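/- Let $\mathrm{Lie}[a,b]$ be the free Lie algebra over $\mathbb Q$ on $a,b$, viewed in $\mathbb Q\langle a,b\rangle$, and put $c=[a,b]$. Let $\mathrm{Lie}_n$ be its part of total degree (weight) $n$ in $a,b$. Let $\mathfrak{der}^{(1,1)}$ be the Lie algebra of derivations $u$ of $\mathrm{Lie}[a,b]$ with $u(c)=0$, and $\mathfrak{der}^{(1,1)}_n$ the space of those $u\in\mathfrak{der}^{(1,1)}$ with $u(a),u(b)\in \mathrm{Lie}_n$. A polynomial $f$ without constant term is written $f=f_a a+f_b b$, and $\mathrm{tr}$ is the projection of $\mathbb Q\langle a,b\rangle$ onto its quotient in which words are identified when they differ by a cyclic permutation of their letters. For $u\in\mathfrak{der}^{(1,1)}$ with $u(a)=f$, $u(b)=g$, put $\mathrm{div}(u)=\mathrm{tr}(f_a+g_b)$. Let $\mathfrak{krv}^{(1,1)}$ be the $\mathbb Q$-vector space spanned by the $u\in\mathfrak{der}^{(1,1)}_n$, $n\ge 3$, such that $\mathrm{div}(u)=K\,\mathrm{tr}\bigl(c^{(n-1)/2}\bigr)$ for some $K\in\mathbb Q$ if $n$ is odd, and $\mathrm{div}(u)=0$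 if $n$ is even. A polynomial mould is a family $F=(F_r)_{r\ge0}$ with $F_r\in\mathbb Q[u_1,\dots,u_r]$, almost all zero; a rational mould is a family of rational functions $A_r$ over $\mathbb Q$ in $r$ variables. Put $$\mathrm{swap}(A)(v_1,\dots,v_r)=A(v_r,v_{r-1}-v_r,\dots,v_1-v_2),\qquad \mathrm{push}(A)(u_1,\dots,u_r)=A(u_2,\dots,u_r,-u_1-\cdots-u_r),$$ $$\mathrm{circ}(A)(v_1,\dots,v_r)=A(v_r,v_1,\dots,v_{r-1}),\qquad \Delta^{-1}(A)(u_1,\dots,u_r)=\frac{A(u_1,\dots,u_r)}{(u_1+\cdots+u_r)\,u_1\cdots u_r}\quad(r\ge1).$$ The mould $F$ is alternal if $F_0=0$ and, for all $r\ge2$ and $1\le k\le r-1$, the sum of $F_r(w)$ over all shuffles $w$ of $(u_1,\dots,u_k)$ and $(u_{k+1},\dots,u_r)$ is $0$; it is push-invariant if $\mathrm{push}(F)=F$. A rational mould $A$ is circ-constant if for every $r\ge2$ there is $K_r\in\mathbb Q$ with $\sum_{i=0}^{r-1}\mathrm{circ}^i(A)(v_1,\dots,v_r)=K_r\,r$.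 Let $\mathfrak{krv}_{ell}$ be the $\mathbb Q$-vector space of polynomial moulds $F$ that are alternal and push-invariant, such that $\mathrm{swap}(\Delta^{-1}F)$ is circ-constant, and such that every monomial of $F_r$ has degree $d$ with $d+r\ge3$. Put $c_i=\mathrm{ad}(a)^{i-1}(b)$ for $i\ge1$. To a polynomial mould $F$ associate the polynomial $p_F\in\mathbb Q\langle a,b\rangle$ by linear extension of $u_1^{a_1-1}\cdots u_r^{a_r-1}\mapsto(-1)^{n+r}c_{a_1}\cdots c_{a_r}$, $n=a_1+\cdots+a_r$. **Main Theorem.** (1) $\mathfrak{krv}^{(1,1)}$ is closed under the bracket of derivations. (2) For each $F\in\mathfrak{krv}_{ell}$ there is a unique $D_F$ in the span of the $\mathfrak{der}^{(1,1)}_n$, $n\ge3$, such that $D_F(a)=p_F$; and $\mathfrak{krv}_{ell}$ is a Lie algebra under the bracket of derivations, i.e. it carries a Lie bracket such that $D_{[F,G]}(a)=[D_F,D_G](a)$, that is, $p_{[F,G]}=[D_F,D_G](a)$, for all $F,G\in\mathfrak{krv}_{ell}$. (3) There is a unique isomorphism of Lie algebras $e:\mathfrak{krv}^{(1,1)}\to\mathfrak{krv}_{ell}$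 such that $p_{e(u)}=u(a)$ for all $u\in\mathfrak{krv}^{(1,1)}$. -/

import Mathlib

noncomputable section

namespace EllKV

open MvPolynomial

/-! ### The free Lie algebra on `a`, `b` and associative words -/

/-- `Lie[a,b]`: the free Lie algebra over `ℚ` on two generators. -/
abbrev LieAB : Type := FreeLieAlgebra ℚ (Fin 2)

/-- The generator `a` of `Lie[a,b]`. -/
def genA : LieAB := FreeLieAlgebra.of ℚ 0

/-- The generator `b` of `Lie[a,b]`. -/
def genB : LieAB := FreeLieAlgebra.of ℚ 1

/-- `ℚ⟨a,b⟩`: noncommutative polynomials in `a` (letter `0`) and `b` (letter `1`), i.e. finite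
linear combinations of words. -/
abbrev Assoc : Type := MonoidAlgebra ℚ (FreeMonoid (Fin 2))

/-- A letter, as an element of `ℚ⟨a,b⟩`. -/
def letter (x : Fin 2) : Assoc := MonoidAlgebra.of ℚ (FreeMonoid (Fin 2)) (FreeMonoid.of x)

section AssocLie

attribute [local instance 100] LieRing.ofAssociativeRing

/-- The canonical map `Lie[a,b] → ℚ⟨a,b⟩`, where the bracket of `ℚ⟨a,b⟩` is the commutator. -/
def toAssoc : LieAB →ₗ[ℚ] Assoc := (FreeLieAlgebra.lift ℚ letter : LieAB →ₗ⁅ℚ⁆ Assoc)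

end AssocLie

/-- `IsLieMonomial n f`: `f` is an iterated bracket of `n` generators. -/
inductive IsLieMonomial : ℕ → LieAB → Prop
  | of (x : Fin 2) : IsLieMonomial 1 (FreeLieAlgebra.of ℚ x)
  | lie {m n : ℕ} {f g : LieAB} :
      IsLieMonomial m f → IsLieMonomial n g → IsLieMonomial (m + n) ⁅f, g⁆

/-- The weight `n` part of `Lie[a,b]` (total degree in `a` and `b`). -/
def lieWeight (n : ℕ) : Submodule ℚ LieAB := Submodule.span ℚ {f | IsLieMonomial n f}

/-- `f ↦ f_x`: if `f` has no constant term, then `f = f_a a + f_b b`, so that the coefficient of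
the word `w` in `f_x` is the coefficient of the word `w x` in `f`. -/
def rightPart (x : Fin 2) : Assoc →ₗ[ℚ] Assoc where
  toFun f := .ofCoeff (Finsupp.comapDomain (fun w => w * FreeMonoid.of x) f.coeff
    (mul_left_injective (FreeMonoid.of x)).injOn)
  map_add' f g := by ext w; simp
  map_smul' k f := by ext w; simp

/-- The space of cyclic words: the quotient of `ℚ⟨a,b⟩` identifying words that differ by a cyclic
permutation of their letters. -/
abbrev CycWords : Type := Cycle (Fin 2) →₀ ℚ

/-- The trace map `tr`, sending a word to its cyclic class. -/
def tr : Assoc →ₗ[ℚ] CycWords where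
  toFun f := Finsupp.mapDomain (fun w => (FreeMonoid.toList w : Cycle (Fin 2))) f.coeff
  map_add' f g := by simp [Finsupp.mapDomain_add]
  map_smul' k f := by simp [Finsupp.mapDomain_smul]

/-! ### Derivations and `krv^{(1,1)}` -/

/-- The Lie algebra of derivations of `Lie[a,b]`, with the commutator bracket. -/
abbrev Der : Type := LieDerivation ℚ LieAB LieAB

/-- `der^{(1,1)}`: the Lie algebra of derivations `u` with `u([a,b]) = 0`. -/
def der11 : LieSubalgebra ℚ Der where
  carrier := {u | u ⁅genA, genB⁆ = 0}
  add_mem' {u v} hu hv := by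
    simp only [Set.mem_ofPred_eq] at hu hv ⊢
    rw [LieDerivation.add_apply, hu, hv, add_zero]
  zero_mem' := by simp
  smul_mem' k u hu := by
    simp only [Set.mem_ofPred_eq] at hu ⊢
    rw [LieDerivation.smul_apply, hu, smul_zero]
  lie_mem' {u v} hu hv := by
    simp only [Set.mem_ofPred_eq] at hu hv ⊢
    change ⁅u, v⁆ ⁅genA, genB⁆ = 0
    rw [LieDerivation.commutator_apply, hu, hv, map_zero, map_zero, sub_zero]

/-- `der^{(1,1)}_n`: the `u ∈ der^{(1,1)}` such that `u(a)` and `u(b)` have weight `n`. -/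
def derWeight (n : ℕ) : Set Der := {u | u ∈ der11 ∧ u genA ∈ lieWeight n ∧ u genB ∈ lieWeight n}

/-- The span of the `der^{(1,1)}_n` with `n ≥ 3`. -/
def derGeThree : Submodule ℚ Der := Submodule.span ℚ {u | ∃ n, 3 ≤ n ∧ u ∈ derWeight n}

/-- The elliptic divergence `div(u) = tr(f_a + g_b)`, where `f = u(a)` and `g = u(b)`. -/
def ellDiv (u : Der) : CycWords :=
  tr (rightPart 0 (toAssoc (u genA)) + rightPart 1 (toAssoc (u genB)))

/-- The divergence condition in weight `n`, with `c = [a,b]`. -/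
def DivCondition (n : ℕ) (u : Der) : Prop :=
  (Odd n → ∃ K : ℚ, ellDiv u = K • tr (toAssoc ⁅genA, genB⁆ ^ ((n - 1) / 2))) ∧
    (Even n → ellDiv u = 0)

/-- The elliptic Kashiwara–Vergne space `krv^{(1,1)}`. -/
def krv11 : Submodule ℚ Der :=
  Submodule.span ℚ {u | ∃ n, 3 ≤ n ∧ u ∈ derWeight n ∧ DivCondition n u}

/-! ### Moulds -/

/-- Polynomials over `ℚ` in `r` commuting variables; the `i`-th variable (`1 ≤ i ≤ r`) is
`X ⟨i - 1, _⟩`. -/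
abbrev Poly (r : ℕ) : Type := MvPolynomial (Fin r) ℚ

/-- Rational functions over `ℚ` in `r` commuting variables. -/
abbrev RatFun (r : ℕ) : Type := FractionRing (Poly r)

/-- Polynomial-valued moulds, i.e. families `(F_r)_{r ≥ 0}` of polynomials `F_r` in `r` variables
of which only finitely many are nonzero. -/
abbrev PolyMould : Type := DirectSum ℕ Poly

/-- Rational-function-valued moulds. -/
abbrev RatMould : Type := ∀ r : ℕ, RatFun r

/-- A polynomial-valued mould seen as a rational mould. -/
def toRatMould (F : PolyMould) : RatMould := fun r => algebraMap (Poly r) (RatFun r) (F r)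

/-- The rational mould which is equal to a given constant in each depth. -/
def constMould (c : ℚ) : RatMould := fun r => algebraMap (Poly r) (RatFun r) (C c)

/-- The shuffles of `(u_1, …, u_k)` and `(u_{k+1}, …, u_r)`, as permutations `σ` which are
increasing on the first `k` and on the last `r - k` indices: `u_i` is put at place `σ(i)`. -/
def shuffles (r k : ℕ) : Finset (Equiv.Perm (Fin r)) := by
  classical
  exact Finset.univ.filter fun σ =>
    ∀ i j : Fin r, i < j → (j.val < k ∨ k ≤ i.val) → σ i < σ j

/-- The sum of `A_r(w)` over the shuffles `w` of `(u_1, …, u_k)` and `(u_{k+1}, …, u_r)`: the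
letter of `w` at place `j` is `u_{σ⁻¹(j)}`. -/
def shuffleSum (r k : ℕ) : Poly r →ₗ[ℚ] Poly r :=
  ∑ σ ∈ shuffles r k, (rename (σ.symm : Fin r → Fin r)).toLinearMap

/-- Alternality of a polynomial-valued mould. -/
def IsAlternal (F : PolyMould) : Prop :=
  F 0 = 0 ∧ ∀ r k : ℕ, 2 ≤ r → 1 ≤ k → k ≤ r - 1 → shuffleSum r k (F r) = 0

/-- `push(A)(u_1, …, u_r) = A(u_2, …, u_r, -u_1 - ⋯ - u_r)`. -/
def pushPoly (r : ℕ) : Poly r →ₐ[ℚ] Poly r :=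
  aeval fun i : Fin r => if h : i.val + 1 < r then X ⟨i.val + 1, h⟩ else -∑ j, X j

/-- Push-invariance of a polynomial-valued mould. -/
def IsPushInvariant (F : PolyMould) : Prop := ∀ r, pushPoly r (F r) = F r

/-- The polynomial `(u_1 + ⋯ + u_r) u_1 ⋯ u_r`. -/
def deltaFactor (r : ℕ) : Poly r := (∑ i, X i) * ∏ i, X i

/-- The operator `Δ⁻¹` on rational moulds, the inverse in depths `r ≥ 1` of
`Δ(A)(u_1, …, u_r) = (u_1 + ⋯ + u_r) u_1 ⋯ u_r A(u_1, …, u_r)`. -/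
def deltaInv (A : RatMould) : RatMould := fun r =>
  A r / algebraMap (Poly r) (RatFun r) (deltaFactor r)

/-- An invertible substitution of variables, extended to rational functions. -/
def ratSubst {r : ℕ} (φ : Poly r ≃ₐ[ℚ] Poly r) : RatFun r ≃+* RatFun r :=
  IsFractionRing.ringEquivOfRingEquiv φ.toRingEquiv

theorem ratSubst_const {r : ℕ} (φ : Poly r ≃ₐ[ℚ] Poly r) (c : ℚ) :
    ratSubst φ (constMould c r) = constMould c r := by
  rw [ratSubst, constMould, IsFractionRing.ringEquivOfRingEquiv_algebraMap]
  congr 1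
  exact φ.commutes c

/-- The variable with index `k`, counted from `0`, and `0` if there is no such variable. -/
def var (r k : ℕ) : Poly r := if h : k < r then X ⟨k, h⟩ else 0

theorem X_eq_var {r : ℕ} (i : Fin r) : (X i : Poly r) = var r i.val := by
  simp [var]

/-- The substitution `u_1 ↦ v_r`, `u_i ↦ v_{r-i+1} - v_{r-i+2}` for `2 ≤ i ≤ r`. With indices
counted from `0`, this is `u_i ↦ v_{r-1-i} - v_{r-i}`, where `v_r` is read as `0`. -/
def swapHom (r : ℕ) : Poly r →ₐ[ℚ] Poly r :=
  aeval fun i : Fin r => var r (r - 1 - i.val) - var r (r - i.val)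

/-- The inverse substitution `v_j ↦ u_1 + ⋯ + u_{r-j+1}`. -/
def swapInvHom (r : ℕ) : Poly r →ₐ[ℚ] Poly r :=
  aeval fun j : Fin r => ∑ k ∈ Finset.range (r - j.val), var r k

theorem swapHom_var {r k : ℕ} (hk : k < r) :
    swapHom r (var r k) = var r (r - 1 - k) - var r (r - k) := by
  simp [var, swapHom, hk]

theorem swapInvHom_var {r k : ℕ} :
    swapInvHom r (var r k) = ∑ j ∈ Finset.range (r - k), var r j := by
  by_cases hk : k < r
  · rw [var, dif_pos hk]
    simp [swapInvHom]
  · rw [var, dif_neg hk, Nat.sub_eq_zero_of_le (not_lt.mp hk)]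
    simp

/-- The substitution which defines `swap`, as an automorphism. -/
def swapEquiv (r : ℕ) : Poly r ≃ₐ[ℚ] Poly r :=
  AlgEquiv.ofAlgHom (swapHom r) (swapInvHom r)
    (by
      ext1 j
      have hj := j.isLt
      have key : ∀ m, m ≤ r → ∑ k ∈ Finset.range m, swapHom r (var r k) = var r (r - m) := by
        intro m
        induction m with
        | zero => intro _; simp [var]
        | succ m ih =>
          intro hm
          rw [Finset.sum_range_succ, ih (by omega), swapHom_var (by omega),
            show r - 1 - m = r - (m + 1) by omega]
          ring
      simp only [AlgHom.comp_apply, AlgHom.id_apply]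
      rw [X_eq_var, swapInvHom_var, map_sum, key _ (by omega),
        show r - (r - j.val) = j.val by omega])
    (by
      ext1 i
      have hi := i.isLt
      simp only [AlgHom.comp_apply, AlgHom.id_apply]
      rw [X_eq_var, swapHom_var hi, map_sub, swapInvHom_var, swapInvHom_var,
        show r - (r - 1 - i.val) = i.val + 1 by omega,
        show r - (r - i.val) = i.val by omega, Finset.sum_range_succ]
      ring)

/-- `swap(A)(v_1, …, v_r) = A(v_r, v_{r-1} - v_r, …, v_1 - v_2)`. -/
def swap (A : RatMould) : RatMould := fun r => ratSubst (swapEquiv r) (A r)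

/-- `circ(A)(v_1, …, v_r) = A(v_r, v_1, …, v_{r-1})`. -/
def circ (A : RatMould) : RatMould := fun r =>
  ratSubst (renameEquiv ℚ (finRotate r).symm) (A r)

theorem circ_iterate_add (A B : RatMould) (i : ℕ) :
    circ^[i] (A + B) = circ^[i] A + circ^[i] B := by
  induction i generalizing A B with
  | zero => rfl
  | succ i ih =>
    have h : circ (A + B) = circ A + circ B := by
      funext r
      simp [circ]
    rw [Function.iterate_succ_apply, Function.iterate_succ_apply, Function.iterate_succ_apply,
      h, ih]

theorem circ_iterate_const_mul (c : ℚ) (A : RatMould) (i : ℕ) :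
    circ^[i] (constMould c * A) = constMould c * circ^[i] A := by
  induction i generalizing A with
  | zero => rfl
  | succ i ih =>
    have h : circ (constMould c * A) = constMould c * circ A := by
      funext r
      simp only [circ, Pi.mul_apply, map_mul, ratSubst_const]
    rw [Function.iterate_succ_apply, Function.iterate_succ_apply, h, ih]

/-- Circ-constance: in each depth `r ≥ 2`, the sum of the `r` cyclic permutations of `A_r` is a
constant, written `K r`. -/
def IsCircConstant (A : RatMould) : Prop :=
  ∀ r : ℕ, 2 ≤ r → ∃ K : ℚ,
    ∑ i ∈ Finset.range r, (circ^[i] A) r = algebraMap (Poly r) (RatFun r) (C (K * r))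

theorem swap_deltaInv_add (F G : PolyMould) :
    swap (deltaInv (toRatMould (F + G))) =
      swap (deltaInv (toRatMould F)) + swap (deltaInv (toRatMould G)) := by
  funext r
  simp only [swap, deltaInv, toRatMould, Pi.add_apply, DirectSum.add_apply, map_add, add_div]

theorem swap_deltaInv_smul (c : ℚ) (F : PolyMould) :
    swap (deltaInv (toRatMould (c • F))) =
      constMould c * swap (deltaInv (toRatMould F)) := by
  funext r
  rw [Pi.mul_apply, ← ratSubst_const (swapEquiv r) c]
  simp only [swap, deltaInv, toRatMould]
  rw [← map_mul, DirectSum.smul_apply, smul_eq_C_mul, map_mul, mul_div_assoc]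
  rfl

/-- All monomials of `F_r` have degree `d` with `d + r ≥ 3`. -/
def IsWeightGeThree (F : PolyMould) : Prop :=
  ∀ (r : ℕ) (m : Fin r →₀ ℕ), coeff m (F r) ≠ 0 → 3 ≤ m.degree + r

/-- The mould version of `krv_ell`. -/
def krvEll : Submodule ℚ PolyMould where
  carrier := {F | IsAlternal F ∧ IsPushInvariant F ∧
    IsCircConstant (swap (deltaInv (toRatMould F))) ∧ IsWeightGeThree F}
  zero_mem' := by
    refine ⟨⟨rfl, fun r k _ _ _ => ?_⟩, fun r => ?_, fun r _ => ⟨0, ?_⟩, fun r m h => ?_⟩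
    · rw [DirectSum.zero_apply, map_zero]
    · rw [DirectSum.zero_apply, map_zero]
    · have h0 : swap (deltaInv (toRatMould 0)) = 0 := by
        simpa using swap_deltaInv_add 0 0
      have h1 : ∀ i, circ^[i] (0 : RatMould) = 0 := fun i => by
        simpa using circ_iterate_add 0 0 i
      simp only [h0, h1]
      simp
    · simp at h
  add_mem' := by
    rintro F G ⟨⟨hF0, hF1⟩, hF2, hF3, hF4⟩ ⟨⟨hG0, hG1⟩, hG2, hG3, hG4⟩
    refine ⟨⟨?_, fun r k h1 h2 h3 => ?_⟩, fun r => ?_, fun r hr => ?_, fun r m h => ?_⟩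
    · rw [DirectSum.add_apply, hF0, hG0, add_zero]
    · rw [DirectSum.add_apply, map_add, hF1 r k h1 h2 h3, hG1 r k h1 h2 h3, add_zero]
    · rw [DirectSum.add_apply, map_add, hF2 r, hG2 r]
    · obtain ⟨K, hK⟩ := hF3 r hr
      obtain ⟨L, hL⟩ := hG3 r hr
      refine ⟨K + L, ?_⟩
      simp only [swap_deltaInv_add, circ_iterate_add, Pi.add_apply, Finset.sum_add_distrib]
      rw [hK, hL, ← map_add, ← map_add, add_mul]
    · rw [DirectSum.add_apply, coeff_add] at h
      by_cases h' : coeff m (F r) = 0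
      · exact hG4 r m fun h'' => h (by rw [h', h'', add_zero])
      · exact hF4 r m h'
  smul_mem' := by
    rintro c F ⟨⟨hF0, hF1⟩, hF2, hF3, hF4⟩
    refine ⟨⟨?_, fun r k h1 h2 h3 => ?_⟩, fun r => ?_, fun r hr => ?_, fun r m h => ?_⟩
    · rw [DirectSum.smul_apply, hF0, smul_zero]
    · rw [DirectSum.smul_apply, map_smul, hF1 r k h1 h2 h3, smul_zero]
    · rw [DirectSum.smul_apply, map_smul, hF2 r]
    · obtain ⟨K, hK⟩ := hF3 r hr
      refine ⟨c * K, ?_⟩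
      simp only [swap_deltaInv_smul, circ_iterate_const_mul, Pi.mul_apply]
      rw [← Finset.mul_sum, hK, constMould, ← map_mul, ← map_mul, mul_assoc]
    · rw [DirectSum.smul_apply, coeff_smul] at h
      exact hF4 r m fun h' => h (by rw [h', smul_zero])

/-! ### From moulds to polynomials in `a`, `b` -/

/-- `c_i = ad(a)^{i-1}(b)` for `i ≥ 1`, in `ℚ⟨a,b⟩`. -/
def cElt (i : ℕ) : Assoc := (fun x => letter 0 * x - x * letter 0)^[i - 1] (letter 1)

/-- The map sending `u_1^{a_1 - 1} ⋯ u_r^{a_r - 1}` to `(-1)^{n + r} c_{a_1} ⋯ c_{a_r}`,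
where `n = a_1 + ⋯ + a_r`. -/
def polyOfDepth (r : ℕ) : Poly r →ₗ[ℚ] Assoc :=
  (basisMonomials (Fin r) ℚ).constr ℚ fun m =>
    (-1 : ℚ) ^ ((∑ i, (m i + 1)) + r) • (List.ofFn fun i : Fin r => cElt (m i + 1)).prod

/-- The noncommutative polynomial in `a`, `b` corresponding to a polynomial-valued mould. -/
def polyOfMould : PolyMould →ₗ[ℚ] Assoc := DirectSum.toModule ℚ ℕ Assoc polyOfDepth

/-- The mould `F` represents the derivation `u`: `F` corresponds to the polynomial `u(a)`. -/
def Represents (F : PolyMould) (u : Der) : Prop := polyOfMould F = toAssoc (u genA)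

/-! ### Lie brackets on a vector space -/

/-- A Lie bracket on a `ℚ`-vector space. -/
structure LieBracketOn (M : Type) [AddCommGroup M] [Module ℚ M] where
  /-- the bracket -/
  br : M →ₗ[ℚ] M →ₗ[ℚ] M
  br_self : ∀ x, br x x = 0
  jacobi : ∀ x y z, br x (br y z) = br (br x y) z + br y (br x z)

/-- The Lie ring given by a Lie bracket. -/
abbrev LieBracketOn.lieRing {M : Type} [AddCommGroup M] [Module ℚ M] (β : LieBracketOn M) :
    LieRing M where
  bracket x y := β.br x y
  add_lie x y z := by change β.br (x + y) z = β.br x z + β.br y z; simp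
  lie_add x y z := by change β.br x (y + z) = β.br x y + β.br x z; simp
  lie_self x := β.br_self x
  leibniz_lie x y z := β.jacobi x y z

/-- The Lie algebra given by a Lie bracket. -/
abbrev LieBracketOn.lieAlgebra {M : Type} [AddCommGroup M] [Module ℚ M] (β : LieBracketOn M) :
    letI := β.lieRing
    LieAlgebra ℚ M :=
  letI := β.lieRing
  { lie_smul := fun t x y => by change β.br x (t • y) = t • β.br x y; simp }

end EllKV

end

open EllKV

noncomputable section

namespace EllKV

open MvPolynomial

/-! Everything is read in commutative coordinates: the word `a^{i_0} b a^{i_1} b ⋯ b a^{i_r}`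
becomes the monomial `x_0^{i_0} ⋯ x_r^{i_r}` in depth `r`. In depth `r`, left and right
multiplication by `a` are multiplication by `x_0` and `x_r`; left multiplication by `b` shifts the
variables and raises the depth, and right multiplication by `b` only raises the depth. The
polynomial of a mould `F` has the coordinates `F_r(x_1 - x_0, …, x_r - x_{r-1})`
(`coords_polyOfMould`), so it determines `F`. Each condition on moulds then translates one condition
on derivations.

Alternality means being Lie. Bracketing with `a` multiplies by `-(u_1 + ⋯ + u_r)` and bracketing
with `b` sends `p` to `p(u_2, …, u_{r+1}) - p(u_1, …, u_r)`; both preserve alternality, so Lie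
elements of weight at least 2 are alternal (`toAssoc_mem_altSpan`). Conversely, replacing products
of the `c_i` by right-normed brackets multiplies an alternal polynomial of depth `r` by `r`
(`bracketSum_of_alternal`), a Dynkin argument with respect to depth.

Push-invariance means killing `c`. The equation `u(c) = 0` reads `(x_{r+1} - x_0) g_{r+1} = f_r -
shift(f_r)` for `f = u(a)`, `g = u(b)` (`coords_der11`). Setting `u_{r+1} = -u_1 - ⋯ - u_r` shows
that `F` is push-invariant; conversely push-invariance makes the right side divisible by the sum of
the variables, and the quotient is again alternal, so it yields a Lie element `u(b)`
(`exists_der_of_depth`).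

Circ-constance is the divergence condition. Cyclic words of depth `n + 1` are detected by summing
the coordinates over the substitutions `x_i ↦ y_{i+j}` with `i + j` read modulo `n + 1`. If `R_j`
denotes `F_{n+1}(y_{j+1}, y_{j+2} - y_{j+1}, …)`, then the substituted divergence times `y_j` is
`R_j - R_{j-1}` (`cycVar_mul_cycSubst_preDiv`). On the mould side, the partial fraction `1/y_k -
1/y_{k+1}` and a summation by parts show that the sum of the cyclic permutations of `swap(Δ⁻¹F)` is
the cyclic sum of the divergence divided by `∏ (y_{z+1} - y_z)` (`sum_circ_swap_mul`). Since that
product is, up to a constant, the cyclic sum of `c^{n+1}` (`cycSum_c_pow`), the two conditions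
agree.

Closure under the bracket holds because the divergence is a cocycle (`ellDiv_lie`) and derivations
in `der11` annihilate the powers of `c`. The Lie bracket on `krvEll` is the one transported along
the resulting linear isomorphism `mouldEquiv`. -/

/-! ### Induction and weights in the free Lie algebra -/

theorem toAssoc_of (x : Fin 2) : toAssoc (FreeLieAlgebra.of ℚ x) = letter x := by
  let _ : LieRing Assoc := LieRing.ofAssociativeRing
  exact FreeLieAlgebra.lift_of_apply (R := ℚ) letter x

theorem toAssoc_lie (f g : LieAB) :
    toAssoc ⁅f, g⁆ = toAssoc f * toAssoc g - toAssoc g * toAssoc f := by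
  let _ : LieRing Assoc := LieRing.ofAssociativeRing
  exact LieHom.map_lie (FreeLieAlgebra.lift ℚ letter : LieAB →ₗ⁅ℚ⁆ Assoc) f g

/-- A subspace of `Lie[a,b]` that is closed under brackets and contains the generators is
everything. -/
theorem lieAB_induction {p : LieAB → Prop} (hof : ∀ x, p (FreeLieAlgebra.of ℚ x))
    (hadd : ∀ f g, p f → p g → p (f + g)) (hsmul : ∀ (t : ℚ) f, p f → p (t • f))
    (hlie : ∀ f g, p f → p g → p ⁅f, g⁆) (f : LieAB) : p f := by
  let S : LieSubalgebra ℚ LieAB :=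
    { carrier := {f | p f}
      add_mem' := fun {f g} hf hg => hadd f g hf hg
      zero_mem' := by simpa using hsmul 0 _ (hof 0)
      smul_mem' := fun t f hf => hsmul t f hf
      lie_mem' := fun {f g} hf hg => hlie f g hf hg }
  let φ : LieAB →ₗ⁅ℚ⁆ S := FreeLieAlgebra.lift ℚ fun x => ⟨FreeLieAlgebra.of ℚ x, hof x⟩
  have h : S.incl.comp φ = LieHom.id := by
    apply FreeLieAlgebra.hom_ext
    intro x
    simp [φ, FreeLieAlgebra.lift_of_apply]
  have h2 := LieHom.congr_fun h f
  rw [LieHom.comp_apply] at h2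
  change ((φ f : S) : LieAB) = f at h2
  rw [← h2]
  exact (φ f).2

theorem of_mem_lieWeight (x : Fin 2) : FreeLieAlgebra.of ℚ x ∈ lieWeight 1 :=
  Submodule.subset_span (IsLieMonomial.of x)

theorem lie_mem_lieWeight {m n : ℕ} {f g : LieAB} (hf : f ∈ lieWeight m) (hg : g ∈ lieWeight n) :
    ⁅f, g⁆ ∈ lieWeight (m + n) := by
  induction hf using Submodule.span_induction with
  | mem f hf =>
    induction hg using Submodule.span_induction with
    | mem g hg => exact Submodule.subset_span (IsLieMonomial.lie hf hg)
    | zero => simp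
    | add g g' _ _ h h' => rw [lie_add]; exact add_mem h h'
    | smul t g _ h => rw [lie_smul]; exact Submodule.smul_mem _ _ h
  | zero => simp
  | add g g' _ _ h h' => rw [add_lie]; exact add_mem h h'
  | smul t g _ h => rw [smul_lie]; exact Submodule.smul_mem _ _ h

theorem IsLieMonomial.pos {n : ℕ} {f : LieAB} (h : IsLieMonomial n f) : 1 ≤ n := by
  induction h with
  | of x => exact le_rfl
  | lie _ _ h1 h2 => omega

theorem lieWeight_zero : lieWeight 0 = ⊥ := by
  rw [lieWeight, Submodule.span_eq_bot]
  intro f hf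
  exact absurd (IsLieMonomial.pos hf) (by norm_num)

theorem mem_iSup_lieWeight (f : LieAB) : f ∈ ⨆ n, lieWeight n := by
  induction f using lieAB_induction with
  | hof x => exact Submodule.mem_iSup_of_mem 1 (of_mem_lieWeight x)
  | hadd f g hf hg => exact add_mem hf hg
  | hsmul t f hf => exact Submodule.smul_mem _ _ hf
  | hlie f g hf hg =>
    induction hf using Submodule.iSup_induction' with
    | mem m f hf =>
      induction hg using Submodule.iSup_induction' with
      | mem n g hg => exact Submodule.mem_iSup_of_mem (m + n) (lie_mem_lieWeight hf hg)
      | zero => simp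
      | add g g' _ _ h h' => rw [lie_add]; exact add_mem h h'
    | zero => simp
    | add g g' _ _ h h' => rw [add_lie]; exact add_mem h h'

/-! ### Words -/

/-- A word, as an element of `ℚ⟨a,b⟩`. -/
def word (w : FreeMonoid (Fin 2)) : Assoc := MonoidAlgebra.of ℚ _ w

theorem word_mul (v w : FreeMonoid (Fin 2)) : word (v * w) = word v * word w :=
  map_mul (MonoidAlgebra.of ℚ _) v w

theorem word_one : word 1 = 1 := map_one (MonoidAlgebra.of ℚ _)

theorem word_of (x : Fin 2) : word (FreeMonoid.of x) = letter x := rfl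

theorem coeff_word (w : FreeMonoid (Fin 2)) : (word w).coeff = Finsupp.single w 1 := rfl

theorem assoc_induction {p : Assoc → Prop} (hword : ∀ w, p (word w))
    (hadd : ∀ f g, p f → p g → p (f + g)) (hsmul : ∀ (t : ℚ) f, p f → p (t • f)) (f : Assoc) :
    p f :=
  MonoidAlgebra.induction_on f hword hadd hsmul

theorem assoc_hom_ext {M : Type*} [AddCommMonoid M] [Module ℚ M] {φ ψ : Assoc →ₗ[ℚ] M}
    (h : ∀ w, φ (word w) = ψ (word w)) : φ = ψ := by
  refine LinearMap.ext fun f => ?_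
  induction f using assoc_induction with
  | hword w => exact h w
  | hadd f g hf hg => rw [map_add, map_add, hf, hg]
  | hsmul t f hf => rw [map_smul, map_smul, hf]

/-- The linear map with prescribed values on words. -/
def onWords {M : Type*} [AddCommMonoid M] [Module ℚ M] (φ : FreeMonoid (Fin 2) → M) :
    Assoc →ₗ[ℚ] M :=
  (Finsupp.linearCombination ℚ φ).comp (MonoidAlgebra.coeffLinearEquiv ℚ).toLinearMap

theorem onWords_word {M : Type*} [AddCommMonoid M] [Module ℚ M] (φ : FreeMonoid (Fin 2) → M)
    (w : FreeMonoid (Fin 2)) : onWords φ (word w) = φ w := by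
  change Finsupp.linearCombination ℚ φ (word w).coeff = φ w
  rw [coeff_word, Finsupp.linearCombination_single, one_smul]

/-- The component of degree `n`. -/
def degreePart (n : ℕ) : Assoc →ₗ[ℚ] Assoc :=
  onWords fun w => if w.length = n then word w else 0

/-- The homogeneous elements of degree `n`. -/
def assocWeight (n : ℕ) : Submodule ℚ Assoc :=
  Submodule.span ℚ {f | ∃ w : FreeMonoid (Fin 2), w.length = n ∧ f = word w}

theorem word_mem_assocWeight {n : ℕ} {w : FreeMonoid (Fin 2)} (h : w.length = n) :
    word w ∈ assocWeight n :=
  Submodule.subset_span ⟨w, h, rfl⟩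

theorem mul_mem_assocWeight {m n : ℕ} {f g : Assoc} (hf : f ∈ assocWeight m)
    (hg : g ∈ assocWeight n) : f * g ∈ assocWeight (m + n) := by
  induction hf using Submodule.span_induction with
  | mem f hf =>
    induction hg using Submodule.span_induction with
    | mem g hg =>
      obtain ⟨v, hv, rfl⟩ := hf
      obtain ⟨w, hw, rfl⟩ := hg
      rw [← word_mul]
      exact word_mem_assocWeight (by rw [FreeMonoid.length_mul, hv, hw])
    | zero => simp
    | add g g' _ _ h h' => rw [mul_add]; exact add_mem h h'
    | smul t g _ h => rw [mul_smul_comm]; exact Submodule.smul_mem _ _ h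
  | zero => simp
  | add g g' _ _ h h' => rw [add_mul]; exact add_mem h h'
  | smul t g _ h => rw [smul_mul_assoc]; exact Submodule.smul_mem _ _ h

theorem toAssoc_mem_assocWeight {n : ℕ} {f : LieAB} (hf : f ∈ lieWeight n) :
    toAssoc f ∈ assocWeight n := by
  induction hf using Submodule.span_induction with
  | mem f hf =>
    induction hf with
    | of x => rw [toAssoc_of, ← word_of]; exact word_mem_assocWeight rfl
    | @lie m n f g _ _ h1 h2 =>
      rw [toAssoc_lie]
      exact sub_mem (mul_mem_assocWeight h1 h2) (add_comm m n ▸ mul_mem_assocWeight h2 h1)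
  | zero => simp
  | add g g' _ _ h h' => rw [map_add]; exact add_mem h h'
  | smul t g _ h => rw [map_smul]; exact Submodule.smul_mem _ _ h

theorem degreePart_of_mem {m n : ℕ} {f : Assoc} (hf : f ∈ assocWeight m) :
    degreePart n f = if m = n then f else 0 := by
  induction hf using Submodule.span_induction with
  | mem f hf =>
    obtain ⟨w, rfl, rfl⟩ := hf
    rw [degreePart, onWords_word]
  | zero => simp
  | add g g' _ _ h h' => rw [map_add, h, h']; split_ifs <;> simp
  | smul t g _ h => rw [map_smul, h]; split_ifs <;> simp

/-! ### Injectivity of `Lie[a,b] → ℚ⟨a,b⟩` -/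

/-- The extension of the adjoint action to `ℚ⟨a,b⟩`. -/
def adAssoc : Assoc →ₐ[ℚ] Module.End ℚ LieAB :=
  MonoidAlgebra.lift ℚ _ _
    (FreeMonoid.lift fun x => (LieAlgebra.ad ℚ LieAB (FreeLieAlgebra.of ℚ x) : Module.End ℚ LieAB))

theorem adAssoc_letter (x : Fin 2) :
    adAssoc (letter x) = LieAlgebra.ad ℚ LieAB (FreeLieAlgebra.of ℚ x) := by
  rw [adAssoc, letter, MonoidAlgebra.lift_of, FreeMonoid.lift_eval_of]

theorem adAssoc_toAssoc (f : LieAB) : adAssoc (toAssoc f) = LieAlgebra.ad ℚ LieAB f := by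
  induction f using lieAB_induction with
  | hof x => rw [toAssoc_of, adAssoc_letter]
  | hadd f g hf hg => rw [map_add, map_add, map_add, hf, hg]
  | hsmul t f hf => rw [map_smul, map_smul, map_smul, hf]
  | hlie f g hf hg =>
    ext x
    rw [toAssoc_lie, map_sub, map_mul, map_mul, hf, hg, LinearMap.sub_apply,
      Module.End.mul_apply, Module.End.mul_apply]
    simp only [LieAlgebra.ad_apply, lie_lie]

/-- The right-normed bracketing of a word. -/
def bracketList : List (Fin 2) → LieAB
  | [] => 0
  | [x] => FreeLieAlgebra.of ℚ x
  | x :: y :: w => ⁅FreeLieAlgebra.of ℚ x, bracketList (y :: w)⁆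

/-- The map of Dynkin, `x_1 ⋯ x_n ↦ [x_1, [x_2, …, x_n]]`. -/
def dynkin : Assoc →ₗ[ℚ] LieAB := onWords fun w => bracketList w.toList

theorem dynkin_letter (x : Fin 2) : dynkin (letter x) = FreeLieAlgebra.of ℚ x := by
  rw [← word_of, dynkin, onWords_word]
  rfl

/-- The letter `x` keeps the right factor nonempty: prepending `y` to a word is `ad y` on
right-normed brackets only then, since a one-letter word goes to its letter and the empty word to 0.
-/
theorem dynkin_word_mul_letter_mul (v w : FreeMonoid (Fin 2)) (x : Fin 2) :
    dynkin (word (v * (FreeMonoid.of x * w))) =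
      adAssoc (word v) (dynkin (word (FreeMonoid.of x * w))) := by
  induction v using FreeMonoid.inductionOn' with
  | one => rw [word_one, map_one, one_mul]; rfl
  | of_mul y v ih =>
    rw [mul_assoc, word_mul _ v, map_mul, word_of, Module.End.mul_apply, ← ih, adAssoc_letter]
    simp only [dynkin, onWords_word]
    obtain ⟨z, l, h⟩ : ∃ z l, (v * (FreeMonoid.of x * w)).toList = z :: l := by
      cases h : (v * (FreeMonoid.of x * w)).toList with
      | nil => simp [FreeMonoid.toList_mul] at h
      | cons z l => exact ⟨z, l, rfl⟩
    rw [FreeMonoid.toList_mul, h]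
    rfl

theorem dynkin_mul (f : Assoc) {n : ℕ} {g : Assoc} (hn : n ≠ 0) (hg : g ∈ assocWeight n) :
    dynkin (f * g) = adAssoc f (dynkin g) := by
  induction hg using Submodule.span_induction with
  | mem g hg =>
    obtain ⟨w, hw, rfl⟩ := hg
    induction w using FreeMonoid.casesOn with
    | one => exact absurd hw.symm hn
    | of_mul x w =>
      induction f using assoc_induction with
      | hword v => rw [← word_mul, dynkin_word_mul_letter_mul]
      | hadd f g hf hg => rw [add_mul, map_add, map_add, hf, hg, LinearMap.add_apply]
      | hsmul t f hf => rw [smul_mul_assoc, map_smul, map_smul, hf, LinearMap.smul_apply]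
  | zero => simp
  | add g g' _ _ h h' => rw [mul_add, map_add, map_add, h, h', map_add]
  | smul t g _ h => rw [mul_smul_comm, map_smul, map_smul, h, map_smul]

/-- Dynkin–Specht–Wever: by induction `[f, g]` goes to `ad f (n g) - ad g (m f)`, which is `(m + n)
[f, g]`. -/
theorem dynkin_toAssoc {n : ℕ} {f : LieAB} (hf : f ∈ lieWeight n) :
    dynkin (toAssoc f) = (n : ℚ) • f := by
  induction hf using Submodule.span_induction with
  | mem f hf =>
    induction hf with
    | of x => rw [toAssoc_of, dynkin_letter, Nat.cast_one, one_smul]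
    | @lie m n f g hf hg h1 h2 =>
      rw [toAssoc_lie, map_sub,
        dynkin_mul _ (by have := hg.pos; omega)
          (toAssoc_mem_assocWeight (Submodule.subset_span hg)),
        dynkin_mul _ (by have := hf.pos; omega)
          (toAssoc_mem_assocWeight (Submodule.subset_span hf)), h1, h2,
        adAssoc_toAssoc, adAssoc_toAssoc, map_smul, map_smul, LieAlgebra.ad_apply,
        LieAlgebra.ad_apply, ← lie_skew g f, smul_neg, sub_neg_eq_add, Nat.cast_add]
      module
  | zero => simp
  | add g g' _ _ h h' => rw [map_add, map_add, h, h', smul_add]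
  | smul t g _ h => rw [map_smul, map_smul, h, smul_comm]

/-- The degree `n` part of the image determines `n` times the weight `n` part of `f` through the
Dynkin map, and `n` is invertible in `ℚ`. Weight 0 is trivial. -/
theorem toAssoc_injective : Function.Injective toAssoc := by
  rw [injective_iff_map_eq_zero]
  intro f hf
  obtain ⟨F, hF, rfl⟩ := (Submodule.mem_iSup_iff_exists_finsupp _ _).1 (mem_iSup_lieWeight f)
  have key : ∀ n, F n = 0 := by
    intro n
    have h1 : degreePart n (toAssoc (F.sum fun _ x => x)) = toAssoc (F n) := by
      rw [Finsupp.sum, map_sum, map_sum, Finset.sum_congr rfl fun m _ =>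
        degreePart_of_mem (toAssoc_mem_assocWeight (hF m)), Finset.sum_ite_eq']
      split_ifs with h
      · rfl
      · rw [Finsupp.notMem_support_iff.1 h, map_zero]
    rw [hf, map_zero] at h1
    have h2 := dynkin_toAssoc (hF n)
    rw [← h1, map_zero] at h2
    rcases Nat.eq_zero_or_pos n with rfl | hn
    · have := hF 0
      rwa [lieWeight_zero, Submodule.mem_bot] at this
    · exact (smul_eq_zero.1 h2.symm).resolve_left (by positivity)
  simp [Finsupp.sum, key]

/-! ### Derivations of `ℚ⟨a,b⟩` -/

/-- The value on a word of the derivation with prescribed values on letters. -/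
def assocDerList (φ : Fin 2 → Assoc) : List (Fin 2) → Assoc
  | [] => 0
  | x :: w => φ x * word (FreeMonoid.ofList w) + letter x * assocDerList φ w

/-- The derivation of `ℚ⟨a,b⟩` with prescribed values on letters. -/
def assocDer (φ : Fin 2 → Assoc) : Assoc →ₗ[ℚ] Assoc := onWords fun w => assocDerList φ w.toList

theorem assocDer_letter_mul_word (φ : Fin 2 → Assoc) (x : Fin 2) (w : FreeMonoid (Fin 2)) :
    assocDer φ (word (FreeMonoid.of x * w)) =
      φ x * word w + letter x * assocDer φ (word w) := by
  simp only [assocDer, onWords_word]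
  rfl

theorem assocDer_one (φ : Fin 2 → Assoc) : assocDer φ 1 = 0 := by
  rw [← word_one, assocDer, onWords_word]
  rfl

theorem assocDer_letter (φ : Fin 2 → Assoc) (x : Fin 2) : assocDer φ (letter x) = φ x := by
  have h := assocDer_letter_mul_word φ x 1
  rwa [mul_one, word_one, mul_one, assocDer_one, mul_zero, add_zero, word_of] at h

theorem assocDer_mul (φ : Fin 2 → Assoc) (f g : Assoc) :
    assocDer φ (f * g) = assocDer φ f * g + f * assocDer φ g := by
  induction f using assoc_induction with
  | hword v =>
    induction g using assoc_induction with
    | hword w =>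
      induction v using FreeMonoid.inductionOn' with
      | one => rw [word_one, one_mul, assocDer_one, zero_mul, zero_add, one_mul]
      | of_mul x v ih =>
        rw [← word_mul, mul_assoc, assocDer_letter_mul_word, assocDer_letter_mul_word, word_mul v w,
          ih, word_mul, word_of]
        noncomm_ring
    | hadd f g hf hg => rw [mul_add, map_add, hf, hg, map_add]; noncomm_ring
    | hsmul t f hf =>
      rw [mul_smul_comm, map_smul, hf, map_smul, mul_smul_comm, mul_smul_comm, smul_add]
  | hadd f g hf hg => rw [add_mul, map_add, hf, hg, map_add]; noncomm_ring
  | hsmul t f hf =>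
    rw [smul_mul_assoc, map_smul, hf, map_smul, smul_mul_assoc, smul_mul_assoc, smul_add]

/-- The derivation of `ℚ⟨a,b⟩` which extends a derivation of `Lie[a,b]`. -/
def extendDer (u : Der) : Assoc →ₗ[ℚ] Assoc :=
  assocDer fun x => toAssoc (u (FreeLieAlgebra.of ℚ x))

theorem extendDer_toAssoc (u : Der) (f : LieAB) : extendDer u (toAssoc f) = toAssoc (u f) := by
  induction f using lieAB_induction with
  | hof x => rw [toAssoc_of, extendDer, assocDer_letter]
  | hadd f g hf hg => simp only [map_add, hf, hg]
  | hsmul t f hf => simp only [map_smul, hf]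
  | hlie f g hf hg =>
    rw [LieDerivation.apply_lie_eq_add, toAssoc_lie, map_sub, map_add, toAssoc_lie, toAssoc_lie]
    simp only [extendDer, assocDer_mul] at hf hg ⊢
    rw [hf, hg]
    abel

theorem Der.ext_of {u v : Der}
    (h : ∀ x, u (FreeLieAlgebra.of ℚ x) = v (FreeLieAlgebra.of ℚ x)) : u = v := by
  ext f
  induction f using lieAB_induction with
  | hof x => exact h x
  | hadd f g hf hg => rw [map_add, map_add, hf, hg]
  | hsmul t f hf => rw [map_smul, map_smul, hf]
  | hlie f g hf hg =>
    rw [LieDerivation.apply_lie_eq_add, LieDerivation.apply_lie_eq_add, hf, hg]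

theorem Der.ext_gen {u v : Der} (ha : u genA = v genA) (hb : u genB = v genB) : u = v :=
  Der.ext_of fun x => by fin_cases x; exacts [ha, hb]

/-- The derivation is first built on `ℚ⟨a,b⟩`, where words form a basis. It preserves the image of
`Lie[a,b]`, and injectivity of `toAssoc` brings it back. -/
theorem exists_der (f g : LieAB) : ∃ u : Der, u genA = f ∧ u genB = g := by
  let φ : Fin 2 → LieAB := ![f, g]
  let D := assocDer fun x => toAssoc (φ x)
  have hD : ∀ h : LieAB, ∃ k : LieAB, toAssoc k = D (toAssoc h) := by
    intro h
    induction h using lieAB_induction with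
    | hof x => exact ⟨φ x, by rw [toAssoc_of]; exact (assocDer_letter (fun x => toAssoc (φ x)) x).symm⟩
    | hadd f g hf hg =>
      obtain ⟨k, hk⟩ := hf
      obtain ⟨l, hl⟩ := hg
      exact ⟨k + l, by rw [map_add, hk, hl, map_add, map_add]⟩
    | hsmul t f hf =>
      obtain ⟨k, hk⟩ := hf
      exact ⟨t • k, by rw [map_smul, hk, map_smul, map_smul]⟩
    | hlie f g hf hg =>
      obtain ⟨k, hk⟩ := hf
      obtain ⟨l, hl⟩ := hg
      refine ⟨⁅k, g⁆ + ⁅f, l⁆, ?_⟩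
      rw [map_add, toAssoc_lie, toAssoc_lie, toAssoc_lie, hk, hl]
      simp only [D, map_sub, assocDer_mul]
      abel
  choose d hd using hD
  have hder : ∀ f g, d ⁅f, g⁆ = ⁅f, d g⁆ - ⁅g, d f⁆ := fun f g => toAssoc_injective <| by
    rw [hd, map_sub, toAssoc_lie, toAssoc_lie, toAssoc_lie, hd, hd]
    simp only [D, map_sub, assocDer_mul]
    abel
  have hof : ∀ x, d (FreeLieAlgebra.of ℚ x) = φ x := fun x => toAssoc_injective <| by
    rw [hd, toAssoc_of]
    exact assocDer_letter _ x
  let u : Der :=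
    { toFun := d
      map_add' := fun f g => toAssoc_injective (by simp only [hd, map_add])
      map_smul' := fun t f => toAssoc_injective (by
        simp only [hd, map_smul, RingHom.id_apply])
      leibniz' := hder }
  exact ⟨u, hof 0, hof 1⟩

/-- Each term of the Leibniz rule replaces one generator, of weight 1, by an element of weight `m +
1`, so `u` has degree `m`. -/
theorem der_mem_lieWeight {u : Der} {m n : ℕ} (ha : u genA ∈ lieWeight (m + 1))
    (hb : u genB ∈ lieWeight (m + 1)) {f : LieAB} (hf : f ∈ lieWeight n) :
    u f ∈ lieWeight (m + n) := by
  induction hf using Submodule.span_induction with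
  | mem f hf =>
    induction hf with
    | of x => fin_cases x; exacts [ha, hb]
    | @lie k l f g hf hg h1 h2 =>
      rw [LieDerivation.apply_lie_eq_add]
      refine add_mem ?_ ?_
      · rw [show m + (k + l) = k + (m + l) by omega]
        exact lie_mem_lieWeight (Submodule.subset_span hf) h2
      · rw [show m + (k + l) = (m + k) + l by omega]
        exact lie_mem_lieWeight h1 (Submodule.subset_span hg)
  | zero => simp
  | add g g' _ _ h h' => rw [map_add]; exact add_mem h h'
  | smul t g _ h => rw [map_smul]; exact Submodule.smul_mem _ _ h

/-! ### Right parts and the trace -/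

/-- The constant term. -/
def constTerm : Assoc →ₗ[ℚ] ℚ := onWords fun w => if w.length = 0 then 1 else 0

theorem constTerm_mul (f g : Assoc) : constTerm (f * g) = constTerm f * constTerm g := by
  induction f using assoc_induction with
  | hword v =>
    induction g using assoc_induction with
    | hword w =>
      simp only [← word_mul, constTerm, onWords_word]
      simp only [FreeMonoid.length_mul, Nat.add_eq_zero_iff, ite_and, ite_mul, one_mul, zero_mul]
    | hadd f g hf hg => rw [mul_add, map_add, hf, hg, map_add]; ring
    | hsmul t f hf => rw [mul_smul_comm, map_smul, hf, map_smul]; simp; ring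
  | hadd f g hf hg => rw [add_mul, map_add, hf, hg, map_add]; ring
  | hsmul t f hf => rw [smul_mul_assoc, map_smul, hf, map_smul]; simp; ring

theorem constTerm_toAssoc (f : LieAB) : constTerm (toAssoc f) = 0 := by
  induction f using lieAB_induction with
  | hof x =>
    rw [toAssoc_of, ← word_of, constTerm, onWords_word, if_neg]
    simp
  | hadd f g hf hg => rw [map_add, map_add, hf, hg, add_zero]
  | hsmul t f hf => rw [map_smul, map_smul, hf, smul_zero]
  | hlie f g hf hg => rw [toAssoc_lie, map_sub, constTerm_mul, constTerm_mul]; ring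

theorem rightPart_one (x : Fin 2) : rightPart x 1 = 0 := by
  classical
  ext w
  change (1 : Assoc).coeff (w * FreeMonoid.of x) = 0
  rw [← word_one, coeff_word, Finsupp.single_apply, if_neg]
  intro h
  have := congrArg FreeMonoid.length h
  simp at this

theorem rightPart_word_mul (x y : Fin 2) (w : FreeMonoid (Fin 2)) :
    rightPart x (word (w * FreeMonoid.of y)) = if y = x then word w else 0 := by
  classical
  ext v
  change (word (w * FreeMonoid.of y)).coeff (v * FreeMonoid.of x) = _
  rw [coeff_word, Finsupp.single_apply]
  have key : w * FreeMonoid.of y = v * FreeMonoid.of x ↔ w = v ∧ y = x := by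
    constructor
    · intro h
      have h2 := congrArg FreeMonoid.toList h
      simp only [FreeMonoid.toList_mul, FreeMonoid.toList_of] at h2
      have h3 := List.append_inj' h2 rfl
      exact ⟨FreeMonoid.toList.injective h3.1, by simpa using h3.2⟩
    · rintro ⟨rfl, rfl⟩; rfl
  by_cases hx : y = x
  · rw [if_pos hx, coeff_word, Finsupp.single_apply]
    subst hx
    simp only [key, and_true]
  · rw [if_neg hx, if_neg fun h => hx (key.1 h).2]
    rfl

theorem freeMonoid_snoc_cases (w : FreeMonoid (Fin 2)) :
    w = 1 ∨ ∃ v y, w = v * FreeMonoid.of y := by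
  rcases List.eq_nil_or_concat w.toList with h | ⟨v, y, h⟩
  · exact Or.inl h
  · exact Or.inr ⟨FreeMonoid.ofList v, y, by
      apply FreeMonoid.toList.injective
      rw [h, List.concat_eq_append]
      rfl⟩

theorem word_induction_right {p : Assoc → Prop} (hone : p 1)
    (hmul : ∀ f x, p (f * letter x)) (hadd : ∀ f g, p f → p g → p (f + g))
    (hsmul : ∀ (t : ℚ) f, p f → p (t • f)) (f : Assoc) : p f := by
  induction f using assoc_induction with
  | hword w =>
    rcases freeMonoid_snoc_cases w with rfl | ⟨v, y, rfl⟩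
    · rw [word_one]; exact hone
    · rw [word_mul, word_of]; exact hmul _ _
  | hadd f g hf hg => exact hadd f g hf hg
  | hsmul t f hf => exact hsmul t f hf

theorem rightPart_mul_letter (x y : Fin 2) (f : Assoc) :
    rightPart x (f * letter y) = if y = x then f else 0 := by
  induction f using assoc_induction with
  | hword w => rw [← word_of, ← word_mul, rightPart_word_mul]
  | hadd f g hf hg => rw [add_mul, map_add, hf, hg]; split_ifs <;> simp
  | hsmul t f hf => rw [smul_mul_assoc, map_smul, hf]; split_ifs <;> simp

theorem constTerm_one : constTerm 1 = 1 := by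
  rw [← word_one, constTerm, onWords_word, if_pos FreeMonoid.length_one]

theorem constTerm_letter (x : Fin 2) : constTerm (letter x) = 0 := by
  rw [← toAssoc_of, constTerm_toAssoc]

/-- `f = ε(f) + f_a a + f_b b`. -/
theorem eq_constTerm_add (f : Assoc) :
    f = constTerm f • 1 + (rightPart 0 f * letter 0 + rightPart 1 f * letter 1) := by
  induction f using word_induction_right with
  | hone => simp [rightPart_one, constTerm_one]
  | hmul f x =>
    rw [constTerm_mul, constTerm_letter, rightPart_mul_letter, rightPart_mul_letter]
    fin_cases x <;> simp
  | hadd f g hf hg =>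
    conv_lhs => rw [hf, hg]
    simp only [map_add, add_mul, add_smul]
    abel
  | hsmul t f hf =>
    conv_lhs => rw [hf]
    simp only [map_smul, smul_mul_assoc, smul_add, smul_eq_mul, mul_smul]

theorem rightPart_mul (x : Fin 2) (f g : Assoc) (hg : constTerm g = 0) :
    rightPart x (f * g) = f * rightPart x g := by
  conv_lhs => rw [eq_constTerm_add g]
  rw [hg, zero_smul, zero_add, mul_add, ← mul_assoc, ← mul_assoc, map_add, rightPart_mul_letter,
    rightPart_mul_letter]
  fin_cases x <;> simp

/-- Differentiate `f = ε(f) + ∑ f_y y`: either `f_y` is differentiated and the last letter survives,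
or the last letter `y` is replaced by `φ y`, whose own last letter then counts because `φ y` has no
constant term. -/
theorem rightPart_assocDer (φ : Fin 2 → Assoc) (hφ : ∀ x, constTerm (φ x) = 0) (x : Fin 2)
    (f : Assoc) : rightPart x (assocDer φ f) =
      assocDer φ (rightPart x f) + ∑ y, rightPart y f * rightPart x (φ y) := by
  have h : rightPart x (assocDer φ f) = rightPart x (assocDer φ (constTerm f • 1 +
    (rightPart 0 f * letter 0 + rightPart 1 f * letter 1))) := by rw [← eq_constTerm_add]
  rw [h]
  simp only [map_add, map_smul, assocDer_one, assocDer_mul, assocDer_letter, rightPart_mul_letter,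
    rightPart_mul _ _ _ (hφ _), Fin.sum_univ_two]
  fin_cases x
  · simp; abel
  · simp; abel

theorem tr_word (w : FreeMonoid (Fin 2)) :
    tr (word w) = Finsupp.single (FreeMonoid.toList w : Cycle (Fin 2)) 1 := by
  change Finsupp.mapDomain _ (word w).coeff = _
  rw [coeff_word, Finsupp.mapDomain_single]

theorem tr_mul_comm (f g : Assoc) : tr (f * g) = tr (g * f) := by
  induction f using assoc_induction with
  | hword v =>
    induction g using assoc_induction with
    | hword w =>
      rw [← word_mul, ← word_mul, tr_word, tr_word]
      congr 1
      rw [Cycle.coe_eq_coe]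
      exact List.isRotated_append
    | hadd f g hf hg => rw [mul_add, map_add, hf, hg, add_mul, map_add]
    | hsmul t f hf => rw [mul_smul_comm, map_smul, hf, smul_mul_assoc, map_smul]
  | hadd f g hf hg => rw [add_mul, map_add, hf, hg, mul_add, map_add]
  | hsmul t f hf => rw [smul_mul_assoc, map_smul, hf, mul_smul_comm, map_smul]

/-- Rotating a list exchanges two complementary factors, so `φ` factors through `tr`. -/
theorem eq_zero_of_tr_eq_zero {M : Type*} [AddCommGroup M] [Module ℚ M] (φ : Assoc →ₗ[ℚ] M)
    (hφ : ∀ v w, φ (word (v * w)) = φ (word (w * v))) {f : Assoc} (hf : tr f = 0) : φ f = 0 := by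
  let c : Cycle (Fin 2) → M := Quotient.lift (fun l => φ (word (FreeMonoid.ofList l))) (by
    rintro l l' ⟨n, rfl⟩
    rw [List.rotate_eq_drop_append_take_mod, FreeMonoid.ofList_append, ← hφ,
      ← FreeMonoid.ofList_append, List.take_append_drop])
  have h : (Finsupp.linearCombination ℚ c).comp tr = φ := assoc_hom_ext fun w => by
    rw [LinearMap.comp_apply, tr_word, Finsupp.linearCombination_single, one_smul]
    rfl
  rw [← h, LinearMap.comp_apply, hf, map_zero]

theorem tr_assocDer_eq_zero (φ : Fin 2 → Assoc) {f : Assoc} (hf : tr f = 0) :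
    tr (assocDer φ f) = 0 := by
  refine eq_zero_of_tr_eq_zero (tr.comp (assocDer φ)) (fun v w => ?_) hf
  simp only [LinearMap.comp_apply, word_mul, assocDer_mul, map_add]
  rw [tr_mul_comm (word w), tr_mul_comm (assocDer φ (word w)), add_comm]

/-! ### The divergence as a cocycle, and closure of `krv11` under the bracket -/

/-- The polynomial `f_a + g_b`, whose trace is the divergence. -/
def preDiv : Der →ₗ[ℚ] Assoc where
  toFun u := rightPart 0 (toAssoc (u genA)) + rightPart 1 (toAssoc (u genB))
  map_add' u v := by simp only [LieDerivation.add_apply, map_add]; abel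
  map_smul' t u := by simp only [LieDerivation.smul_apply, map_smul, smul_add, RingHom.id_apply]

theorem ellDiv_eq (u : Der) : ellDiv u = tr (preDiv u) := rfl

/-- The cocycle property. Besides the differentiated right parts, `u ∘ v` and `v ∘ u` contribute
double sums of products of right parts; these have the same trace after exchanging the two letters
and using `tr_mul_comm`. -/
theorem ellDiv_lie (u v : Der) :
    ellDiv ⁅u, v⁆ = tr (extendDer u (preDiv v)) - tr (extendDer v (preDiv u)) := by
  have key : ∀ (u v : Der) (x : Fin 2),
      rightPart x (toAssoc (u (v (FreeLieAlgebra.of ℚ x)))) =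
        extendDer u (rightPart x (toAssoc (v (FreeLieAlgebra.of ℚ x)))) +
        ∑ y, rightPart y (toAssoc (v (FreeLieAlgebra.of ℚ x))) *
          rightPart x (toAssoc (u (FreeLieAlgebra.of ℚ y))) := fun u v x => by
    rw [← extendDer_toAssoc, extendDer, rightPart_assocDer _ fun y => constTerm_toAssoc _]
  have h2 : preDiv ⁅u, v⁆ = ∑ x, rightPart x (toAssoc (u (v (FreeLieAlgebra.of ℚ x)))) -
      ∑ x, rightPart x (toAssoc (v (u (FreeLieAlgebra.of ℚ x)))) := by
    simp only [preDiv, LinearMap.coe_mk, AddHom.coe_mk, LieDerivation.commutator_apply, map_sub,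
      Fin.sum_univ_two]
    change _ = rightPart 0 (toAssoc (u (v genA))) + rightPart 1 (toAssoc (u (v genB))) -
      (rightPart 0 (toAssoc (v (u genA))) + rightPart 1 (toAssoc (v (u genB))))
    abel
  have h3 : ∀ v : Der, preDiv v = ∑ x, rightPart x (toAssoc (v (FreeLieAlgebra.of ℚ x))) :=
    fun v => by rw [Fin.sum_univ_two]; rfl
  rw [ellDiv_eq, h2]
  simp only [key, Finset.sum_add_distrib, h3, map_sum, map_add, map_sub]
  have h4 : ∑ x, ∑ y, tr (rightPart y (toAssoc (v (FreeLieAlgebra.of ℚ x))) *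
          rightPart x (toAssoc (u (FreeLieAlgebra.of ℚ y)))) =
      ∑ x, ∑ y, tr (rightPart y (toAssoc (u (FreeLieAlgebra.of ℚ x))) *
          rightPart x (toAssoc (v (FreeLieAlgebra.of ℚ y)))) := by
    rw [Finset.sum_comm]
    simp only [tr_mul_comm]
  rw [h4]
  abel

theorem assocDer_pow_eq_zero (φ : Fin 2 → Assoc) {f : Assoc} (hf : assocDer φ f = 0) (k : ℕ) :
    assocDer φ (f ^ k) = 0 := by
  induction k with
  | zero => rw [pow_zero, assocDer_one]
  | succ k ih => rw [pow_succ, assocDer_mul, ih, hf, zero_mul, mul_zero, add_zero]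

/-- A derivation preserves the kernel of `tr`, so the divergence of `v` may be replaced by `K c^k`,
which `u` annihilates. -/
theorem tr_extendDer_preDiv {u v : Der} (hu : u ∈ der11) {K : ℚ} {k : ℕ}
    (hv : ellDiv v = K • tr (toAssoc ⁅genA, genB⁆ ^ k)) : tr (extendDer u (preDiv v)) = 0 := by
  have hc : extendDer u (toAssoc ⁅genA, genB⁆) = 0 := by
    rw [extendDer_toAssoc, show u ⁅genA, genB⁆ = 0 from hu, map_zero]
  have h : tr (preDiv v - K • toAssoc ⁅genA, genB⁆ ^ k) = 0 := by
    rw [map_sub, map_smul, ← ellDiv_eq, hv, sub_self]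
  have h2 := tr_assocDer_eq_zero (fun x => toAssoc (u (FreeLieAlgebra.of ℚ x))) h
  rw [map_sub, map_smul, assocDer_pow_eq_zero _ hc, smul_zero, sub_zero] at h2
  exact h2

theorem DivCondition.exists_eq {n : ℕ} {u : Der} (h : DivCondition n u) :
    ∃ (K : ℚ) (k : ℕ), ellDiv u = K • tr (toAssoc ⁅genA, genB⁆ ^ k) := by
  rcases Nat.even_or_odd n with hn | hn
  · exact ⟨0, 0, by rw [h.2 hn, zero_smul]⟩
  · obtain ⟨K, hK⟩ := h.1 hn
    exact ⟨K, _, hK⟩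

theorem lie_mem_derWeight {u v : Der} {m n : ℕ} (hu : u ∈ derWeight (m + 1))
    (hv : v ∈ derWeight (n + 1)) : ⁅u, v⁆ ∈ derWeight (m + n + 1) := by
  obtain ⟨hu1, hu2, hu3⟩ := hu
  obtain ⟨hv1, hv2, hv3⟩ := hv
  have key : ∀ f, u f ∈ lieWeight (m + 1) → v f ∈ lieWeight (n + 1) →
      ⁅u, v⁆ f ∈ lieWeight (m + n + 1) := fun f hf1 hf2 => by
    rw [LieDerivation.commutator_apply]
    have h1 : u (v f) ∈ lieWeight (m + (n + 1)) := der_mem_lieWeight hu2 hu3 hf2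
    have h2 : v (u f) ∈ lieWeight (n + (m + 1)) := der_mem_lieWeight hv2 hv3 hf1
    rw [show n + (m + 1) = m + n + 1 by omega] at h2
    exact sub_mem h1 h2
  exact ⟨der11.lie_mem hu1 hv1, key genA hu2 hv2, key genB hu3 hv3⟩

theorem lie_mem_krv11_of_mem {u v : Der} {m n : ℕ} (hm : 3 ≤ m) (hn : 3 ≤ n)
    (hu : u ∈ derWeight m) (hv : v ∈ derWeight n) (hu' : DivCondition m u)
    (hv' : DivCondition n v) : ⁅u, v⁆ ∈ krv11 := by
  obtain ⟨K, k, hK⟩ := hu'.exists_eq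
  obtain ⟨L, l, hL⟩ := hv'.exists_eq
  have hdiv : ellDiv ⁅u, v⁆ = 0 := by
    rw [ellDiv_lie, tr_extendDer_preDiv hu.1 hL, tr_extendDer_preDiv hv.1 hK, sub_zero]
  obtain ⟨m, rfl⟩ : ∃ m', m = m' + 1 := ⟨m - 1, by omega⟩
  obtain ⟨n, rfl⟩ : ∃ n', n = n' + 1 := ⟨n - 1, by omega⟩
  exact Submodule.subset_span ⟨m + n + 1, by omega, lie_mem_derWeight hu hv,
    fun _ => ⟨0, by rw [hdiv, zero_smul]⟩, fun _ => hdiv⟩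

theorem lie_mem_krv11 {u v : Der} (hu : u ∈ krv11) (hv : v ∈ krv11) : ⁅u, v⁆ ∈ krv11 := by
  induction hu using Submodule.span_induction with
  | mem u hu =>
    induction hv using Submodule.span_induction with
    | mem v hv =>
      obtain ⟨m, hm, hu, hu'⟩ := hu
      obtain ⟨n, hn, hv, hv'⟩ := hv
      exact lie_mem_krv11_of_mem hm hn hu hv hu' hv'
    | zero => rw [lie_zero]; exact zero_mem _
    | add g g' _ _ h h' => rw [lie_add]; exact add_mem h h'
    | smul t g _ h => rw [lie_smul]; exact Submodule.smul_mem _ _ h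
  | zero => rw [zero_lie]; exact zero_mem _
  | add g g' _ _ h h' => rw [add_lie]; exact add_mem h h'
  | smul t g _ h => rw [smul_lie]; exact Submodule.smul_mem _ _ h

/-- `krv^{(1,1)}` as a Lie algebra. -/
def krvLieSubalgebra : LieSubalgebra ℚ Der :=
  { krv11 with lie_mem' := fun hu hv => lie_mem_krv11 hu hv }

/-! ### Coordinates on `ℚ⟨a,b⟩` -/

/-- Polynomials in commuting variables `x_0, x_1, …`. -/
abbrev Coord : Type := MvPolynomial ℕ ℚ

/-- The shift `x_i ↦ x_{i+1}`. -/
def shift : Coord →ₐ[ℚ] Coord := rename Nat.succ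

theorem shift_X (i : ℕ) : shift (X i) = X (i + 1) := rename_X _ _

/-- The action of `a` by left multiplication. -/
def actA : Module.End ℚ (ℕ → Coord) where
  toFun φ r := X 0 * φ r
  map_add' φ ψ := by funext r; simp [mul_add]
  map_smul' t φ := by funext r; simp

/-- The action of `b` by left multiplication. -/
def actB : Module.End ℚ (ℕ → Coord) where
  toFun φ r := Nat.casesOn r 0 fun r => shift (φ r)
  map_add' φ ψ := by funext r; cases r <;> simp
  map_smul' t φ := by funext r; cases r <;> simp

/-- The left regular representation, in coordinates. -/
def rep : Assoc →ₐ[ℚ] Module.End ℚ (ℕ → Coord) :=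
  MonoidAlgebra.lift ℚ _ _ (FreeMonoid.lift ![actA, actB])

theorem rep_letter (x : Fin 2) : rep (letter x) = ![actA, actB] x := by
  rw [rep, letter, MonoidAlgebra.lift_of, FreeMonoid.lift_eval_of]

/-- The coordinates of a noncommutative polynomial: the word `a^{i_0} b a^{i_1} b ⋯ b a^{i_r}` has
the coordinate `x_0^{i_0} ⋯ x_r^{i_r}` in depth `r`. -/
def coords : Assoc →ₗ[ℚ] (ℕ → Coord) :=
  (LinearMap.applyₗ (Pi.single 0 1 : ℕ → Coord)).comp rep.toLinearMap

theorem coords_mul (f g : Assoc) : coords (f * g) = rep f (coords g) := by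
  change rep (f * g) _ = rep f (rep g _)
  rw [map_mul, Module.End.mul_apply]

theorem coords_one : coords 1 = Pi.single 0 1 := by
  change rep 1 _ = _
  rw [map_one, Module.End.one_apply]

theorem coords_a_mul (f : Assoc) (r : ℕ) : coords (letter 0 * f) r = X 0 * coords f r := by
  rw [coords_mul, rep_letter]
  rfl

theorem coords_b_mul_zero (f : Assoc) : coords (letter 1 * f) 0 = 0 := by
  rw [coords_mul, rep_letter]
  rfl

theorem coords_b_mul_succ (f : Assoc) (r : ℕ) :
    coords (letter 1 * f) (r + 1) = shift (coords f r) := by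
  rw [coords_mul, rep_letter]
  rfl

theorem word_induction_left {p : Assoc → Prop} (hone : p 1)
    (hmul : ∀ w x, p (word w) → p (letter x * word w)) (hadd : ∀ f g, p f → p g → p (f + g))
    (hsmul : ∀ (t : ℚ) f, p f → p (t • f)) (f : Assoc) : p f := by
  induction f using assoc_induction with
  | hword w =>
    induction w using FreeMonoid.inductionOn' with
    | one => rw [word_one]; exact hone
    | of_mul x w ih => rw [word_mul, word_of]; exact hmul _ _ ih
  | hadd f g hf hg => exact hadd f g hf hg
  | hsmul t f hf => exact hsmul t f hf

theorem coords_mul_a (f : Assoc) (r : ℕ) : coords (f * letter 0) r = X r * coords f r := by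
  induction f using word_induction_left generalizing r with
  | hone =>
    rw [one_mul, ← mul_one (letter 0), coords_a_mul, coords_one]
    rcases eq_or_ne r 0 with rfl | h
    · rfl
    · rw [Pi.single_eq_of_ne h, mul_zero, mul_zero]
  | hmul w x ih =>
    rw [mul_assoc]
    fin_cases x
    · simp only [Fin.zero_eta, coords_a_mul, ih]; ring
    · cases r with
      | zero => simp only [Fin.mk_one, coords_b_mul_zero, mul_zero]
      | succ r => simp only [Fin.mk_one, coords_b_mul_succ, ih, map_mul, shift_X]
  | hadd f g hf hg => simp only [add_mul, map_add, Pi.add_apply, hf, hg]; ring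
  | hsmul t f hf => simp only [smul_mul_assoc, map_smul, Pi.smul_apply, hf, mul_smul_comm]

theorem coords_mul_b_zero (f : Assoc) : coords (f * letter 1) 0 = 0 := by
  induction f using word_induction_left with
  | hone => rw [one_mul, ← mul_one (letter 1), coords_b_mul_zero]
  | hmul w x ih =>
    rw [mul_assoc]
    fin_cases x
    · simp only [Fin.zero_eta, coords_a_mul, ih, mul_zero]
    · simp only [Fin.mk_one, coords_b_mul_zero]
  | hadd f g hf hg => simp only [add_mul, map_add, Pi.add_apply, hf, hg, add_zero]
  | hsmul t f hf => simp only [smul_mul_assoc, map_smul, Pi.smul_apply, hf, smul_zero]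

theorem coords_mul_b_succ (f : Assoc) (r : ℕ) : coords (f * letter 1) (r + 1) = coords f r := by
  induction f using word_induction_left generalizing r with
  | hone =>
    rw [one_mul, ← mul_one (letter 1), coords_b_mul_succ, coords_one]
    rcases eq_or_ne r 0 with rfl | h
    · rw [Pi.single_eq_same, map_one]
    · rw [Pi.single_eq_of_ne h, map_zero]
  | hmul w x ih =>
    rw [mul_assoc]
    fin_cases x
    · simp only [Fin.zero_eta, coords_a_mul, ih]
    · cases r with
      | zero => simp only [Fin.mk_one, coords_b_mul_zero, coords_b_mul_succ, coords_mul_b_zero,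
          map_zero]
      | succ r => simp only [Fin.mk_one, coords_b_mul_succ, ih]
  | hadd f g hf hg => simp only [add_mul, map_add, Pi.add_apply, hf, hg]
  | hsmul t f hf => simp only [smul_mul_assoc, map_smul, Pi.smul_apply, hf]

/-! ### Injectivity of the coordinates -/

/-- The number of letters `b`. -/
def depth : List (Fin 2) → ℕ
  | [] => 0
  | x :: w => if x = 0 then depth w else depth w + 1

/-- The exponents `i_0, …, i_r` of `a^{i_0} b a^{i_1} b ⋯ b a^{i_r}`. -/
def expo : List (Fin 2) → (ℕ →₀ ℕ)
  | [] => 0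
  | x :: w => if x = 0 then Finsupp.single 0 1 + expo w else (expo w).mapDomain Nat.succ

theorem coords_word (w : FreeMonoid (Fin 2)) :
    coords (word w) = Pi.single (depth w.toList) (monomial (expo w.toList) 1) := by
  induction w using FreeMonoid.inductionOn' with
  | one => rw [word_one, coords_one]; rfl
  | of_mul x w ih =>
    rw [word_mul, word_of]
    funext r
    fin_cases x
    · change coords (letter 0 * word w) r = (Pi.single (depth w.toList)
        (monomial (Finsupp.single 0 1 + expo w.toList) 1) : ℕ → Coord) r
      rw [coords_a_mul, ih]
      rcases eq_or_ne r (depth w.toList) with rfl | h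
      · rw [Pi.single_eq_same, Pi.single_eq_same, X, monomial_mul, one_mul]
      · rw [Pi.single_eq_of_ne h, Pi.single_eq_of_ne h, mul_zero]
    · change coords (letter 1 * word w) r = (Pi.single (depth w.toList + 1)
        (monomial ((expo w.toList).mapDomain Nat.succ) 1) : ℕ → Coord) r
      cases r with
      | zero => rw [coords_b_mul_zero, Pi.single_eq_of_ne (by omega)]
      | succ r =>
        rw [coords_b_mul_succ, ih]
        rcases eq_or_ne r (depth w.toList) with rfl | h
        · rw [Pi.single_eq_same, Pi.single_eq_same, shift, rename_monomial]
        · rw [Pi.single_eq_of_ne h, Pi.single_eq_of_ne (by omega), map_zero]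

/-- The first letter can be recovered: the exponent of `x_0` is positive exactly when the word
begins with `a`, since prepending `b` shifts all variables away from `x_0`. -/
theorem expo_injective : ∀ v w : List (Fin 2), depth v = depth w → expo v = expo w → v = w
  | [], [], _, _ => rfl
  | [], x :: w, h1, h2 => by
    by_cases hx : x = 0
    · have := DFunLike.congr_fun h2 0
      simp only [expo, hx, if_true, Finsupp.add_apply, Finsupp.single_eq_same, Finsupp.zero_apply]
        at this
      omega
    · simp [depth, hx] at h1
  | x :: v, [], h1, h2 => by
    by_cases hx : x = 0
    · have := DFunLike.congr_fun h2 0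
      simp [expo, hx] at this
    · simp [depth, hx] at h1
  | x :: v, y :: w, h1, h2 => by
    have h0 : ∀ e : ℕ →₀ ℕ, e.mapDomain Nat.succ 0 = 0 := fun e =>
      Finsupp.mapDomain_of_notMem_range _ _ (by simp)
    by_cases hx : x = 0 <;> by_cases hy : y = 0
    · simp only [depth, expo, hx, hy, if_true] at h1 h2
      rw [hx, hy, expo_injective v w h1 (add_left_cancel h2)]
    · have := DFunLike.congr_fun h2 0
      simp only [expo, hx, hy, if_true, if_false, h0, Finsupp.add_apply, Finsupp.single_eq_same]
        at this
      omega
    · have := DFunLike.congr_fun h2 0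
      simp only [expo, hx, hy, if_true, if_false, h0, Finsupp.add_apply, Finsupp.single_eq_same]
        at this
      omega
    · simp only [depth, expo, hx, hy, if_false] at h1 h2
      rw [expo_injective v w (by omega)
        (Finsupp.mapDomain_injective Nat.succ_injective h2), show x = y by omega]

theorem coeff_coords (f : Assoc) (w : FreeMonoid (Fin 2)) :
    coeff (expo w.toList) (coords f (depth w.toList)) = f.coeff w := by
  classical
  induction f using assoc_induction with
  | hword v =>
    rw [coords_word, coeff_word, Finsupp.single_apply]
    by_cases h : depth w.toList = depth v.toList
    · rw [← h, Pi.single_eq_same, coeff_monomial]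
      have : expo v.toList = expo w.toList ↔ v = w :=
        ⟨fun h' => FreeMonoid.toList.injective (expo_injective _ _ h.symm h'), fun h' => by rw [h']⟩
      simp only [this]
    · rw [Pi.single_eq_of_ne h, if_neg (by rintro rfl; exact h rfl), coeff_zero]
  | hadd f g hf hg => rw [map_add, Pi.add_apply, coeff_add, hf, hg]; rfl
  | hsmul t f hf => rw [map_smul, Pi.smul_apply, coeff_smul, hf]; rfl

theorem coords_injective : Function.Injective coords := by
  rw [injective_iff_map_eq_zero]
  intro f hf
  ext w
  rw [← coeff_coords, hf]
  simp

/-! ### Coordinates of polynomials of moulds -/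

/-- The substitution `u_i ↦ x_i - x_{i-1}`. -/
def diffSubst (r : ℕ) : Poly r →ₐ[ℚ] Coord := aeval fun i : Fin r => X (i.val + 1) - X i.val

/-- The substitution `x_i ↦ u_1 + ⋯ + u_i`. -/
def sumSubst (r : ℕ) : Coord →ₐ[ℚ] Poly r := aeval fun k => ∑ j ∈ Finset.range k, var r j

theorem diffSubst_X {r : ℕ} (i : Fin r) : diffSubst r (X i) = X (i.val + 1) - X i.val :=
  aeval_X _ _

theorem sumSubst_X (r k : ℕ) : sumSubst r (X k) = ∑ j ∈ Finset.range k, var r j := aeval_X _ _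

theorem sumSubst_diffSubst {r : ℕ} (p : Poly r) : sumSubst r (diffSubst r p) = p := by
  have : (sumSubst r).comp (diffSubst r) = AlgHom.id ℚ _ := by
    ext1 i
    rw [AlgHom.comp_apply, diffSubst_X, map_sub, sumSubst_X, sumSubst_X, Finset.sum_range_succ,
      add_sub_cancel_left, X_eq_var]
    rfl
  exact DFunLike.congr_fun this p

theorem diffSubst_injective (r : ℕ) : Function.Injective (diffSubst r) :=
  Function.LeftInverse.injective sumSubst_diffSubst

theorem cElt_one : cElt 1 = letter 1 := rfl

theorem cElt_succ (m : ℕ) :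
    cElt (m + 2) = letter 0 * cElt (m + 1) - cElt (m + 1) * letter 0 := by
  simp only [cElt, Nat.add_sub_cancel, show m + 2 - 1 = m + 1 by omega]
  rw [Function.iterate_succ_apply']

theorem coords_cElt_mul_zero (m : ℕ) (f : Assoc) : coords (cElt (m + 1) * f) 0 = 0 := by
  induction m generalizing f with
  | zero => rw [zero_add, cElt_one, coords_b_mul_zero]
  | succ m ih =>
    rw [cElt_succ, sub_mul, map_sub, mul_assoc, mul_assoc, Pi.sub_apply, coords_a_mul, ih, ih,
      mul_zero, sub_zero]

/-- An `a` to the left of the letter `b` acts as `x_0`, one to its right as `x_1`, so each `ad(a)`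
contributes the factor `x_0 - x_1`. -/
theorem coords_cElt_mul_succ (m : ℕ) (f : Assoc) (r : ℕ) :
    coords (cElt (m + 1) * f) (r + 1) = (X 0 - X 1) ^ m * shift (coords f r) := by
  induction m generalizing f with
  | zero => rw [zero_add, cElt_one, coords_b_mul_succ, pow_zero, one_mul]
  | succ m ih =>
    rw [cElt_succ, sub_mul, map_sub, mul_assoc, mul_assoc, Pi.sub_apply, coords_a_mul, ih, ih,
      coords_a_mul, map_mul, shift_X]
    ring

theorem coords_list_prod {r : ℕ} (m : Fin r → ℕ) :
    coords (List.ofFn fun i => cElt (m i + 1)).prod =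
      Pi.single r (∏ i : Fin r, (X i.val - X (i.val + 1)) ^ m i) := by
  induction r with
  | zero => rw [List.ofFn_zero, List.prod_nil, coords_one, Fin.prod_univ_zero]
  | succ r ih =>
    rw [List.ofFn_succ, List.prod_cons, Fin.prod_univ_succ]
    funext s
    cases s with
    | zero => rw [coords_cElt_mul_zero, Pi.single_eq_of_ne (by omega)]
    | succ s =>
      rw [coords_cElt_mul_succ, ih]
      rcases eq_or_ne s r with rfl | h
      · rw [Pi.single_eq_same, Pi.single_eq_same, map_prod]
        simp only [map_pow, map_sub, shift_X, Fin.val_zero, Fin.val_succ, zero_add]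
      · rw [Pi.single_eq_of_ne h, Pi.single_eq_of_ne (by omega), map_zero, mul_zero]

theorem polyOfDepth_monomial {r : ℕ} (m : Fin r →₀ ℕ) :
    polyOfDepth r (monomial m 1) =
      (-1 : ℚ) ^ (∑ i, m i) • (List.ofFn fun i : Fin r => cElt (m i + 1)).prod := by
  rw [show monomial m (1 : ℚ) = basisMonomials (Fin r) ℚ m by rw [coe_basisMonomials],
    polyOfDepth, Module.Basis.constr_basis, Finset.sum_add_distrib]
  congr 1
  simp only [Finset.sum_const, Finset.card_univ, Fintype.card_fin, smul_eq_mul, mul_one]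
  -- With `n = ∑ m_i + r`, the sign exponent `n + r` has the same parity as `∑ m_i`.
  rw [add_assoc, pow_add, ← two_mul, pow_mul]
  norm_num

theorem poly_hom_ext {σ M : Type*} [AddCommMonoid M] [Module ℚ M] {φ ψ : MvPolynomial σ ℚ →ₗ[ℚ] M}
    (h : ∀ m, φ (monomial m 1) = ψ (monomial m 1)) : φ = ψ :=
  (basisMonomials σ ℚ).ext fun m => by rw [coe_basisMonomials]; exact h m

/-- The sign in the definition of `polyOfDepth` turns the factors `x_{i-1} - x_i` coming from the
`c_i` into `x_i - x_{i-1}`. -/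
theorem coords_polyOfDepth {r : ℕ} (p : Poly r) :
    coords (polyOfDepth r p) = Pi.single r (diffSubst r p) := by
  have : coords.comp (polyOfDepth r) =
      (LinearMap.single ℚ (fun _ => Coord) r).comp (diffSubst r).toLinearMap := by
    refine poly_hom_ext fun m => ?_
    rw [LinearMap.comp_apply, polyOfDepth_monomial, map_smul, coords_list_prod,
      LinearMap.comp_apply, LinearMap.single_apply, ← Pi.single_smul]
    congr 1
    rw [AlgHom.toLinearMap_apply, diffSubst, aeval_monomial, map_one, one_mul,
      Finsupp.prod_fintype _ _ (fun i => pow_zero _), ← Finset.prod_pow_eq_pow_sum,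
      Algebra.smul_def, map_prod, ← Finset.prod_mul_distrib]
    refine Finset.prod_congr rfl fun i _ => ?_
    rw [map_pow, map_neg, map_one, ← mul_pow]
    ring
  exact LinearMap.congr_fun this p

theorem coords_polyOfDepth_same {r : ℕ} (p : Poly r) :
    coords (polyOfDepth r p) r = diffSubst r p := by
  rw [coords_polyOfDepth, Pi.single_eq_same]

theorem coords_polyOfDepth_ne {r s : ℕ} (h : s ≠ r) (p : Poly r) :
    coords (polyOfDepth r p) s = 0 := by
  rw [coords_polyOfDepth, Pi.single_eq_of_ne h]

theorem polyOfMould_of (r : ℕ) (p : Poly r) :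
    polyOfMould (DirectSum.lof ℚ ℕ Poly r p) = polyOfDepth r p := by
  rw [polyOfMould, DirectSum.toModule_lof]

theorem mould_induction {p : PolyMould → Prop} (hzero : p 0)
    (hof : ∀ r f, p (DirectSum.lof ℚ ℕ Poly r f)) (hadd : ∀ F G, p F → p G → p (F + G))
    (F : PolyMould) : p F :=
  DirectSum.induction_on F hzero hof hadd

theorem coords_polyOfMould (F : PolyMould) (r : ℕ) :
    coords (polyOfMould F) r = diffSubst r (F r) := by
  induction F using mould_induction with
  | hzero => simp
  | hof s f =>
    rw [polyOfMould_of]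
    rcases eq_or_ne r s with rfl | h
    · rw [coords_polyOfDepth_same, DirectSum.lof_apply]
    · rw [coords_polyOfDepth_ne h, DirectSum.lof_eq_of, DirectSum.of_eq_of_ne _ _ _ h, map_zero]
  | hadd F G hF hG => rw [map_add, map_add, Pi.add_apply, hF, hG, DirectSum.add_apply, map_add]

theorem polyOfMould_injective : Function.Injective polyOfMould := by
  intro F G h
  refine DFinsupp.ext fun r => diffSubst_injective r ?_
  have := congrFun (congrArg coords h) r
  rwa [coords_polyOfMould, coords_polyOfMould] at this

/-! ### Shuffles of lists -/

section Shuffle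

variable {α β M : Type*}

/-- The list of all shuffles of two lists. -/
def shuf : List α → List α → List (List α)
  | [], v => [v]
  | x :: u, [] => [x :: u]
  | x :: u, y :: v => (shuf u (y :: v)).map (x :: ·) ++ (shuf (x :: u) v).map (y :: ·)
termination_by u v => u.length + v.length

theorem shuf_nil_left (v : List α) : shuf [] v = [v] := by rw [shuf]

theorem shuf_nil_right (u : List α) : shuf u [] = [u] := by cases u <;> rw [shuf]

theorem shuf_cons_cons (x y : α) (u v : List α) : shuf (x :: u) (y :: v) =
    (shuf u (y :: v)).map (x :: ·) ++ (shuf (x :: u) v).map (y :: ·) := by rw [shuf]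

/-- Induction along the recursive definition of shuffles. -/
theorem shuf_induction {p : List α → List α → Prop} (hl : ∀ v, p [] v) (hr : ∀ u, p u [])
    (hcons : ∀ x y u v, p u (y :: v) → p (x :: u) v → p (x :: u) (y :: v)) :
    ∀ u v, p u v
  | [], v => hl v
  | x :: u, [] => hr (x :: u)
  | x :: u, y :: v => hcons x y u v (shuf_induction hl hr hcons u (y :: v))
      (shuf_induction hl hr hcons (x :: u) v)
termination_by u v => u.length + v.length

theorem length_of_mem_shuf (u v w : List α) (h : w ∈ shuf u v) :
    w.length = u.length + v.length := by
  induction u, v using shuf_induction generalizing w with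
  | hl v => rw [shuf_nil_left, List.mem_singleton] at h; simp [h]
  | hr u => rw [shuf_nil_right, List.mem_singleton] at h; simp [h]
  | hcons x y u v h1 h2 =>
    rw [shuf_cons_cons, List.mem_append, List.mem_map, List.mem_map] at h
    rcases h with ⟨w, hw, rfl⟩ | ⟨w, hw, rfl⟩
    · have := h1 w hw
      simp only [List.length_cons] at this ⊢
      omega
    · have := h2 w hw
      simp only [List.length_cons] at this ⊢
      omega

/-- When a predicate separates the letters of the two lists, a shuffle is characterised by its two
restrictions. This gives the bridge to shuffles defined by permutations. -/
theorem mem_shuf_iff (p : α → Bool) (u v : List α) (hu : ∀ x ∈ u, p x = true)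
    (hv : ∀ x ∈ v, p x = false) (w : List α) :
    w ∈ shuf u v ↔ w.filter p = u ∧ w.filter (fun x => !p x) = v := by
  induction w generalizing u v with
  | nil =>
    cases u with
    | nil => rw [shuf_nil_left, List.mem_singleton]; simp
    | cons x u =>
      cases v with
      | nil => rw [shuf_nil_right, List.mem_singleton]; simp
      | cons y v => rw [shuf_cons_cons]; simp
  | cons z w ih =>
    cases u with
    | nil =>
      rw [shuf_nil_left, List.mem_singleton]
      constructor
      · rintro rfl
        exact ⟨List.filter_eq_nil_iff.2 fun x hx => by simp [hv x hx],
          List.filter_eq_self.2 fun x hx => by simp [hv x hx]⟩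
      · rintro ⟨h1, h2⟩
        rw [← h2, eq_comm, List.filter_eq_self]
        intro x hx
        have := List.filter_eq_nil_iff.1 h1 x hx
        simpa using this
    | cons x u =>
      cases v with
      | nil =>
        rw [shuf_nil_right, List.mem_singleton]
        constructor
        · intro h
          rw [h]
          exact ⟨List.filter_eq_self.2 hu, List.filter_eq_nil_iff.2 fun x hx => by simp [hu x hx]⟩
        · rintro ⟨h1, h2⟩
          rw [← h1, eq_comm, List.filter_eq_self]
          intro x hx
          have := List.filter_eq_nil_iff.1 h2 x hx
          simpa using this
      | cons y v =>
        have hx := hu x (by simp)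
        have hy := hv y (by simp)
        rw [shuf_cons_cons, List.mem_append, List.mem_map, List.mem_map]
        simp only [List.cons.injEq, exists_eq_right_right]
        rw [ih u (y :: v) (fun z hz => hu z (by simp [hz])) hv,
          ih (x :: u) v hu (fun z hz => hv z (by simp [hz]))]
        cases hz : p z
        · have hxz : x ≠ z := by rintro rfl; rw [hx] at hz; cases hz
          simp [hz, hxz]
          tauto
        · have hyz : y ≠ z := by rintro rfl; rw [hy] at hz; cases hz
          simp [hz, hyz]
          tauto

theorem nodup_shuf (p : α → Bool) (u v : List α) (hu : ∀ x ∈ u, p x = true)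
    (hv : ∀ x ∈ v, p x = false) : (shuf u v).Nodup := by
  induction u, v using shuf_induction with
  | hl v => rw [shuf_nil_left]; exact List.nodup_singleton _
  | hr u => rw [shuf_nil_right]; exact List.nodup_singleton _
  | hcons x y u v h1 h2 =>
    have hx := hu x (by simp)
    have hy := hv y (by simp)
    rw [shuf_cons_cons]
    refine List.Nodup.append ((h1 (fun z hz => hu z (by simp [hz])) hv).map
      (List.cons_injective)) ((h2 hu (fun z hz => hv z (by simp [hz]))).map
      (List.cons_injective)) ?_
    intro w hw1 hw2
    obtain ⟨w1, -, rfl⟩ := List.mem_map.1 hw1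
    obtain ⟨w2, -, h⟩ := List.mem_map.1 hw2
    rw [List.cons.injEq] at h
    rw [← h.1, hy] at hx
    cases hx

variable [AddCommMonoid M]

/-- The sum of the values of `φ` at the shuffles of `u` and `v`. -/
def shSum (φ : List α → M) (u v : List α) : M := ((shuf u v).map φ).sum

theorem shSum_nil_left (φ : List α → M) (v : List α) : shSum φ [] v = φ v := by
  simp [shSum, shuf_nil_left]

theorem shSum_nil_right (φ : List α → M) (u : List α) : shSum φ u [] = φ u := by
  simp [shSum, shuf_nil_right]

theorem shSum_cons_cons (φ : List α → M) (x y : α) (u v : List α) :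
    shSum φ (x :: u) (y :: v) =
      shSum (fun w => φ (x :: w)) u (y :: v) + shSum (fun w => φ (y :: w)) (x :: u) v := by
  simp only [shSum, shuf_cons_cons, List.map_append, List.map_map, List.sum_append]
  rfl

theorem shSum_congr {φ ψ : List α → M} {u v : List α}
    (h : ∀ w, w.length = u.length + v.length → φ w = ψ w) : shSum φ u v = shSum ψ u v := by
  rw [shSum, shSum, List.map_congr_left fun w hw => h w (length_of_mem_shuf u v w hw)]

theorem shSum_map (φ : List β → M) (f : α → β) (u v : List α) :
    shSum φ (u.map f) (v.map f) = shSum (fun w => φ (w.map f)) u v := by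
  induction u, v using shuf_induction generalizing φ with
  | hl v => simp only [List.map_nil, shSum_nil_left]
  | hr u => simp only [List.map_nil, shSum_nil_right]
  | hcons x y u v h1 h2 =>
    simp only [List.map_cons] at h1 h2 ⊢
    rw [shSum_cons_cons, shSum_cons_cons, h1, h2]
    simp only [List.map_cons]

/-- The recursive definition splits shuffles by their first letter; this splits them by the last
one, as is needed when the last variable is dropped or held fixed. -/
theorem shSum_snoc_snoc (φ : List α → M) (x y : α) (u v : List α) :
    shSum φ (u ++ [x]) (v ++ [y]) = shSum (fun w => φ (w ++ [x])) u (v ++ [y]) +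
      shSum (fun w => φ (w ++ [y])) (u ++ [x]) v := by
  induction u, v using shuf_induction generalizing φ with
  | hl v =>
    rw [shSum_nil_left]
    induction v generalizing φ with
    | nil =>
      simp only [List.nil_append, shSum_nil_right, shSum_cons_cons, shSum_nil_left,
        List.cons_append]
      rw [add_comm]
    | cons z v ih =>
      simp only [List.nil_append, List.cons_append] at ih ⊢
      rw [shSum_cons_cons, shSum_cons_cons, ih]
      simp only [shSum_nil_left, List.cons_append]
      abel
  | hr u =>
    rw [shSum_nil_right]
    induction u generalizing φ with
    | nil =>
      simp only [List.nil_append, shSum_nil_left, shSum_cons_cons, shSum_nil_right,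
        List.cons_append]
      rw [add_comm]
    | cons z u ih =>
      simp only [List.nil_append, List.cons_append] at ih ⊢
      rw [shSum_cons_cons, shSum_cons_cons, ih]
      simp only [shSum_nil_right, List.cons_append]
      abel
  | hcons z z' u v h1 h2 =>
    simp only [List.cons_append] at h1 h2 ⊢
    rw [shSum_cons_cons, h1, h2, shSum_cons_cons, shSum_cons_cons]
    simp only [List.cons_append]
    abel

theorem shSum_add (φ ψ : List α → M) (u v : List α) :
    shSum (fun w => φ w + ψ w) u v = shSum φ u v + shSum ψ u v := by
  induction u, v using shuf_induction generalizing φ ψ with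
  | hl v => simp only [shSum_nil_left]
  | hr u => simp only [shSum_nil_right]
  | hcons x y u v h1 h2 => simp only [shSum_cons_cons, h1, h2]; abel

theorem map_shSum {N F : Type*} [AddCommMonoid N] [FunLike F M N] [AddMonoidHomClass F M N]
    (f : F) (φ : List α → M) (u v : List α) :
    f (shSum φ u v) = shSum (fun w => f (φ w)) u v := by
  induction u, v using shuf_induction generalizing φ with
  | hl v => simp only [shSum_nil_left]
  | hr u => simp only [shSum_nil_right]
  | hcons x y u v h1 h2 => simp only [shSum_cons_cons, map_add, h1, h2]

end Shuffle

theorem filter_finRange_lt (r k : ℕ) :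
    (List.finRange r).filter (fun i => decide (i.val < k)) = (List.finRange r).take k := by
  conv_lhs => rw [← List.take_append_drop k (List.finRange r), List.filter_append]
  rw [List.filter_eq_self.2, List.filter_eq_nil_iff.2, List.append_nil]
  · intro i hi
    obtain ⟨j, hj, rfl⟩ := List.mem_iff_getElem.1 hi
    simp
  · intro i hi
    obtain ⟨j, hj, rfl⟩ := List.mem_iff_getElem.1 hi
    simp only [List.length_take] at hj
    simp
    omega

theorem filter_finRange_not_lt (r k : ℕ) :
    (List.finRange r).filter (fun i => !decide (i.val < k)) = (List.finRange r).drop k := by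
  conv_lhs => rw [← List.take_append_drop k (List.finRange r), List.filter_append]
  rw [List.filter_eq_nil_iff.2, List.filter_eq_self.2, List.nil_append]
  · intro i hi
    obtain ⟨j, hj, rfl⟩ := List.mem_iff_getElem.1 hi
    simp
  · intro i hi
    obtain ⟨j, hj, rfl⟩ := List.mem_iff_getElem.1 hi
    simp only [List.length_take] at hj
    simp
    omega

theorem filter_ofFn_symm {r : ℕ} (p : Fin r → Bool) (σ : Equiv.Perm (Fin r))
    (hσ : ∀ i j, i < j → p i = true → p j = true → σ i < σ j) :
    (List.ofFn σ.symm).filter p = (List.finRange r).filter p := by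
  refine List.Perm.eq_of_pairwise (le := (· < ·)) (fun a b _ _ h1 h2 => absurd h1 h2.asymm) ?_ ?_ ?_
  · rw [List.pairwise_filter, List.pairwise_ofFn]
    intro i j hij h1 h2
    by_contra h
    rcases (not_lt.1 h).eq_or_lt with h | h
    · exact hij.ne' (σ.symm.injective h)
    · have := hσ _ _ h h2 h1
      simp only [Equiv.apply_symm_apply] at this
      exact hij.asymm this
  · exact (List.pairwise_lt_finRange r).filter _
  · refine List.Perm.filter _ ?_
    rw [List.ofFn_eq_map]
    exact Equiv.Perm.map_finRange_perm σ.symm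

theorem lt_of_filter_eq {r : ℕ} (p : Fin r → Bool) (σ : Equiv.Perm (Fin r))
    (h : (List.ofFn σ.symm).filter p = (List.finRange r).filter p) (i j : Fin r) (hij : i < j)
    (hi : p i = true) (hj : p j = true) : σ i < σ j := by
  have h2 : ((List.finRange r).filter p).Pairwise (· < ·) := (List.pairwise_lt_finRange r).filter _
  rw [← h, List.pairwise_filter, List.pairwise_ofFn] at h2
  by_contra h'
  rcases (not_lt.1 h').eq_or_lt with h' | h'
  · exact hij.ne' (σ.injective h')
  · have := h2 h'
    simp only [Equiv.symm_apply_apply] at this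
    exact hij.asymm (this hj hi)

/-- The word attached to `σ` lists the values of `σ⁻¹`, and `σ` is increasing on a block of indices
exactly when these indices occur in their natural order in the word. -/
theorem mem_shuffles_iff {r k : ℕ} (σ : Equiv.Perm (Fin r)) :
    σ ∈ shuffles r k ↔
      List.ofFn σ.symm ∈ shuf ((List.finRange r).take k) ((List.finRange r).drop k) := by
  rw [mem_shuf_iff (fun i => decide (i.val < k)), ← filter_finRange_lt, ← filter_finRange_not_lt]
  · simp only [shuffles, Finset.mem_filter, Finset.mem_univ, true_and]
    constructor
    · intro h
      refine ⟨filter_ofFn_symm _ σ fun i j hij h1 h2 => h i j hij (Or.inl (by simpa using h2)),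
        filter_ofFn_symm _ σ fun i j hij h1 h2 => h i j hij (Or.inr (by simpa using h1))⟩
    · rintro ⟨h1, h2⟩ i j hij (hk | hk)
      · exact lt_of_filter_eq _ σ h1 i j hij (by simp; omega) (by simp; omega)
      · exact lt_of_filter_eq _ σ h2 i j hij (by simp; omega) (by simp; omega)
  · rw [← filter_finRange_lt]
    intro i hi
    exact (List.mem_filter.1 hi).2
  · rw [← filter_finRange_not_lt]
    intro i hi
    simpa using (List.mem_filter.1 hi).2

theorem exists_perm_of_mem_shuf {r k : ℕ} {w : List (Fin r)}
    (hw : w ∈ shuf ((List.finRange r).take k) ((List.finRange r).drop k)) :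
    ∃ σ : Equiv.Perm (Fin r), List.ofFn σ.symm = w := by
  have hlen : w.length = r := by
    rw [length_of_mem_shuf _ _ _ hw, ← List.length_append, List.take_append_drop,
      List.length_finRange]
  rw [mem_shuf_iff (fun i => decide (i.val < k)), ← filter_finRange_lt, ← filter_finRange_not_lt]
    at hw
  · have hperm : w.Perm (List.finRange r) := by
      refine (List.filter_append_perm (fun i => decide (i.val < k)) w).symm.trans ?_
      rw [hw.1, hw.2]
      exact List.filter_append_perm _ _
    have hnd : w.Nodup := hperm.nodup_iff.2 (List.nodup_finRange r)
    have hinj : Function.Injective fun i : Fin r => w[i.val]'(i.isLt.trans_eq hlen.symm) := fun i j hij =>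
      Fin.ext ((List.Nodup.getElem_inj_iff hnd).1 hij)
    refine ⟨(Equiv.ofBijective _ (Finite.injective_iff_bijective.1 hinj)).symm, ?_⟩
    rw [Equiv.symm_symm]
    exact List.ext_getElem (by simp [hlen]) fun i h1 h2 => by simp
  · rw [← filter_finRange_lt]
    intro i hi
    exact (List.mem_filter.1 hi).2
  · rw [← filter_finRange_not_lt]
    intro i hi
    simpa using (List.mem_filter.1 hi).2

theorem sum_shuffles {M : Type*} [AddCommMonoid M] (r k : ℕ) (φ : List (Fin r) → M) :
    ∑ σ ∈ shuffles r k, φ (List.ofFn σ.symm) =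
      shSum φ ((List.finRange r).take k) ((List.finRange r).drop k) := by
  classical
  have hnd : (shuf ((List.finRange r).take k) ((List.finRange r).drop k)).Nodup := by
    refine nodup_shuf (fun i => decide (i.val < k)) _ _ ?_ ?_
    · rw [← filter_finRange_lt]
      intro i hi
      exact (List.mem_filter.1 hi).2
    · rw [← filter_finRange_not_lt]
      intro i hi
      simpa using (List.mem_filter.1 hi).2
  rw [shSum, ← List.sum_toFinset _ hnd]
  refine Finset.sum_bij (fun σ _ => List.ofFn σ.symm) ?_ ?_ ?_ ?_
  · intro σ hσ
    rw [List.mem_toFinset]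
    exact (mem_shuffles_iff σ).1 hσ
  · intro σ _ τ _ h
    have := List.ofFn_injective h
    exact Equiv.symm_bijective.injective (DFunLike.coe_injective this)
  · intro w hw
    rw [List.mem_toFinset] at hw
    obtain ⟨σ, rfl⟩ := exists_perm_of_mem_shuf hw
    exact ⟨σ, (mem_shuffles_iff σ).2 hw, rfl⟩
  · intro σ _
    rfl

/-! ### Alternal polynomials -/

/-- The value of a polynomial at a list. -/
def evalList {R : Type*} [CommRing R] [Algebra ℚ R] {r : ℕ} (p : Poly r) (l : List R) : R :=
  aeval (fun i : Fin r => l.getD i.val 0) p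

theorem aeval_shuffleSum {R : Type*} [CommRing R] [Algebra ℚ R] {r : ℕ} (k : ℕ) (p : Poly r)
    (x : Fin r → R) : aeval x (shuffleSum r k p) =
      shSum (evalList p) (((List.finRange r).take k).map x) (((List.finRange r).drop k).map x) := by
  rw [shSum_map, ← sum_shuffles r k fun w => evalList p (w.map x), shuffleSum, LinearMap.sum_apply,
    map_sum]
  refine Finset.sum_congr rfl fun σ _ => ?_
  rw [AlgHom.toLinearMap_apply, aeval_rename, evalList]
  congr 2
  funext i
  simp

/-- Alternality in depth `r`. -/
def altSubmodule (r : ℕ) : Submodule ℚ (Poly r) :=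
  ⨅ k ∈ Finset.Icc 1 (r - 1), LinearMap.ker (shuffleSum r k)

theorem mem_altSubmodule {r : ℕ} {p : Poly r} :
    p ∈ altSubmodule r ↔ ∀ k, 1 ≤ k → k ≤ r - 1 → shuffleSum r k p = 0 := by
  simp [altSubmodule, Submodule.mem_iInf]

theorem isAlternal_iff (F : PolyMould) :
    IsAlternal F ↔ F 0 = 0 ∧ ∀ r, F r ∈ altSubmodule r := by
  simp only [IsAlternal, mem_altSubmodule]
  refine and_congr_right fun _ => ⟨fun h r k h1 h2 => h r k (by omega) h1 h2, fun h r k _ => h r k⟩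

/-- Alternality specialises to arbitrary lists of elements of `Coord`; the converse evaluates at
distinct variables. The list form makes recursion on the shuffled words available. -/
theorem mem_altSubmodule_iff {r : ℕ} {p : Poly r} :
    p ∈ altSubmodule r ↔ ∀ u v : List Coord, u ≠ [] → v ≠ [] → u.length + v.length = r →
      shSum (evalList p) u v = 0 := by
  rw [mem_altSubmodule]
  constructor
  · intro h u v hu hv hr
    have hu' := List.length_pos_iff.2 hu
    have hv' := List.length_pos_iff.2 hv
    have h1 := aeval_shuffleSum u.length p fun i => (u ++ v).getD i.val 0
    rw [h _ hu' (by omega), map_zero] at h1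
    have h2 : (List.finRange r).map (fun i => (u ++ v).getD i.val 0) = u ++ v :=
      List.ext_getElem (by simp [hr]) fun i h1 h2 => by
        simp only [List.length_map, List.length_finRange] at h1
        rw [List.getElem_map, List.getElem_finRange]
        simp only [Fin.val_cast]
        rw [List.getD_eq_getElem]
    rw [List.map_take, List.map_drop, h2, List.take_left, List.drop_left] at h1
    exact h1.symm
  · intro h k h1 h2
    have h3 := aeval_shuffleSum k p fun i => (X i.val : Coord)
    rw [h] at h3
    · refine rename_injective _ Fin.val_injective ?_
      rw [map_zero, ← h3, rename_eq_aeval]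
      rfl
    · intro h'
      have := congrArg List.length h'
      simp at this
      omega
    · intro h'
      have := congrArg List.length h'
      simp at this
      omega
    · rw [← List.length_append, ← List.map_append, List.take_append_drop]
      simp

/-- Substitution of `u_2, …, u_{r+1}`. -/
def succHom (r : ℕ) : Poly r →ₐ[ℚ] Poly (r + 1) := rename Fin.succ

/-- Substitution of `u_1, …, u_r`, in one more variable. -/
def castSuccHom (r : ℕ) : Poly r →ₐ[ℚ] Poly (r + 1) := rename Fin.castSucc

theorem evalList_succHom {R : Type*} [CommRing R] [Algebra ℚ R] {r : ℕ} (p : Poly r) (x : R)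
    (w : List R) : evalList (succHom r p) (x :: w) = evalList p w := by
  rw [evalList, succHom, aeval_rename, evalList]
  rfl

theorem evalList_castSuccHom {R : Type*} [CommRing R] [Algebra ℚ R] {r : ℕ} (p : Poly r) (x : R)
    (w : List R) (hw : w.length = r) : evalList (castSuccHom r p) (w ++ [x]) = evalList p w := by
  rw [evalList, castSuccHom, aeval_rename, evalList]
  congr 2
  funext i
  exact List.getD_append _ _ _ _ (by rw [hw]; exact i.isLt)

theorem evalList_sub {R : Type*} [CommRing R] [Algebra ℚ R] {r : ℕ} (p q : Poly r) (w : List R) :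
    evalList (p - q) w = evalList p w - evalList q w := map_sub _ _ _

/-- Split the shuffles by their first letter for `succHom` and by their last letter for
`castSuccHom`. Alternality of `p` kills every remaining shuffle sum except those where one list has
become empty, and these boundary terms are the same on both sides. -/
theorem succHom_sub_castSuccHom_mem {r : ℕ} {p : Poly r} (hp : p ∈ altSubmodule r) :
    succHom r p - castSuccHom r p ∈ altSubmodule (r + 1) := by
  rw [mem_altSubmodule_iff] at hp ⊢
  have key : ∀ u v : List Coord, u.length + v.length = r → u ++ v ≠ [] →
      shSum (evalList p) u v =
        (if u = [] then evalList p v else 0) + (if v = [] then evalList p u else 0) := by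
    intro u v hr hne
    by_cases hu : u = [] <;> by_cases hv : v = []
    · simp [hu, hv] at hne
    · simp [hu, hv, shSum_nil_left]
    · simp [hu, hv, shSum_nil_right]
    · simp [hu, hv, hp u v hu hv hr]
  intro u v hu hv hr
  have h1 : shSum (evalList (succHom r p)) u v =
      (if u.length = 1 then evalList p v else 0) + (if v.length = 1 then evalList p u else 0) := by
    obtain ⟨x, u, rfl⟩ := List.exists_cons_of_ne_nil hu
    obtain ⟨y, v, rfl⟩ := List.exists_cons_of_ne_nil hv
    simp only [List.length_cons] at hr
    rw [shSum_cons_cons]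
    simp only [evalList_succHom]
    rw [key u (y :: v) (by simp; omega) (by simp), key (x :: u) v (by simp; omega) (by simp)]
    simp
  have h2 : shSum (evalList (castSuccHom r p)) u v =
      (if u.length = 1 then evalList p v else 0) + (if v.length = 1 then evalList p u else 0) := by
    obtain ⟨u, x, rfl⟩ := (List.eq_nil_or_concat u).resolve_left hu
    obtain ⟨v, y, rfl⟩ := (List.eq_nil_or_concat v).resolve_left hv
    simp only [List.concat_eq_append, List.length_append, List.length_singleton] at hr ⊢
    rw [shSum_snoc_snoc]
    have h3 : ∀ (z : Coord) (w w' : List Coord), w.length + w'.length = r →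
        shSum (fun l => evalList (castSuccHom r p) (l ++ [z])) w w' = shSum (evalList p) w w' :=
      fun z w w' h => shSum_congr fun l hl => evalList_castSuccHom p z l (by omega)
    rw [h3 _ _ _ (by simp; omega), h3 _ _ _ (by simp; omega),
      key u (v ++ [y]) (by simp; omega) (by simp), key (u ++ [x]) v (by simp; omega) (by simp)]
    simp
  have h3 : shSum (evalList (succHom r p - castSuccHom r p)) u v +
      shSum (evalList (castSuccHom r p)) u v = shSum (evalList (succHom r p)) u v := by
    rw [← shSum_add]
    simp only [evalList_sub, sub_add_cancel]
  rw [h1, h2] at h3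
  simpa using h3

theorem shuffleSum_sum_X_mul {r : ℕ} (k : ℕ) (p : Poly r) :
    shuffleSum r k ((∑ i, X i) * p) = (∑ i, X i) * shuffleSum r k p := by
  simp only [shuffleSum, LinearMap.sum_apply, AlgHom.toLinearMap_apply, map_mul, Finset.mul_sum,
    map_sum, rename_X]
  refine Finset.sum_congr rfl fun σ _ => ?_
  rw [Equiv.sum_comp σ.symm fun i => (X i : Poly r)]

theorem sum_X_ne_zero (r : ℕ) : (∑ i, X i : Poly (r + 1)) ≠ 0 := by
  intro h
  have := congrArg (aeval fun i : Fin (r + 1) => if i = 0 then (1 : ℚ) else 0) h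
  simp at this

/-- The sum of the variables is symmetric, hence passes through shuffle sums, and it is a nonzero
element of a domain. -/
theorem sum_X_mul_mem_iff {r : ℕ} {p : Poly (r + 1)} :
    (∑ i, X i) * p ∈ altSubmodule (r + 1) ↔ p ∈ altSubmodule (r + 1) := by
  simp only [mem_altSubmodule, shuffleSum_sum_X_mul, mul_eq_zero, sum_X_ne_zero, false_or]

/-! ### Lie elements are alternal -/

theorem diffSubst_sum_X (r : ℕ) : diffSubst r (∑ i, X i) = X r - X 0 := by
  rw [map_sum]
  simp only [diffSubst_X]
  rw [Fin.sum_univ_eq_sum_range (fun i => (X (i + 1) - X i : Coord)), Finset.sum_range_sub]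

theorem diffSubst_succHom {r : ℕ} (p : Poly r) :
    diffSubst (r + 1) (succHom r p) = shift (diffSubst r p) := by
  have : (diffSubst (r + 1)).comp (succHom r) = shift.comp (diffSubst r) := by
    ext1 i
    simp only [AlgHom.comp_apply, succHom, rename_X, diffSubst_X, map_sub, shift_X, Fin.val_succ]
  exact DFunLike.congr_fun this p

theorem diffSubst_castSuccHom {r : ℕ} (p : Poly r) :
    diffSubst (r + 1) (castSuccHom r p) = diffSubst r p := by
  have : (diffSubst (r + 1)).comp (castSuccHom r) = diffSubst r := by
    ext1 i
    simp only [AlgHom.comp_apply, castSuccHom, rename_X, diffSubst_X, Fin.val_castSucc]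
  exact DFunLike.congr_fun this p

/-- In coordinates the commutator multiplies by `x_0 - x_r`, the negative of the telescoping sum of
the `u_i = x_i - x_{i-1}`. -/
theorem commutator_a_polyOfDepth {r : ℕ} (p : Poly r) :
    letter 0 * polyOfDepth r p - polyOfDepth r p * letter 0 =
      polyOfDepth r (-((∑ i, X i) * p)) := by
  apply coords_injective
  funext s
  rw [map_sub, Pi.sub_apply, coords_a_mul, coords_mul_a]
  rcases eq_or_ne s r with rfl | h
  · rw [coords_polyOfDepth_same, coords_polyOfDepth_same, map_neg, map_mul, diffSubst_sum_X]
    ring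
  · simp only [coords_polyOfDepth_ne h]
    ring

theorem commutator_b_polyOfDepth {r : ℕ} (p : Poly r) :
    letter 1 * polyOfDepth r p - polyOfDepth r p * letter 1 =
      polyOfDepth (r + 1) (succHom r p - castSuccHom r p) := by
  apply coords_injective
  funext s
  rw [map_sub, Pi.sub_apply]
  cases s with
  | zero =>
    rw [coords_b_mul_zero, coords_mul_b_zero, coords_polyOfDepth_ne (by omega), sub_zero]
  | succ s =>
    rw [coords_b_mul_succ, coords_mul_b_succ]
    rcases eq_or_ne s r with rfl | h
    · rw [coords_polyOfDepth_same, coords_polyOfDepth_same, map_sub, diffSubst_succHom,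
        diffSubst_castSuccHom]
    · rw [coords_polyOfDepth_ne h, coords_polyOfDepth_ne (by omega), map_zero, sub_zero]

/-- The polynomials in `a`, `b` given by alternal polynomials of weight `n`. -/
def altSet (n : ℕ) : Set Assoc :=
  {z | ∃ (r d : ℕ) (p : Poly r), 1 ≤ r ∧ d + r = n ∧ p ∈ altSubmodule r ∧ p.IsHomogeneous d ∧
    polyOfDepth r p = z}

/-- The span of the polynomials in `a`, `b` given by alternal polynomials of weight `n`. -/
def altSpan (n : ℕ) : Submodule ℚ Assoc := Submodule.span ℚ (altSet n)

theorem letter_one_mem_altSpan : letter 1 ∈ altSpan 1 := by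
  refine Submodule.subset_span ⟨1, 0, 1, le_rfl, rfl, ?_, isHomogeneous_one _ _, ?_⟩
  · rw [mem_altSubmodule]
    intro k h1 h2
    omega
  · have := polyOfDepth_monomial (0 : Fin 1 →₀ ℕ)
    rw [show monomial (0 : Fin 1 →₀ ℕ) (1 : ℚ) = 1 from rfl] at this
    rw [this]
    simp [cElt_one]

theorem sum_X_isHomogeneous (r : ℕ) : (∑ i, X i : Poly r).IsHomogeneous 1 :=
  IsHomogeneous.sum _ _ _ fun _ _ => isHomogeneous_X _ _

theorem commutator_letter_mem_altSpan (x : Fin 2) {n : ℕ} {z : Assoc} (hz : z ∈ altSpan n) :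
    letter x * z - z * letter x ∈ altSpan (n + 1) := by
  induction hz using Submodule.span_induction with
  | mem z hz =>
    obtain ⟨r, d, p, hr, hd, hp, hh, rfl⟩ := hz
    apply Submodule.subset_span
    fin_cases x
    · refine ⟨r, d + 1, -((∑ i, X i) * p), hr, by omega, ?_, ?_,
        (commutator_a_polyOfDepth p).symm⟩
      · obtain ⟨r, rfl⟩ : ∃ s, r = s + 1 := ⟨r - 1, by omega⟩
        exact neg_mem (sum_X_mul_mem_iff.2 hp)
      · rw [add_comm d]
        exact ((sum_X_isHomogeneous r).mul hh).neg
    · exact ⟨r + 1, d, _, by omega, by omega, succHom_sub_castSuccHom_mem hp,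
        hh.rename_isHomogeneous.sub hh.rename_isHomogeneous, (commutator_b_polyOfDepth p).symm⟩
  | zero => simp
  | add g g' _ _ h h' =>
    rw [mul_add, add_mul, add_sub_add_comm]
    exact add_mem h h'
  | smul t g _ h =>
    rw [mul_smul_comm, smul_mul_assoc, ← smul_sub]
    exact Submodule.smul_mem _ _ h

/-- By the Jacobi identity, stability under brackets with the two letters suffices. -/
theorem commutator_mem_altSpan {m : ℕ} {f : LieAB} (hf : IsLieMonomial m f) {n : ℕ} {z : Assoc}
    (hz : z ∈ altSpan n) : toAssoc f * z - z * toAssoc f ∈ altSpan (m + n) := by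
  induction hf generalizing n z with
  | of x =>
    rw [toAssoc_of, add_comm]
    exact commutator_letter_mem_altSpan x hz
  | @lie k l f g _ _ h1 h2 =>
    have h3 := h1 (h2 hz)
    have h4 := h2 (h1 hz)
    rw [← add_assoc] at h3
    rw [← add_assoc, add_comm l] at h4
    convert sub_mem h3 h4 using 1
    rw [toAssoc_lie]
    noncomm_ring

/-- The generator `a` is the exception, having depth 0. It disappears once a bracket is formed,
because `[a, a] = 0` and `[f, a] = -[a, f]`. -/
theorem IsLieMonomial.mem_altSpan {n : ℕ} {f : LieAB} (hf : IsLieMonomial n f) :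
    (n = 1 ∧ f = genA) ∨ toAssoc f ∈ altSpan n := by
  induction hf with
  | of x =>
    fin_cases x
    · exact Or.inl ⟨rfl, rfl⟩
    · right
      rw [toAssoc_of]
      exact letter_one_mem_altSpan
  | @lie m n f g hf hg h1 h2 =>
    right
    rw [toAssoc_lie]
    rcases h2 with ⟨rfl, rfl⟩ | h2
    · rcases h1 with ⟨rfl, rfl⟩ | h1
      · rw [sub_self]
        exact zero_mem _
      · rw [← neg_sub]
        refine neg_mem ?_
        rw [genA, toAssoc_of]
        exact commutator_letter_mem_altSpan 0 h1
    · exact commutator_mem_altSpan hf h2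

theorem toAssoc_mem_altSpan {n : ℕ} (hn : 2 ≤ n) {f : LieAB} (hf : f ∈ lieWeight n) :
    toAssoc f ∈ altSpan n := by
  induction hf using Submodule.span_induction with
  | mem f hf => exact hf.mem_altSpan.resolve_left (by omega)
  | zero => simp
  | add g g' _ _ h h' => rw [map_add]; exact add_mem h h'
  | smul t g _ h => rw [map_smul]; exact Submodule.smul_mem _ _ h

theorem exists_mould_of_mem_altSpan {n : ℕ} {z : Assoc} (hz : z ∈ altSpan n) :
    ∃ F : PolyMould, IsAlternal F ∧
      (∀ r m, coeff m (F r) ≠ 0 → m.degree + r = n) ∧ polyOfMould F = z := by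
  simp only [isAlternal_iff]
  induction hz using Submodule.span_induction with
  | mem z hz =>
    obtain ⟨r, d, p, hr, hd, hp, hh, rfl⟩ := hz
    refine ⟨DirectSum.lof ℚ ℕ Poly r p, ⟨?_, fun s => ?_⟩, fun s m hm => ?_, polyOfMould_of r p⟩
    · rw [DirectSum.lof_eq_of, DirectSum.of_eq_of_ne _ _ _ (by omega)]
    · rcases eq_or_ne s r with rfl | h
      · rwa [DirectSum.lof_apply]
      · rw [DirectSum.lof_eq_of, DirectSum.of_eq_of_ne _ _ _ h]
        exact zero_mem _
    · rcases eq_or_ne s r with rfl | h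
      · rw [DirectSum.lof_apply] at hm
        by_contra h2
        exact hm (hh.coeff_eq_zero (by omega))
      · rw [DirectSum.lof_eq_of, DirectSum.of_eq_of_ne _ _ _ h] at hm
        simp at hm
  | zero => exact ⟨0, ⟨rfl, fun r => zero_mem _⟩, fun r m hm => by simp at hm, map_zero _⟩
  | add z z' _ _ h h' =>
    obtain ⟨F, hF1, hF2, rfl⟩ := h
    obtain ⟨G, hG1, hG2, rfl⟩ := h'
    refine ⟨F + G, ⟨?_, fun r => ?_⟩, fun r m hm => ?_, map_add _ _ _⟩
    · rw [DirectSum.add_apply, hF1.1, hG1.1, add_zero]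
    · rw [DirectSum.add_apply]
      exact add_mem (hF1.2 r) (hG1.2 r)
    · rw [DirectSum.add_apply, coeff_add] at hm
      by_cases h0 : coeff m (F r) = 0
      · exact hG2 r m fun h1 => hm (by rw [h0, h1, add_zero])
      · exact hF2 r m h0
  | smul t z _ h =>
    obtain ⟨F, hF1, hF2, rfl⟩ := h
    refine ⟨t • F, ⟨?_, fun r => ?_⟩, fun r m hm => ?_, map_smul _ _ _⟩
    · rw [DirectSum.smul_apply, hF1.1, smul_zero]
    · rw [DirectSum.smul_apply]
      exact Submodule.smul_mem _ _ (hF1.2 r)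
    · rw [DirectSum.smul_apply, coeff_smul] at hm
      exact hF2 r m fun h0 => hm (by rw [h0, smul_zero])

theorem exists_mould_of_mem_lieWeight {n : ℕ} (hn : 2 ≤ n) {f : LieAB} (hf : f ∈ lieWeight n) :
    ∃ F : PolyMould, IsAlternal F ∧
      (∀ r m, coeff m (F r) ≠ 0 → m.degree + r = n) ∧ polyOfMould F = toAssoc f :=
  exists_mould_of_mem_altSpan (toAssoc_mem_altSpan hn hf)

/-! ### Alternal polynomials are Lie elements -/

/-- The differences `x_{i+1} - x_i`. -/
def diffVar (i : ℕ) : Coord := X (i + 1) - X i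

/-- The variables `u_i, …, u_{j-1}`, with indices counted from `0`. -/
def diffList (i j : ℕ) : List Coord := (List.Ico i j).map diffVar

theorem shift_diffVar (i : ℕ) : shift (diffVar i) = diffVar (i + 1) := by
  rw [diffVar, map_sub, shift_X, shift_X, diffVar]

theorem diffList_cons {i j : ℕ} (h : i < j) : diffList i j = diffVar i :: diffList (i + 1) j := by
  rw [diffList, List.Ico.eq_cons h, List.map_cons, diffList]

theorem diffList_snoc {i j : ℕ} (h : i ≤ j) :
    diffList i (j + 1) = diffList i j ++ [diffVar j] := by
  rw [diffList, List.Ico.succ_top h, List.map_append, diffList, List.map_singleton]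

theorem diffList_self (i : ℕ) : diffList i i = [] := by
  rw [diffList, List.Ico.self_empty, List.map_nil]

theorem length_diffList (i j : ℕ) : (diffList i j).length = j - i := by
  rw [diffList, List.length_map, List.Ico.length]

/-- The sum of `φ` over the shuffles of `u_i, …, u_{k-1}` and `u_{j-1}, …, u_{k+1}`, followed by
`u_k`. -/
def endSum (φ : List Coord → Coord) (i k j : ℕ) : Coord :=
  shSum (fun w => φ (w ++ [diffVar k])) (diffList i k) (diffList (k + 1) j).reverse

/-- The coordinates of right-normed brackets. -/
def bracketSum (φ : List Coord → Coord) (i j : ℕ) : Coord :=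
  ∑ k ∈ Finset.Ico i j, (-1) ^ (j + k + 1) * endSum φ i k j

theorem reverse_diffList {k j : ℕ} (h : k < j) :
    (diffList k j).reverse = diffVar (j - 1) :: (diffList k (j - 1)).reverse := by
  obtain ⟨j, rfl⟩ : ∃ m, j = m + 1 := ⟨j - 1, by omega⟩
  rw [diffList_snoc (by omega), List.reverse_append]
  rfl

/-- The shuffled words begin with `u_i` or with `u_{j-1}`, according to the list that supplies the
first letter. The two conditions say that this list is nonempty; `i + 2 ≤ j` ensures that the fixed
last letter is not also the first. -/
theorem endSum_cons (χ : Coord → Coord) (φ ψ : List Coord → Coord)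
    (h : ∀ x w, φ (x :: w) = χ x * ψ w) {i k j : ℕ} (hik : i ≤ k) (hkj : k < j)
    (hij : i + 2 ≤ j) : endSum φ i k j =
      (if i < k then χ (diffVar i) * endSum ψ (i + 1) k j else 0) +
      (if k < j - 1 then χ (diffVar (j - 1)) * endSum ψ i k (j - 1) else 0) := by
  have hmul : ∀ (y : Coord) (u v : List Coord), shSum (fun w => χ y * ψ (w ++ [diffVar k])) u v =
      χ y * shSum (fun w => ψ (w ++ [diffVar k])) u v := fun y u v =>
    (map_shSum (AddMonoidHom.mulLeft (χ y)) (fun w => ψ (w ++ [diffVar k])) u v).symm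
  rcases hik.eq_or_lt with rfl | hik
  · rw [if_neg (lt_irrefl _), if_pos (by omega), endSum, endSum, diffList_self,
      reverse_diffList (by omega), shSum_nil_left, shSum_nil_left, List.cons_append, h, zero_add]
  · rw [if_pos hik]
    rcases (show k ≤ j - 1 by omega).eq_or_lt with rfl | hk
    · rw [if_neg (lt_irrefl _), show endSum φ i (j - 1) j = endSum φ i (j - 1) (j - 1 + 1) by
        rw [Nat.sub_add_cancel (by omega)], show endSum ψ (i + 1) (j - 1) j =
        endSum ψ (i + 1) (j - 1) (j - 1 + 1) by rw [Nat.sub_add_cancel (by omega)]]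
      rw [endSum, endSum, diffList_self, List.reverse_nil, shSum_nil_right, shSum_nil_right,
        diffList_cons hik, List.cons_append, h, add_zero]
    · rw [if_pos hk, endSum, endSum, endSum, diffList_cons hik, reverse_diffList (by omega),
        shSum_cons_cons]
      simp only [List.cons_append, h, hmul]

/-- This recursion mirrors bracketing with `c_i`: left multiplication uses the first variable and
shifts the others, right multiplication uses the last variable with the opposite sign. -/
theorem bracketSum_cons (χ : Coord → Coord) (φ ψ : List Coord → Coord)
    (h : ∀ x w, φ (x :: w) = χ x * ψ w) {i j : ℕ} (hij : i + 1 ≤ j) :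
    bracketSum φ i (j + 1) =
      χ (diffVar i) * bracketSum ψ (i + 1) (j + 1) - χ (diffVar j) * bracketSum ψ i j := by
  have h1 : bracketSum φ i (j + 1) = ∑ k ∈ Finset.Ico i (j + 1),
      ((if i < k then (-1) ^ (j + 1 + k + 1) * (χ (diffVar i) * endSum ψ (i + 1) k (j + 1)) else 0)
        + (if k < j then (-1) ^ (j + 1 + k + 1) * (χ (diffVar j) * endSum ψ i k j) else 0)) := by
    refine Finset.sum_congr rfl fun k hk => ?_
    rw [Finset.mem_Ico] at hk
    rw [endSum_cons χ φ ψ h hk.1 hk.2 (by omega), Nat.add_sub_cancel, mul_add, mul_ite, mul_ite,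
      mul_zero]
  rw [h1, Finset.sum_add_distrib, ← Finset.sum_filter, ← Finset.sum_filter,
    show (Finset.Ico i (j + 1)).filter (fun k => i < k) = Finset.Ico (i + 1) (j + 1) by
      ext k; simp only [Finset.mem_filter, Finset.mem_Ico]; omega,
    show (Finset.Ico i (j + 1)).filter (fun k => k < j) = Finset.Ico i j by
      ext k; simp only [Finset.mem_filter, Finset.mem_Ico]; omega,
    sub_eq_add_neg, bracketSum, bracketSum, Finset.mul_sum, Finset.mul_sum,
    ← Finset.sum_neg_distrib]
  congr 1
  · exact Finset.sum_congr rfl fun k _ => by ring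
  · exact Finset.sum_congr rfl fun k _ => by ring

/-- The monomial with given exponents, as a function on lists. -/
def powList : List ℕ → List Coord → Coord
  | [], _ => 1
  | n :: ns, l => l.headD 0 ^ n * powList ns l.tail

theorem evalList_monomial {r : ℕ} (m : Fin r →₀ ℕ) (l : List Coord) :
    evalList (monomial m 1) l = powList (List.ofFn m) l := by
  have key : ∀ (r : ℕ) (m : Fin r → ℕ) (l : List Coord),
      ∏ i, l.getD i.val 0 ^ m i = powList (List.ofFn m) l := by
    intro r
    induction r with
    | zero => intro m l; rfl
    | succ r ih =>
      intro m l
      rw [Fin.prod_univ_succ, List.ofFn_succ, powList, ← ih]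
      congr 1
      · cases l <;> rfl
      · refine Finset.prod_congr rfl fun i _ => ?_
        cases l <;> simp
  rw [evalList, aeval_monomial, map_one, one_mul, Finsupp.prod_fintype _ _ fun i => pow_zero _]
  exact key r m l

theorem powList_cons_cons (n : ℕ) (ns : List ℕ) (x : Coord) (l : List Coord) :
    powList (n :: ns) (x :: l) = x ^ n * powList ns l := rfl

theorem bracketSum_powList_cons (n : ℕ) (ns : List ℕ) {i j : ℕ} (hij : i + 1 ≤ j) :
    bracketSum (powList (n :: ns)) i (j + 1) =
      diffVar i ^ n * bracketSum (powList ns) (i + 1) (j + 1) -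
        diffVar j ^ n * bracketSum (powList ns) i j :=
  bracketSum_cons (· ^ n) _ _ (powList_cons_cons n ns) hij

theorem bracketSum_powList_singleton (n i : ℕ) :
    bracketSum (powList [n]) i (i + 1) = diffVar i ^ n := by
  rw [bracketSum, Nat.Ico_succ_singleton, Finset.sum_singleton, endSum, diffList_self,
    diffList_self, List.reverse_nil, shSum_nil_left, List.nil_append, powList_cons_cons,
    show i + 1 + i + 1 = 2 * (i + 1) by ring, pow_mul]
  simp [powList]

theorem shift_bracketSum (ns : List ℕ) (hns : ns ≠ []) (i : ℕ) :
    shift (bracketSum (powList ns) i (i + ns.length)) =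
      bracketSum (powList ns) (i + 1) (i + 1 + ns.length) := by
  induction ns generalizing i with
  | nil => exact absurd rfl hns
  | cons n ns ih =>
    rcases eq_or_ne ns [] with rfl | h
    · rw [List.length_singleton, bracketSum_powList_singleton, bracketSum_powList_singleton,
        map_pow, shift_diffVar]
    · have hpos := List.length_pos_iff.2 h
      rw [List.length_cons, ← add_assoc, ← add_assoc, bracketSum_powList_cons _ _ (by omega),
        bracketSum_powList_cons _ _ (by omega), map_sub, map_mul, map_mul, map_pow, map_pow,
        shift_diffVar, shift_diffVar, ih h,
        show i + ns.length + 1 = i + 1 + ns.length by ring, ih h,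
        show i + 1 + ns.length + 1 = i + 1 + 1 + ns.length by ring]

/-- Right-normed brackets. -/
def rightNormed : List LieAB → LieAB
  | [] => 0
  | [x] => x
  | x :: y :: w => ⁅x, rightNormed (y :: w)⁆

/-- The Lie element `ad(-a)^m(b)`. -/
def cLie (m : ℕ) : LieAB := (fun x => -⁅genA, x⁆)^[m] genB

theorem cLie_succ (m : ℕ) : cLie (m + 1) = -⁅genA, cLie m⁆ :=
  Function.iterate_succ_apply' _ _ _

theorem cLie_mem (m : ℕ) : cLie m ∈ lieWeight (m + 1) := by
  induction m with
  | zero => exact of_mem_lieWeight 1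
  | succ m ih =>
    rw [cLie_succ, add_comm]
    exact neg_mem (lie_mem_lieWeight (of_mem_lieWeight 0) ih)

theorem toAssoc_cLie (m : ℕ) : toAssoc (cLie m) = (-1 : ℚ) ^ m • cElt (m + 1) := by
  induction m with
  | zero => rw [pow_zero, one_smul]; exact toAssoc_of 1
  | succ m ih =>
    rw [cLie_succ, map_neg, toAssoc_lie, ih, genA, toAssoc_of, cElt_succ, pow_succ]
    simp only [mul_smul_comm, smul_mul_assoc, ← smul_sub, mul_neg, mul_one, neg_smul]

theorem coords_mul_cElt_zero (m : ℕ) (f : Assoc) : coords (f * cElt (m + 1)) 0 = 0 := by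
  induction m generalizing f with
  | zero => rw [zero_add, cElt_one, coords_mul_b_zero]
  | succ m ih =>
    rw [cElt_succ, mul_sub, map_sub, ← mul_assoc, ← mul_assoc, Pi.sub_apply, coords_mul_a, ih, ih,
      mul_zero, sub_zero]

theorem coords_mul_cElt_succ (m : ℕ) (f : Assoc) (r : ℕ) :
    coords (f * cElt (m + 1)) (r + 1) = (X r - X (r + 1)) ^ m * coords f r := by
  induction m generalizing f with
  | zero => rw [zero_add, cElt_one, coords_mul_b_succ, pow_zero, one_mul]
  | succ m ih =>
    rw [cElt_succ, mul_sub, map_sub, ← mul_assoc, ← mul_assoc, Pi.sub_apply, coords_mul_a, ih, ih,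
      coords_mul_a]
    ring

theorem neg_one_pow_smul (m : ℕ) (x y : Coord) :
    (-1 : ℚ) ^ m • ((x - y) ^ m) = (y - x) ^ m := by
  rw [Algebra.smul_def, map_pow, map_neg, map_one, ← mul_pow]
  ring

theorem coords_lie_cLie_zero (m : ℕ) (g : LieAB) : coords (toAssoc ⁅cLie m, g⁆) 0 = 0 := by
  rw [toAssoc_lie, toAssoc_cLie, smul_mul_assoc, mul_smul_comm, map_sub, map_smul, map_smul]
  simp only [Pi.sub_apply, Pi.smul_apply, coords_cElt_mul_zero, coords_mul_cElt_zero, smul_zero,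
    sub_zero]

theorem coords_lie_cLie_succ (m : ℕ) (g : LieAB) (r : ℕ) :
    coords (toAssoc ⁅cLie m, g⁆) (r + 1) =
      diffVar 0 ^ m * shift (coords (toAssoc g) r) - diffVar r ^ m * coords (toAssoc g) r := by
  rw [toAssoc_lie, toAssoc_cLie, smul_mul_assoc, mul_smul_comm, map_sub, map_smul, map_smul]
  simp only [Pi.sub_apply, Pi.smul_apply, coords_cElt_mul_succ, coords_mul_cElt_succ]
  rw [← smul_mul_assoc, ← smul_mul_assoc, neg_one_pow_smul, neg_one_pow_smul]
  rfl

/-- Both sides obey the same recursion in the first bracketed element, by `coords_lie_cLie_succ` and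
`bracketSum_powList_cons`. -/
theorem coords_rightNormed (ns : List ℕ) (hns : ns ≠ []) :
    coords (toAssoc (rightNormed (ns.map cLie))) =
      Pi.single ns.length (bracketSum (powList ns) 0 ns.length) := by
  induction ns with
  | nil => exact absurd rfl hns
  | cons n ns ih =>
    funext s
    cases ns with
    | nil =>
      change coords (toAssoc (cLie n)) s = (Pi.single 1 (bracketSum (powList [n]) 0 (0 + 1)) :
        ℕ → Coord) s
      rw [bracketSum_powList_singleton, toAssoc_cLie, map_smul, Pi.smul_apply,
        ← mul_one (cElt (n + 1))]
      cases s with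
      | zero => rw [coords_cElt_mul_zero, smul_zero, Pi.single_eq_of_ne (by omega)]
      | succ s =>
        rw [coords_cElt_mul_succ, coords_one]
        rcases eq_or_ne s 0 with rfl | h
        · rw [Pi.single_eq_same, Pi.single_eq_same, map_one, mul_one, neg_one_pow_smul]
          rfl
        · rw [Pi.single_eq_of_ne h, Pi.single_eq_of_ne (by omega), map_zero, mul_zero, smul_zero]
    | cons n' ns =>
      have ih' := ih (by simp)
      have hr : rightNormed ((n :: n' :: ns).map cLie) =
          ⁅cLie n, rightNormed ((n' :: ns).map cLie)⁆ := rfl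
      rw [hr]
      cases s with
      | zero =>
        rw [coords_lie_cLie_zero, Pi.single_eq_of_ne]
        simp
      | succ s =>
        rw [coords_lie_cLie_succ, ih', List.length_cons (a := n)]
        rcases eq_or_ne s (n' :: ns).length with rfl | h
        · rw [Pi.single_eq_same, Pi.single_eq_same, bracketSum_powList_cons _ _ (by simp)]
          have := shift_bracketSum (n' :: ns) (by simp) 0
          rw [zero_add] at this
          rw [this, zero_add, add_comm 1]
        · rw [Pi.single_eq_of_ne h, Pi.single_eq_of_ne (by omega), map_zero, mul_zero, mul_zero,
            sub_zero]

theorem rightNormed_mem (ns : List ℕ) (hns : ns ≠ []) :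
    rightNormed (ns.map cLie) ∈ lieWeight (ns.sum + ns.length) := by
  induction ns with
  | nil => exact absurd rfl hns
  | cons n ns ih =>
    cases ns with
    | nil => simpa [rightNormed] using cLie_mem n
    | cons n' ns =>
      have h := lie_mem_lieWeight (cLie_mem n) (ih (by simp))
      have h2 : n + 1 + ((n' :: ns).sum + (n' :: ns).length) =
          (n :: n' :: ns).sum + (n :: n' :: ns).length := by
        simp only [List.sum_cons, List.length_cons]
        ring
      rw [h2] at h
      exact h

/-- The linear map which replaces products of the `c_i` by right-normed brackets. -/
def lieOfDepth (r : ℕ) : Poly r →ₗ[ℚ] LieAB :=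
  (basisMonomials (Fin r) ℚ).constr ℚ fun m => rightNormed ((List.ofFn m).map cLie)

theorem lieOfDepth_monomial {r : ℕ} (m : Fin r →₀ ℕ) :
    lieOfDepth r (monomial m 1) = rightNormed ((List.ofFn m).map cLie) := by
  rw [show monomial m (1 : ℚ) = basisMonomials (Fin r) ℚ m by rw [coe_basisMonomials],
    lieOfDepth, Module.Basis.constr_basis]

theorem lieOfDepth_mem {r d : ℕ} {p : Poly (r + 1)} (hp : p.IsHomogeneous d) :
    lieOfDepth (r + 1) p ∈ lieWeight (d + (r + 1)) := by
  rw [p.as_sum, map_sum]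
  refine sum_mem fun m hm => ?_
  have hd : m.degree = d := by
    by_contra h
    exact mem_support_iff.1 hm (hp.coeff_eq_zero h)
  rw [← mul_one (coeff m p), ← smul_eq_mul, ← smul_monomial, map_smul, lieOfDepth_monomial]
  refine Submodule.smul_mem _ _ ?_
  have h := rightNormed_mem (List.ofFn m) (by simp)
  rwa [List.sum_ofFn, List.length_ofFn, ← Finsupp.degree_eq_sum, hd] at h

theorem bracketSum_add (φ ψ : List Coord → Coord) (i j : ℕ) :
    bracketSum (fun w => φ w + ψ w) i j = bracketSum φ i j + bracketSum ψ i j := by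
  simp only [bracketSum, endSum, shSum_add, mul_add, Finset.sum_add_distrib]

theorem bracketSum_smul (t : ℚ) (φ : List Coord → Coord) (i j : ℕ) :
    bracketSum (fun w => t • φ w) i j = t • bracketSum φ i j := by
  have h : ∀ k, endSum (fun w => t • φ w) i k j = t • endSum φ i k j := fun k =>
    (map_shSum (DistribSMul.toAddMonoidHom Coord t) (fun w => φ (w ++ [diffVar k])) _ _).symm
  simp only [bracketSum, h, mul_smul_comm, Finset.smul_sum]

theorem coords_lieOfDepth {r : ℕ} (p : Poly (r + 1)) :
    coords (toAssoc (lieOfDepth (r + 1) p)) =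
      Pi.single (r + 1) (bracketSum (evalList p) 0 (r + 1)) := by
  let B : Poly (r + 1) →ₗ[ℚ] Coord :=
    { toFun := fun p => bracketSum (evalList p) 0 (r + 1)
      map_add' := fun p q => by
        rw [← bracketSum_add]
        congr 1
        funext w
        exact map_add _ _ _
      map_smul' := fun t p => by
        rw [RingHom.id_apply, ← bracketSum_smul]
        congr 1
        funext w
        exact map_smul _ _ _ }
  have : (coords.comp toAssoc).comp (lieOfDepth (r + 1)) =
      (LinearMap.single ℚ (fun _ => Coord) (r + 1)).comp B := by
    refine poly_hom_ext fun m => ?_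
    have h := coords_rightNormed (List.ofFn m) (by simp)
    rw [List.length_ofFn] at h
    change coords (toAssoc (lieOfDepth (r + 1) (monomial m 1))) =
      Pi.single (r + 1) (bracketSum (evalList (monomial m 1)) 0 (r + 1))
    rw [lieOfDepth_monomial, h]
    congr 2
    funext w
    exact (evalList_monomial m w).symm
  exact LinearMap.congr_fun this p

/-- Moving the fixed end letter one place to the left changes the sign: shuffle an initial segment
with the reversed remaining segment and split by the last letter. The two resulting terms are
consecutive values of `endSum`, and alternality makes their sum vanish. -/
theorem endSum_of_alternal {r : ℕ} {p : Poly (r + 1)} (hp : p ∈ altSubmodule (r + 1)) {k : ℕ}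
    (hk : k ≤ r) : endSum (evalList p) 0 (r - k) (r + 1) =
      (-1) ^ k * evalList p (diffList 0 (r + 1)) := by
  induction k with
  | zero =>
    rw [pow_zero, one_mul, Nat.sub_zero, endSum, diffList_self, List.reverse_nil,
      shSum_nil_right, diffList_snoc (by omega)]
  | succ k ih =>
    have h1 := mem_altSubmodule_iff.1 hp (diffList 0 (r - k))
      (diffList (r - k) (r + 1)).reverse
      (List.ne_nil_of_length_pos (by rw [length_diffList]; omega))
      (List.ne_nil_of_length_pos (by rw [List.length_reverse, length_diffList]; omega))
      (by rw [List.length_reverse, length_diffList, length_diffList]; omega)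
    have h2 : diffList 0 (r - k) = diffList 0 (r - (k + 1)) ++ [diffVar (r - (k + 1))] := by
      rw [← diffList_snoc (by omega)]
      congr 1
      omega
    have h3 : (diffList (r - k) (r + 1)).reverse =
        (diffList (r - k + 1) (r + 1)).reverse ++ [diffVar (r - k)] := by
      rw [diffList_cons (by omega), List.reverse_cons]
    rw [h2, h3, shSum_snoc_snoc, ← h2, ← h3] at h1
    have h4 : r - k = r - (k + 1) + 1 := by omega
    have h5 : endSum (evalList p) 0 (r - (k + 1)) (r + 1) +
        endSum (evalList p) 0 (r - k) (r + 1) = 0 := by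
      rw [endSum, endSum, ← h4]
      exact h1
    rw [ih (by omega)] at h5
    rw [eq_neg_of_add_eq_zero_left h5, pow_succ]
    ring

theorem evalList_diffList {r : ℕ} (p : Poly r) : evalList p (diffList 0 r) = diffSubst r p := by
  rw [evalList, diffSubst]
  congr 2
  funext i
  rw [List.getD_eq_getElem _ _ (by rw [length_diffList]; omega)]
  simp [diffList, diffVar, List.Ico]

/-- The signs of `bracketSum` and `endSum_of_alternal` cancel, so each of the `r + 1` summands
equals `p` in the difference variables. -/
theorem bracketSum_of_alternal {r : ℕ} {p : Poly (r + 1)} (hp : p ∈ altSubmodule (r + 1)) :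
    bracketSum (evalList p) 0 (r + 1) = ((r : ℚ) + 1) • diffSubst (r + 1) p := by
  have h : ∀ k ∈ Finset.Ico 0 (r + 1), (-1) ^ (r + 1 + k + 1) * endSum (evalList p) 0 k (r + 1) =
      diffSubst (r + 1) p := by
    intro k hk
    rw [Finset.mem_Ico] at hk
    have h := endSum_of_alternal hp (k := r - k) (by omega)
    rw [show r - (r - k) = k by omega] at h
    rw [h, evalList_diffList, ← mul_assoc, ← pow_add,
      show r + 1 + k + 1 + (r - k) = 2 * (r + 1) by omega, pow_mul]
    simp
  rw [bracketSum, Finset.sum_congr rfl h, Finset.sum_const, Nat.card_Ico, Nat.sub_zero,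
    ← Nat.cast_smul_eq_nsmul ℚ, Nat.cast_succ]

theorem exists_lie_of_alternal {r d : ℕ} {p : Poly (r + 1)} (hp : p ∈ altSubmodule (r + 1))
    (hd : p.IsHomogeneous d) :
    ∃ f ∈ lieWeight (d + (r + 1)), toAssoc f = polyOfDepth (r + 1) p := by
  refine ⟨((r : ℚ) + 1)⁻¹ • lieOfDepth (r + 1) p, Submodule.smul_mem _ _ (lieOfDepth_mem hd),
    coords_injective ?_⟩
  rw [map_smul, map_smul, coords_lieOfDepth, bracketSum_of_alternal hp, coords_polyOfDepth,
    Pi.single_smul, smul_smul, inv_mul_cancel₀ (by positivity), one_smul]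

/-! ### Homogeneous components -/

theorem homogeneousComponent_map {σ τ : Type*} {e : ℕ}
    (L : MvPolynomial σ ℚ →ₗ[ℚ] MvPolynomial τ ℚ)
    (hL : ∀ n p, p.IsHomogeneous n → (L p).IsHomogeneous (n + e)) (n : ℕ) (p : MvPolynomial σ ℚ) :
    homogeneousComponent (n + e) (L p) = L (homogeneousComponent n p) := by
  conv_lhs => rw [← sum_homogeneousComponent p, map_sum, map_sum]
  have h : ∀ i, homogeneousComponent (n + e) (L (homogeneousComponent i p)) =
      if i = n then L (homogeneousComponent n p) else 0 := fun i => by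
    rw [homogeneousComponent_of_mem (hL i _ (homogeneousComponent_isHomogeneous i p))]
    by_cases hi : i = n
    · subst hi
      simp
    · rw [if_neg (by omega), if_neg hi]
  rw [Finset.sum_congr rfl fun i _ => h i, Finset.sum_ite_eq']
  split_ifs with hn
  · rfl
  · rw [homogeneousComponent_eq_zero n p (by rw [Finset.mem_range] at hn; omega), map_zero]

theorem shuffleSum_isHomogeneous {r : ℕ} (k : ℕ) {d : ℕ} {p : Poly r} (hp : p.IsHomogeneous d) :
    (shuffleSum r k p).IsHomogeneous d := by
  rw [shuffleSum, LinearMap.sum_apply]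
  exact IsHomogeneous.sum _ _ _ fun σ _ => hp.rename_isHomogeneous

theorem homogeneousComponent_mem_altSubmodule {r : ℕ} {p : Poly r} (hp : p ∈ altSubmodule r)
    (d : ℕ) : homogeneousComponent d p ∈ altSubmodule r := by
  rw [mem_altSubmodule] at hp ⊢
  intro k h1 h2
  have := homogeneousComponent_map (e := 0) (shuffleSum r k)
    (fun n p hp => shuffleSum_isHomogeneous k hp) d p
  rw [hp k h1 h2, map_zero] at this
  exact this.symm

theorem pushPoly_isHomogeneous {r d : ℕ} {p : Poly r} (hp : p.IsHomogeneous d) :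
    (pushPoly r p).IsHomogeneous d := by
  have := hp.aeval (fun i : Fin r => if h : i.val + 1 < r then (X ⟨i.val + 1, h⟩ : Poly r)
    else -∑ j, X j) (n := 1) fun i => by
      split_ifs
      · exact isHomogeneous_X _ _
      · exact (sum_X_isHomogeneous r).neg
  rwa [one_mul] at this

theorem pushPoly_homogeneousComponent {r : ℕ} {p : Poly r} (hp : pushPoly r p = p) (d : ℕ) :
    pushPoly r (homogeneousComponent d p) = homogeneousComponent d p := by
  have := homogeneousComponent_map (e := 0) (pushPoly r).toLinearMap
    (fun n p hp => pushPoly_isHomogeneous hp) d p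
  rw [AlgHom.toLinearMap_apply, hp] at this
  exact this.symm

/-! ### Push-invariance -/

/-- The substitution `u_{r+1} ↦ -u_1 - ⋯ - u_r`. -/
def closeHom (r : ℕ) : Poly (r + 1) →ₐ[ℚ] Poly r :=
  aeval (Fin.snoc (α := fun _ => Poly r) X (-∑ j, X j))

theorem closeHom_castSucc {r : ℕ} (i : Fin r) : closeHom r (X i.castSucc) = X i := by
  rw [closeHom, aeval_X, Fin.snoc_castSucc]

theorem closeHom_last (r : ℕ) : closeHom r (X (Fin.last r)) = -∑ j, X j := by
  rw [closeHom, aeval_X, Fin.snoc_last]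

theorem closeHom_castSuccHom {r : ℕ} (p : Poly r) : closeHom r (castSuccHom r p) = p := by
  have : (closeHom r).comp (castSuccHom r) = AlgHom.id ℚ _ := by
    ext1 i
    rw [AlgHom.comp_apply, castSuccHom, rename_X, closeHom_castSucc]
    rfl
  exact DFunLike.congr_fun this p

theorem closeHom_succHom {r : ℕ} (p : Poly r) : closeHom r (succHom r p) = pushPoly r p := by
  have : (closeHom r).comp (succHom r) = pushPoly r := by
    ext1 i
    rw [AlgHom.comp_apply, succHom, rename_X, pushPoly, aeval_X]
    split_ifs with h
    · exact closeHom_castSucc (⟨i.val + 1, h⟩ : Fin r)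
    · rw [← closeHom_last]
      congr 2
      exact Fin.ext (by simp; omega)
  exact DFunLike.congr_fun this p

theorem closeHom_sum_X (r : ℕ) : closeHom r (∑ i, X i) = 0 := by
  rw [Fin.sum_univ_castSucc, map_add, map_sum, closeHom_last]
  simp only [closeHom_castSucc]
  ring

/-- Modulo the sum of the variables the last variable is minus the sum of the others, so `p` is
congruent to its image under `closeHom`, here 0. -/
theorem exists_eq_sum_X_mul {r : ℕ} {p : Poly (r + 1)} (hp : closeHom r p = 0) :
    ∃ q, p = (∑ i, X i) * q := by
  let I : Ideal (Poly (r + 1)) := Ideal.span {∑ i, X i}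
  have h : (Ideal.Quotient.mkₐ ℚ I).comp ((castSuccHom r).comp (closeHom r)) =
      Ideal.Quotient.mkₐ ℚ I := by
    ext1 i
    rw [AlgHom.comp_apply, AlgHom.comp_apply, Ideal.Quotient.mkₐ_eq_mk, Ideal.Quotient.mk_eq_mk_iff_sub_mem]
    induction i using Fin.lastCases with
    | last =>
      rw [closeHom_last, map_neg, map_sum, ← neg_add', neg_mem_iff]
      simp only [castSuccHom, rename_X]
      rw [← Fin.sum_univ_castSucc (fun i => (X i : Poly (r + 1)))]
      exact Ideal.mem_span_singleton_self _
    | cast i =>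
      rw [closeHom_castSucc, castSuccHom, rename_X, sub_self]
      exact zero_mem _
  have h2 := DFunLike.congr_fun h p
  rw [AlgHom.comp_apply, AlgHom.comp_apply, hp, map_zero, map_zero, Ideal.Quotient.mkₐ_eq_mk,
    eq_comm, Ideal.Quotient.eq_zero_iff_mem, Ideal.mem_span_singleton] at h2
  exact h2

theorem exists_homogeneous_quotient {r d : ℕ} {p : Poly r} (hd : p.IsHomogeneous d)
    (hpush : pushPoly r p = p) : ∃ q : Poly (r + 1),
      castSuccHom r p - succHom r p = (∑ i, X i) * q ∧
      (q = 0 ∨ ∃ e, d = e + 1 ∧ q.IsHomogeneous e) := by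
  cases d with
  | zero =>
    -- In degree 0 the polynomial is constant, its two embeddings coincide, and the quotient is 0.
    refine ⟨0, ?_, Or.inl rfl⟩
    rw [← totalDegree_zero_iff_isHomogeneous, totalDegree_eq_zero_iff_eq_C] at hd
    rw [hd, castSuccHom, succHom, rename_C, rename_C, sub_self, mul_zero]
  | succ e =>
    obtain ⟨q, hq⟩ := exists_eq_sum_X_mul (p := castSuccHom r p - succHom r p)
      (by rw [map_sub, closeHom_castSuccHom, closeHom_succHom, hpush, sub_self])
    -- The quotient may be replaced by its component of degree `e`, because the product is
    -- homogeneous of degree `e + 1`.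
    refine ⟨homogeneousComponent e q, ?_,
      Or.inr ⟨e, rfl, homogeneousComponent_isHomogeneous e q⟩⟩
    have h := homogeneousComponent_map (e := 1) (LinearMap.mulLeft ℚ (∑ i, X i : Poly (r + 1)))
      (fun n p hp => by
        rw [LinearMap.mulLeft_apply, add_comm n 1]
        exact (sum_X_isHomogeneous _).mul hp) e q
    rw [LinearMap.mulLeft_apply, ← hq, LinearMap.mulLeft_apply] at h
    rw [← h, homogeneousComponent_of_mem (m := e + 1), if_pos rfl]
    exact hd.rename_isHomogeneous.sub hd.rename_isHomogeneous

/-! ### Existence and uniqueness of the derivation of a mould -/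

/-- The quotient `q` is the mould of `u(b)`, one depth higher and one degree lower than `p`. It is
alternal because its product with the sum of the variables is, so it comes from a Lie element; the
defining equation of `q` then says `[u(a), b] + [a, u(b)] = 0`. -/
theorem exists_der_of_depth {r d : ℕ} {p : Poly (r + 1)} (hp : p ∈ altSubmodule (r + 1))
    (hd : p.IsHomogeneous d) (hpush : pushPoly (r + 1) p = p) :
    ∃ u ∈ derWeight (d + (r + 1)), toAssoc (u genA) = polyOfDepth (r + 1) p := by
  obtain ⟨f, hf, hfp⟩ := exists_lie_of_alternal hp hd
  obtain ⟨q, hq, hq'⟩ := exists_homogeneous_quotient hd hpush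
  obtain ⟨g, hg, hgq⟩ : ∃ g ∈ lieWeight (d + (r + 1)), toAssoc g = polyOfDepth (r + 2) q := by
    rcases hq' with rfl | ⟨e, rfl, he⟩
    · exact ⟨0, zero_mem _, by rw [map_zero, map_zero]⟩
    · have halt : q ∈ altSubmodule (r + 2) := by
        rw [← sum_X_mul_mem_iff, ← hq, ← neg_sub]
        exact neg_mem (succHom_sub_castSuccHom_mem hp)
      obtain ⟨g, hg, hgq⟩ := exists_lie_of_alternal halt he
      exact ⟨g, by rwa [show e + 1 + (r + 1) = e + (r + 1 + 1) by ring], hgq⟩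
  obtain ⟨u, hua, hub⟩ := exists_der f g
  refine ⟨u, ⟨?_, by rwa [hua], by rwa [hub]⟩, by rw [hua, hfp]⟩
  change u ⁅genA, genB⁆ = 0
  apply toAssoc_injective
  rw [LieDerivation.apply_lie_eq_add, hua, hub, map_add, toAssoc_lie, toAssoc_lie, hfp, hgq,
    genA, genB, toAssoc_of, toAssoc_of, commutator_a_polyOfDepth, ← hq,
    ← neg_sub (letter 1 * _), commutator_b_polyOfDepth, ← map_neg, ← map_add, map_zero]
  rw [show -(castSuccHom (r + 1) p - succHom (r + 1) p) +
    -(succHom (r + 1) p - castSuccHom (r + 1) p) = 0 by ring, map_zero]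

theorem coords_der11 {u : Der} (hu : u ∈ der11) (r : ℕ) :
    (X (r + 1) - X 0) * coords (toAssoc (u genB)) (r + 1) =
      coords (toAssoc (u genA)) r - shift (coords (toAssoc (u genA)) r) := by
  have h : u ⁅genA, genB⁆ = 0 := hu
  rw [LieDerivation.apply_lie_eq_add] at h
  have h2 := congrFun (congrArg (fun f => coords (toAssoc f)) h) (r + 1)
  simp only [map_add, toAssoc_lie, genA, genB, toAssoc_of, map_sub, Pi.add_apply, Pi.sub_apply,
    coords_a_mul, coords_mul_a, coords_b_mul_succ, coords_mul_b_succ, map_zero,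
    Pi.zero_apply] at h2
  rw [← sub_eq_zero, ← neg_eq_zero, ← h2]
  simp only [genA, genB]
  ring

theorem isPushInvariant_of_der11 {u : Der} (hu : u ∈ der11) {F : PolyMould}
    (hF : Represents F u) : IsPushInvariant F := by
  intro r
  have h := coords_der11 hu r
  rw [← show polyOfMould F = toAssoc (u genA) from hF, coords_polyOfMould, ← diffSubst_succHom,
    ← diffSubst_castSuccHom] at h
  -- In the variables `u_i` the factor `x_{r+1} - x_0` is their sum, which `closeHom` kills; what
  -- remains is `F_r - push(F)_r = 0`.
  have h2 := congrArg (fun q => closeHom r (sumSubst (r + 1) q)) h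
  simp only [map_mul, map_sub, sumSubst_diffSubst, closeHom_castSuccHom, closeHom_succHom,
    sumSubst_X, Finset.range_zero, Finset.sum_empty, sub_zero] at h2
  rw [← Fin.sum_univ_eq_sum_range, Finset.sum_congr rfl fun i _ => (X_eq_var i).symm,
    closeHom_sum_X, zero_mul] at h2
  exact (sub_eq_zero.1 h2.symm).symm

/-- Lie elements of weight at least 2 are alternal and thus have no depth 0 part. For `u(b)` this is
the extra datum needed for uniqueness, since `coords_der11` only controls positive depths. -/
theorem derGeThree_spec {u : Der} (hu : u ∈ derGeThree) :
    u ∈ der11 ∧ (∃ F, IsAlternal F ∧ IsWeightGeThree F ∧ Represents F u) ∧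
      coords (toAssoc (u genB)) 0 = 0 := by
  induction hu using Submodule.span_induction with
  | mem u hu =>
    obtain ⟨n, hn, hu1, hu2, hu3⟩ := hu
    obtain ⟨F, hF1, hF2, hF3⟩ := exists_mould_of_mem_lieWeight (by omega) hu2
    obtain ⟨G, hG1, -, hG3⟩ := exists_mould_of_mem_lieWeight (by omega) hu3
    refine ⟨hu1, ⟨F, hF1, fun r m hm => ?_, hF3⟩, ?_⟩
    · rw [hF2 r m hm]
      exact hn
    · rw [← hG3, coords_polyOfMould, hG1.1, map_zero]
  | zero =>
    refine ⟨zero_mem _, ⟨0, krvEll.zero_mem.1, krvEll.zero_mem.2.2.2, ?_⟩, ?_⟩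
    · change polyOfMould 0 = toAssoc 0
      rw [map_zero, map_zero]
    · change coords (toAssoc 0) 0 = 0
      rw [map_zero, map_zero]
      rfl
  | add u v _ _ h h' =>
    obtain ⟨hu, ⟨F, hF1, hF2, hF3⟩, hu'⟩ := h
    obtain ⟨hv, ⟨G, hG1, hG2, hG3⟩, hv'⟩ := h'
    rw [isAlternal_iff] at hF1 hG1
    refine ⟨add_mem hu hv, ⟨F + G, (isAlternal_iff _).2 ⟨?_, fun r => ?_⟩, fun r m hm => ?_, ?_⟩, ?_⟩
    · rw [DirectSum.add_apply, hF1.1, hG1.1, add_zero]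
    · rw [DirectSum.add_apply]
      exact add_mem (hF1.2 r) (hG1.2 r)
    · rw [DirectSum.add_apply, coeff_add] at hm
      by_cases h0 : coeff m (F r) = 0
      · exact hG2 r m fun h1 => hm (by rw [h0, h1, add_zero])
      · exact hF2 r m h0
    · rw [Represents, map_add, hF3, hG3, LieDerivation.add_apply, map_add]
    · rw [LieDerivation.add_apply, map_add, map_add, Pi.add_apply, hu', hv', add_zero]
  | smul t u _ h =>
    obtain ⟨hu, ⟨F, hF1, hF2, hF3⟩, hu'⟩ := h
    rw [isAlternal_iff] at hF1
    refine ⟨der11.smul_mem t hu, ⟨t • F, (isAlternal_iff _).2 ⟨?_, fun r => ?_⟩, fun r m hm => ?_,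
      ?_⟩, ?_⟩
    · rw [DirectSum.smul_apply, hF1.1, smul_zero]
    · rw [DirectSum.smul_apply]
      exact Submodule.smul_mem _ _ (hF1.2 r)
    · rw [DirectSum.smul_apply, coeff_smul] at hm
      exact hF2 r m fun h0 => hm (by rw [h0, smul_zero])
    · rw [Represents, map_smul, hF3, LieDerivation.smul_apply, map_smul]
    · rw [LieDerivation.smul_apply, map_smul, map_smul, Pi.smul_apply, hu', smul_zero]

theorem X_sub_X_ne_zero {σ : Type*} {i j : σ} (h : i ≠ j) :
    (X i - X j : MvPolynomial σ ℚ) ≠ 0 :=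
  fun h' => h (X_injective (sub_eq_zero.1 h'))

/-- The value on `b` is determined in positive depth because `x_{r+1} - x_0` is not a zero divisor.
Low weights must be excluded: `a ↦ 0`, `b ↦ a` also annihilates `c`. -/
theorem eq_zero_of_derGeThree {u : Der} (hu : u ∈ derGeThree) (ha : u genA = 0) : u = 0 := by
  obtain ⟨h1, -, h2⟩ := derGeThree_spec hu
  refine Der.ext_gen ha (toAssoc_injective (coords_injective (funext fun r => ?_)))
  cases r with
  | zero =>
    rw [h2]
    change _ = coords (toAssoc 0) 0
    rw [map_zero, map_zero]
    rfl
  | succ r =>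
    have h := coords_der11 h1 r
    rw [ha, map_zero, map_zero, Pi.zero_apply, map_zero, sub_zero] at h
    rw [(mul_eq_zero.1 h).resolve_left (X_sub_X_ne_zero (by omega))]
    change _ = coords (toAssoc 0) (r + 1)
    rw [map_zero, map_zero]
    rfl

theorem derGeThree_ext {F : PolyMould} {u v : Der} (hu : u ∈ derGeThree) (hv : v ∈ derGeThree)
    (hFu : Represents F u) (hFv : Represents F v) : u = v := by
  rw [← sub_eq_zero]
  refine eq_zero_of_derGeThree (sub_mem hu hv) ?_
  rw [LieDerivation.sub_apply, sub_eq_zero]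
  exact toAssoc_injective (hFu.symm.trans hFv)

theorem exists_der_of_homogeneous {r d : ℕ} {p : Poly r} (hp : p ∈ altSubmodule r)
    (hd : p.IsHomogeneous d) (hpush : pushPoly r p = p) (h0 : r = 0 → p = 0)
    (h3 : p ≠ 0 → 3 ≤ d + r) : ∃ u ∈ derGeThree, toAssoc (u genA) = polyOfDepth r p := by
  by_cases hp0 : p = 0
  · refine ⟨0, zero_mem _, ?_⟩
    rw [hp0, map_zero]
    exact map_zero _
  · obtain ⟨r, rfl⟩ : ∃ s, r = s + 1 := ⟨r - 1, by
      have : r ≠ 0 := fun h => hp0 (h0 h)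
      omega⟩
    obtain ⟨u, hu, hu'⟩ := exists_der_of_depth hp hd hpush
    exact ⟨u, Submodule.subset_span ⟨_, h3 hp0, hu⟩, hu'⟩

theorem exists_der_sum {ι : Type*} (s : Finset ι) (z : ι → Assoc)
    (h : ∀ i ∈ s, ∃ u ∈ derGeThree, toAssoc (u genA) = z i) :
    ∃ u ∈ derGeThree, toAssoc (u genA) = ∑ i ∈ s, z i := by
  classical
  induction s using Finset.induction_on with
  | empty => exact ⟨0, zero_mem _, by rw [Finset.sum_empty]; exact map_zero _⟩
  | insert i s hi ih =>
    obtain ⟨u, hu, hu'⟩ := h i (Finset.mem_insert_self i s)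
    obtain ⟨v, hv, hv'⟩ := ih fun j hj => h j (Finset.mem_insert_of_mem hj)
    refine ⟨u + v, add_mem hu hv, ?_⟩
    rw [LieDerivation.add_apply, map_add, hu', hv', Finset.sum_insert hi]

theorem exists_der_of_mould {F : PolyMould} (h1 : IsAlternal F) (h2 : IsPushInvariant F)
    (h3 : IsWeightGeThree F) : ∃ u ∈ derGeThree, Represents F u := by
  rw [isAlternal_iff] at h1
  have hdepth : ∀ r, ∃ u ∈ derGeThree, toAssoc (u genA) = polyOfDepth r (F r) := by
    intro r
    rw [← sum_homogeneousComponent (F r), map_sum]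
    refine exists_der_sum _ _ fun d _ => ?_
    refine exists_der_of_homogeneous (homogeneousComponent_mem_altSubmodule (h1.2 r) d)
      (homogeneousComponent_isHomogeneous _ _) (pushPoly_homogeneousComponent (h2 r) d) ?_ ?_
    · rintro rfl
      rw [h1.1, map_zero]
    · intro hne
      obtain ⟨m, hm⟩ := ne_zero_iff.1 hne
      rw [coeff_homogeneousComponent] at hm
      split_ifs at hm with hd
      · rw [← hd]
        exact h3 r m hm
      · exact absurd rfl hm
  classical
  obtain ⟨u, hu, hu'⟩ := exists_der_sum (DFinsupp.support F) (fun r => polyOfDepth r (F r))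
    fun r _ => hdepth r
  refine ⟨u, hu, ?_⟩
  rw [Represents, hu']
  conv_lhs => rw [← DirectSum.sum_support_of F, map_sum]
  exact Finset.sum_congr rfl fun r _ => polyOfMould_of r (F r)

/-! ### Cyclic words in coordinates -/

/-- The identification of `ℤ/(n+1)` with `{0, …, n}`. -/
def ofZMod (n : ℕ) (z : ZMod (n + 1)) : Fin (n + 1) := z

theorem ofZMod_injective (n : ℕ) : Function.Injective (ofZMod n) := fun _ _ h => h

/-- The variables `y_z`, `z ∈ ℤ/(n+1)`, with `y_z = v_{-z}` (indices counted from `0`). -/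
def cycVar (n : ℕ) (z : ZMod (n + 1)) : Poly (n + 1) := X (ofZMod n (-z))

/-- The substitution `x_i ↦ y_{i+j}`. -/
def cycSubst (n : ℕ) (j : ZMod (n + 1)) : Coord →ₐ[ℚ] Poly (n + 1) :=
  rename fun i : ℕ => ofZMod n (-((i : ZMod (n + 1)) + j))

theorem cycSubst_X (n : ℕ) (j : ZMod (n + 1)) (i : ℕ) :
    cycSubst n j (X i) = cycVar n (i + j) := rename_X _ _

theorem cycSubst_X_top (n : ℕ) (j : ZMod (n + 1)) :
    cycSubst n j (X (n + 1)) = cycSubst n j (X 0) := by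
  rw [cycSubst_X, cycSubst_X]
  congr 1
  simp

theorem cycSubst_shift (n : ℕ) (j : ZMod (n + 1)) (p : Coord) :
    cycSubst n j (shift p) = cycSubst n (j + 1) p := by
  have : (cycSubst n j).comp shift = cycSubst n (j + 1) := by
    ext1 i
    rw [AlgHom.comp_apply, shift_X, cycSubst_X, cycSubst_X]
    congr 1
    push_cast
    ring
  exact DFunLike.congr_fun this p

/-- The cyclic symmetrization in depth `n + 1`. -/
def cycSum (n : ℕ) : Assoc →ₗ[ℚ] Poly (n + 1) where
  toFun f := ∑ j : ZMod (n + 1), cycSubst n j (coords f (n + 1))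
  map_add' f g := by simp only [map_add, Pi.add_apply, Finset.sum_add_distrib]
  map_smul' t f := by simp only [map_smul, Pi.smul_apply, Finset.smul_sum, RingHom.id_apply]

theorem cycSum_apply (n : ℕ) (f : Assoc) :
    cycSum n f = ∑ j : ZMod (n + 1), cycSubst n j (coords f (n + 1)) := rfl

/-- For `a`, the substitutions identify `x_0` with `x_{n+1}`; for `b`, the shift of variables is
absorbed by reindexing `j`. -/
theorem cycSum_letter_mul (n : ℕ) (x : Fin 2) (f : Assoc) :
    cycSum n (letter x * f) = cycSum n (f * letter x) := by
  rw [cycSum_apply, cycSum_apply]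
  fin_cases x
  · simp only [Fin.zero_eta, coords_a_mul, coords_mul_a, map_mul, cycSubst_X_top]
  · simp only [Fin.mk_one, coords_b_mul_succ, coords_mul_b_succ, cycSubst_shift]
    exact Equiv.sum_comp (Equiv.addRight 1) fun j => cycSubst n j (coords f n)

theorem cycSum_mul_comm (n : ℕ) (v w : FreeMonoid (Fin 2)) :
    cycSum n (word (v * w)) = cycSum n (word (w * v)) := by
  induction v using FreeMonoid.inductionOn' generalizing w with
  | one => rw [one_mul, mul_one]
  | of_mul x v ih =>
    rw [mul_assoc, word_mul, word_of, cycSum_letter_mul, ← word_of, ← word_mul, mul_assoc, ih,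
      mul_assoc]

theorem cycSum_eq_zero_of_tr {f : Assoc} (hf : tr f = 0) (n : ℕ) : cycSum n f = 0 :=
  eq_zero_of_tr_eq_zero (cycSum n) (cycSum_mul_comm n) hf

/-- The word `b a^{m 1} b a^{m 2} ⋯ b a^{m r}`. -/
def blocks (r : ℕ) (m : ℕ → ℕ) : List (Fin 2) :=
  (List.range r).flatMap fun i => 1 :: List.replicate (m (i + 1)) 0

theorem blocks_succ (r : ℕ) (m : ℕ → ℕ) :
    blocks (r + 1) m = blocks r m ++ 1 :: List.replicate (m (r + 1)) 0 := by
  rw [blocks, List.range_succ, List.flatMap_append, List.flatMap_singleton, blocks]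

theorem blocks_succ' (r : ℕ) (m : ℕ → ℕ) :
    blocks (r + 1) m = 1 :: List.replicate (m 1) 0 ++ blocks r fun i => m (i + 1) := by
  rw [blocks, List.range_succ_eq_map, List.flatMap_cons, List.flatMap_map, blocks]

theorem blocks_congr {r : ℕ} {m m' : ℕ → ℕ} (h : ∀ i, i < r → m (i + 1) = m' (i + 1)) :
    blocks r m = blocks r m' := by
  induction r with
  | zero => rfl
  | succ r ih => rw [blocks_succ, blocks_succ, ih fun i hi => h i (by omega), h r (by omega)]

theorem eq_replicate_append_blocks (w : List (Fin 2)) :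
    w = List.replicate (expo w 0) 0 ++ blocks (depth w) (expo w) := by
  induction w with
  | nil => rfl
  | cons x w ih =>
    by_cases hx : x = 0
    · have h1 : depth (x :: w) = depth w := by simp [depth, hx]
      have h2 : expo (x :: w) 0 = expo w 0 + 1 := by simp [expo, hx, add_comm]
      have h3 : ∀ i, expo (x :: w) (i + 1) = expo w (i + 1) := fun i => by simp [expo, hx]
      rw [h1, h2, blocks_congr fun i _ => h3 i, List.replicate_succ, List.cons_append, ← ih, hx]
    · have h1 : depth (x :: w) = depth w + 1 := by simp [depth, hx]
      have h2 : expo (x :: w) 0 = 0 := by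
        simp only [expo, hx, if_false]
        exact Finsupp.mapDomain_of_notMem_range _ _ (by simp)
      have h3 : ∀ i, expo (x :: w) (i + 1) = expo w i := fun i => by
        simp only [expo, hx, if_false]
        exact Finsupp.mapDomain_apply Nat.succ_injective _ _
      rw [h1, h2, blocks_succ', h3 0]
      simp only [h3]
      rw [List.replicate_zero, List.nil_append, List.cons_append, ← ih, show x = 1 by omega]

theorem expo_eq_zero_of_depth_lt (w : List (Fin 2)) {k : ℕ} (h : depth w < k) : expo w k = 0 := by
  induction w generalizing k with
  | nil => rfl
  | cons x w ih =>
    obtain ⟨k, rfl⟩ : ∃ l, k = l + 1 := ⟨k - 1, by omega⟩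
    by_cases hx : x = 0
    · simp only [depth, hx, if_true] at h
      simp [expo, hx, ih h]
    · simp only [depth, hx, if_false] at h
      simp only [expo, hx, if_false]
      rw [show k + 1 = Nat.succ k from rfl, Finsupp.mapDomain_apply Nat.succ_injective]
      exact ih (by omega)

/-- The cyclic word `b a^{e 1} b a^{e 2} ⋯ b a^{e (n + 1)}`. -/
def cycBlocks (n : ℕ) (e : ZMod (n + 1) → ℕ) : Cycle (Fin 2) :=
  (blocks (n + 1) fun i => e i : List (Fin 2))

theorem cycBlocks_add_one (n : ℕ) (e : ZMod (n + 1) → ℕ) :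
    cycBlocks n (fun z => e (z + 1)) = cycBlocks n e := by
  rw [cycBlocks, cycBlocks, Cycle.coe_eq_coe, blocks_succ, blocks_succ' n fun i => e i]
  have h : ((n + 1 : ℕ) : ZMod (n + 1)) + 1 = ((1 : ℕ) : ZMod (n + 1)) := by simp
  rw [h]
  have h2 : blocks n (fun i => e (i + 1)) = blocks n fun i => e ((i + 1 : ℕ) : ZMod (n + 1)) := by
    push_cast
    rfl
  rw [h2]
  exact List.isRotated_append

theorem cycBlocks_sub (n : ℕ) (e : ZMod (n + 1) → ℕ) (j : ZMod (n + 1)) :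
    cycBlocks n (fun z => e (z - j)) = cycBlocks n e := by
  obtain ⟨k, rfl⟩ := ZMod.natCast_zmod_surjective j
  induction k with
  | zero => simp
  | succ k ih =>
    rw [← cycBlocks_add_one, ← ih]
    congr 1
    funext z
    push_cast
    congr 1
    ring

/-- Among the indices `0, …, n + 1` only `0` and `n + 1` agree modulo `n + 1`: the `a`s at the two
ends of a word merge when it is closed up to a cycle. -/
theorem mapDomain_natCast_apply {n : ℕ} {m : ℕ →₀ ℕ} (hm : ∀ k, n + 1 < k → m k = 0) {i : ℕ}
    (hi : i ≤ n) : m.mapDomain (Nat.cast : ℕ → ZMod (n + 1)) i =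
      m i + if i = 0 then m (n + 1) else 0 := by
  classical
  rw [Finsupp.mapDomain, Finsupp.sum_of_support_subset (s := Finset.range (n + 2)) _ _ _ (by simp)]
  · rw [Finset.sum_range_succ, Finsupp.add_apply, Finsupp.finsetSum_apply]
    congr 1
    · rw [Finset.sum_eq_single i]
      · rw [Finsupp.single_eq_same]
      · intro k hk hki
        rw [Finset.mem_range] at hk
        rw [Finsupp.single_apply, if_neg]
        intro h
        rw [ZMod.natCast_eq_natCast_iff, Nat.ModEq, Nat.mod_eq_of_lt hk,
          Nat.mod_eq_of_lt (by omega)] at h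
        exact hki h
      · intro h
        rw [Finset.mem_range] at h
        omega
    · rw [Finsupp.single_apply]
      congr 1
      rw [eq_iff_iff, ZMod.natCast_eq_natCast_iff, Nat.ModEq, Nat.mod_self,
        Nat.mod_eq_of_lt (by omega), eq_comm]
  · intro k hk
    rw [Finset.mem_range]
    by_contra h
    exact Finsupp.mem_support_iff.1 hk (hm k (by omega))

theorem cycBlocks_expo {n : ℕ} {w : List (Fin 2)} (hw : depth w = n + 1) :
    cycBlocks n ((expo w).mapDomain (Nat.cast : ℕ → ZMod (n + 1))) = (w : Cycle (Fin 2)) := by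
  have hm : ∀ k, n + 1 < k → expo w k = 0 := fun k hk =>
    expo_eq_zero_of_depth_lt w (by omega)
  conv_rhs => rw [eq_replicate_append_blocks w, hw]
  rw [cycBlocks, Cycle.coe_eq_coe, blocks_succ, blocks_succ]
  have h1 : blocks n (fun i => (expo w).mapDomain (Nat.cast : ℕ → ZMod (n + 1)) i) =
      blocks n (expo w) := blocks_congr fun i hi => by
    rw [mapDomain_natCast_apply hm (by omega), if_neg (by omega), add_zero]
  have h2 : (expo w).mapDomain (Nat.cast : ℕ → ZMod (n + 1)) ((n + 1 : ℕ) : ZMod (n + 1)) =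
      expo w (n + 1) + expo w 0 := by
    have := mapDomain_natCast_apply hm (Nat.zero_le n)
    rw [if_pos rfl, Nat.cast_zero] at this
    rw [ZMod.natCast_self, this, add_comm]
  rw [h1, h2, List.replicate_add, ← List.cons_append, ← List.append_assoc]
  exact List.isRotated_append

/-- The cyclic word of a monomial in the variables `y_z`. -/
def cycOfPoly (n : ℕ) : Poly (n + 1) →ₗ[ℚ] CycWords :=
  (basisMonomials (Fin (n + 1)) ℚ).constr ℚ fun m =>
    Finsupp.single (cycBlocks n fun z => m (ofZMod n (-z))) 1

theorem cycOfPoly_cycSubst_monomial (n : ℕ) (j : ZMod (n + 1)) (m : ℕ →₀ ℕ) :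
    cycOfPoly n (cycSubst n j (monomial m 1)) =
      Finsupp.single (cycBlocks n (m.mapDomain (Nat.cast : ℕ → ZMod (n + 1)))) 1 := by
  rw [cycSubst, rename_monomial]
  rw [show ∀ m : Fin (n + 1) →₀ ℕ, monomial m (1 : ℚ) = basisMonomials (Fin (n + 1)) ℚ m from
    fun m => by rw [coe_basisMonomials], cycOfPoly, Module.Basis.constr_basis,
    ← cycBlocks_sub n (m.mapDomain (Nat.cast : ℕ → ZMod (n + 1))) j]
  congr 2
  funext z
  have hinj : Function.Injective fun z : ZMod (n + 1) => ofZMod n (-(z + j)) := fun z z' h => by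
    simpa using ofZMod_injective n h
  rw [← Finsupp.mapDomain_apply hinj, ← Finsupp.mapDomain_comp, sub_add_cancel]
  rfl

/-- The trace of the component of depth `n`. -/
def trDepth (n : ℕ) : Assoc →ₗ[ℚ] CycWords :=
  onWords fun w => if depth w.toList = n then tr (word w) else 0

/-- All `n + 1` rotated monomials of a word of depth `n + 1` give its cyclic class. Hence `cycSum`
loses no information about the trace. -/
theorem cycOfPoly_cycSum (n : ℕ) (f : Assoc) :
    cycOfPoly n (cycSum n f) = ((n : ℚ) + 1) • trDepth (n + 1) f := by
  have : (cycOfPoly n).comp (cycSum n) = ((n : ℚ) + 1) • trDepth (n + 1) :=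
    assoc_hom_ext fun w => by
      rw [LinearMap.comp_apply, LinearMap.smul_apply, trDepth, onWords_word, cycSum_apply,
        coords_word]
      split_ifs with h
      · rw [h, Pi.single_eq_same, map_sum, Finset.sum_congr rfl fun j _ =>
          cycOfPoly_cycSubst_monomial n j _, cycBlocks_expo h, Finset.sum_const,
          Finset.card_univ, ZMod.card, tr_word, ← Nat.cast_smul_eq_nsmul ℚ, Nat.cast_succ]
      · rw [Pi.single_eq_of_ne (Ne.symm h)]
        simp
  exact LinearMap.congr_fun this f

theorem trDepth_zero {f : Assoc} (hf : coords f 0 = 0) : trDepth 0 f = 0 := by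
  let κ : Coord →ₗ[ℚ] CycWords := (basisMonomials ℕ ℚ).constr ℚ fun m =>
    Finsupp.single (List.replicate (m 0) (0 : Fin 2) : Cycle (Fin 2)) 1
  have : (κ.comp (LinearMap.proj 0)).comp coords = trDepth 0 := assoc_hom_ext fun w => by
    rw [LinearMap.comp_apply, LinearMap.comp_apply, LinearMap.proj_apply, trDepth, onWords_word,
      coords_word]
    split_ifs with h
    · rw [h, Pi.single_eq_same, tr_word, show monomial (expo w.toList) (1 : ℚ) =
        basisMonomials ℕ ℚ (expo w.toList) by rw [coe_basisMonomials], Module.Basis.constr_basis]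
      conv_rhs => rw [eq_replicate_append_blocks w.toList, h]
      simp [blocks]
    · rw [Pi.single_eq_of_ne (Ne.symm h), map_zero]
  rw [← this, LinearMap.comp_apply, LinearMap.comp_apply, LinearMap.proj_apply, hf, map_zero]

theorem exists_tr_eq_sum_trDepth (f : Assoc) :
    ∃ N, ∀ M, N ≤ M → tr f = ∑ n ∈ Finset.range M, trDepth n f := by
  induction f using assoc_induction with
  | hword w =>
    refine ⟨depth w.toList + 1, fun M hM => ?_⟩
    simp only [trDepth, onWords_word]
    rw [Finset.sum_ite_eq, if_pos (Finset.mem_range.2 (by omega))]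
  | hadd f g hf hg =>
    obtain ⟨N, hN⟩ := hf
    obtain ⟨N', hN'⟩ := hg
    refine ⟨max N N', fun M hM => ?_⟩
    simp only [map_add, Finset.sum_add_distrib]
    rw [hN M (le_trans (le_max_left _ _) hM), hN' M (le_trans (le_max_right _ _) hM)]
  | hsmul t f hf =>
    obtain ⟨N, hN⟩ := hf
    refine ⟨N, fun M hM => ?_⟩
    simp only [map_smul, ← Finset.smul_sum]
    rw [hN M hM]

theorem tr_eq_zero_of_cycSum {f : Assoc} (h0 : coords f 0 = 0) (h : ∀ n, cycSum n f = 0) :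
    tr f = 0 := by
  obtain ⟨N, hN⟩ := exists_tr_eq_sum_trDepth f
  rw [hN N le_rfl]
  refine Finset.sum_eq_zero fun n _ => ?_
  cases n with
  | zero => exact trDepth_zero h0
  | succ n =>
    have := cycOfPoly_cycSum n f
    rw [h, map_zero] at this
    exact (smul_eq_zero.1 this.symm).resolve_left (by positivity)

/-! ### The divergence in coordinates -/

/-- The coordinate in depth `s` involves only `x_0, …, x_s`. -/
theorem coords_hom_congr {R : Type*} [CommRing R] [Algebra ℚ R] (f : Assoc) (s : ℕ)
    {φ ψ : Coord →ₐ[ℚ] R} (h : ∀ i ≤ s, φ (X i) = ψ (X i)) :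
    φ (coords f s) = ψ (coords f s) := by
  induction f using word_induction_left generalizing s φ ψ with
  | hone =>
    rw [coords_one]
    rcases eq_or_ne s 0 with rfl | hs
    · rw [Pi.single_eq_same, map_one, map_one]
    · rw [Pi.single_eq_of_ne hs, map_zero, map_zero]
  | hmul w x ih =>
    fin_cases x
    · simp only [Fin.zero_eta, coords_a_mul, map_mul]
      rw [ih s h, h 0 (Nat.zero_le s)]
    · cases s with
      | zero => simp only [Fin.mk_one, coords_b_mul_zero, map_zero]
      | succ s =>
        simp only [Fin.mk_one, coords_b_mul_succ]
        exact ih s (φ := φ.comp shift) (ψ := ψ.comp shift) fun i hi => by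
          simp only [AlgHom.comp_apply, shift_X]
          exact h (i + 1) (by omega)
  | hadd f g hf hg => simp only [map_add, Pi.add_apply, hf s h, hg s h]
  | hsmul t f hf => simp only [map_smul, Pi.smul_apply, hf s h]

theorem coords_succ_eq (f : Assoc) (s : ℕ) : coords f (s + 1) =
    X (s + 1) * coords (rightPart 0 f) (s + 1) + coords (rightPart 1 f) s := by
  conv_lhs => rw [eq_constTerm_add f]
  rw [map_add, map_add, map_smul, Pi.add_apply, Pi.add_apply, Pi.smul_apply, coords_one,
    Pi.single_eq_of_ne (by omega), smul_zero, zero_add, coords_mul_a, coords_mul_b_succ]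

theorem coords_zero_eq (f : Assoc) :
    coords f 0 = C (constTerm f) + X 0 * coords (rightPart 0 f) 0 := by
  conv_lhs => rw [eq_constTerm_add f]
  rw [map_add, map_add, map_smul, Pi.add_apply, Pi.add_apply, Pi.smul_apply, coords_one,
    Pi.single_eq_same, coords_mul_a, coords_mul_b_zero, add_zero, smul_eq_C_mul, mul_one]

/-- The value of a polynomial at `s_1, s_2 - s_1, …, s_r - s_{r-1}`. -/
def evalDiff {R : Type*} [CommRing R] [Algebra ℚ R] {r : ℕ} (p : Poly r) (s : ℕ → R) : R :=
  aeval (fun i : Fin r => s (i.val + 1) - if i.val = 0 then 0 else s i.val) p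

/-- The arguments `s_1, s_2 - s_1, …, s_r - s_{r-1}` have sum `s_r`, so one push turns them into
`s_2 - s_1, …, s_r - s_{r-1}, -s_r`. -/
theorem evalDiff_of_push {R : Type*} [CommRing R] [Algebra ℚ R] {r : ℕ} {p : Poly r}
    (hp : pushPoly r p = p) (s : ℕ → R) : evalDiff p s =
      aeval (fun i : Fin r => if i.val + 1 < r then s (i.val + 2) - s (i.val + 1)
        else -s (i.val + 1)) p := by
  have key : ∀ n, n + 1 ≤ r → ∑ i ∈ Finset.range (n + 1), (s (i + 1) - if i = 0 then 0 else s i) =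
      s (n + 1) := by
    intro n
    induction n with
    | zero => simp
    | succ n ih => intro hn; rw [Finset.sum_range_succ, ih (by omega)]; simp
  have h : (aeval fun i : Fin r => s (i.val + 1) - if i.val = 0 then 0 else s i.val).comp
      (pushPoly r) = aeval (fun i : Fin r => if i.val + 1 < r then s (i.val + 2) - s (i.val + 1)
        else -s (i.val + 1)) := by
    ext1 i
    rw [AlgHom.comp_apply, pushPoly, aeval_X, aeval_X]
    have hi := i.isLt
    split_ifs with h
    · simp
    · rw [map_neg, map_sum]
      simp only [aeval_X]
      have hr : Finset.range r = Finset.range (i.val + 1) := by rw [show i.val + 1 = r by omega]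
      rw [Fin.sum_univ_eq_sum_range (fun i => s (i + 1) - if i = 0 then 0 else s i), hr,
        key _ (by omega)]
  rw [evalDiff]
  conv_lhs => rw [← hp]
  exact DFunLike.congr_fun h p

/-- The value of `F_{n+1}` at `y_{j+1}, y_{j+2} - y_{j+1}, …, y_{j+n+1} - y_{j+n}`. -/
def cycValue (n : ℕ) (p : Poly (n + 1)) (j : ZMod (n + 1)) : Poly (n + 1) :=
  evalDiff p fun i => cycVar n (i + j)

/-- Setting the last variable to 0 removes the words ending in `a`, hence isolates `f_b` in `f` and
`g_b` in `g`. Closing up `f = f_a a + f_b b` expresses `y_j f_a`, and the equation for `u(c) = 0` at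
`x_{n+2} = 0` expresses `y_j g_b`. In the sum the closed-up `f` cancels; push-invariance identifies
the two remaining terms. -/
theorem cycVar_mul_cycSubst_preDiv {u : Der} (hu : u ∈ der11) {F : PolyMould}
    (hF : Represents F u) (n : ℕ) (j : ZMod (n + 1)) :
    cycVar n j * cycSubst n j (coords (preDiv u) (n + 1)) =
      cycValue n (F (n + 1)) j - cycValue n (F (n + 1)) (j - 1) := by
  have hpush := isPushInvariant_of_der11 hu hF (n + 1)
  have hP : coords (toAssoc (u genA)) (n + 1) = diffSubst (n + 1) (F (n + 1)) := by
    rw [← show polyOfMould F = toAssoc (u genA) from hF, coords_polyOfMould]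
  set f := toAssoc (u genA)
  set g := toAssoc (u genB) with hg
  -- Two truncations of the cyclic substitution: `φ` is applied to `g` in depth `n + 2` and `ψ` to
  -- `f` in depth `n + 1`, each annihilating the last variable of that depth.
  let φ : Coord →ₐ[ℚ] Poly (n + 1) := aeval fun i => if i = n + 2 then 0 else cycSubst n j (X i)
  let ψ : Coord →ₐ[ℚ] Poly (n + 1) := aeval fun i => if i = n + 1 then 0 else cycSubst n j (X i)
  have hφX : ∀ i, φ (X i) = if i = n + 2 then 0 else cycSubst n j (X i) := fun i => aeval_X _ _
  have hψX : ∀ i, ψ (X i) = if i = n + 1 then 0 else cycSubst n j (X i) := fun i => aeval_X _ _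
  have hφ : ∀ h s, s ≤ n + 1 → φ (coords h s) = cycSubst n j (coords h s) := fun h s hs =>
    coords_hom_congr h s fun i hi => by rw [hφX, if_neg (by omega)]
  have hψ : ∀ h s, s ≤ n → ψ (coords h s) = cycSubst n j (coords h s) := fun h s hs =>
    coords_hom_congr h s fun i hi => by rw [hψX, if_neg (by omega)]
  have hy : cycSubst n j (X 0) = cycVar n j := by rw [cycSubst_X, Nat.cast_zero, zero_add]
  have h1 : ψ (coords f (n + 1)) = cycSubst n j (coords (rightPart 1 f) n) := by
    rw [coords_succ_eq, map_add, map_mul, hψX, if_pos rfl, zero_mul, zero_add, hψ _ _ le_rfl]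
  have h2 : cycSubst n j (coords f (n + 1)) =
      cycVar n j * cycSubst n j (coords (rightPart 0 f) (n + 1)) + ψ (coords f (n + 1)) := by
    rw [h1, coords_succ_eq, map_add, map_mul, cycSubst_X_top, hy]
  have h3 := congrArg φ (coords_der11 hu (n + 1))
  rw [← hg, coords_succ_eq g, map_mul, map_sub, map_add, map_mul, hφX, if_pos rfl, zero_mul,
    zero_add, zero_sub, hφX, if_neg (by omega), hy, hφ _ _ le_rfl, map_sub, hφ _ _ le_rfl] at h3
  have h4 : φ (shift (coords f (n + 1))) = cycValue n (F (n + 1)) j := by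
    rw [cycValue, evalDiff_of_push hpush, hP]
    have : (φ.comp shift).comp (diffSubst (n + 1)) = aeval (fun i : Fin (n + 1) =>
        if i.val + 1 < n + 1 then cycVar n ((i.val + 2 : ℕ) + j) - cycVar n ((i.val + 1 : ℕ) + j)
        else -cycVar n ((i.val + 1 : ℕ) + j)) := by
      ext1 i
      have hi := i.isLt
      rw [AlgHom.comp_apply, AlgHom.comp_apply, diffSubst_X, aeval_X, map_sub, map_sub, shift_X,
        shift_X, hφX, hφX, cycSubst_X, cycSubst_X, if_neg (show i.val + 1 ≠ n + 2 by omega)]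
      split_ifs
      · omega
      · rw [zero_sub]
      · rfl
      · omega
    exact DFunLike.congr_fun this _
  have h5 : ψ (coords f (n + 1)) = cycValue n (F (n + 1)) (j - 1) := by
    rw [cycValue, evalDiff_of_push hpush, hP]
    have : ψ.comp (diffSubst (n + 1)) = aeval (fun i : Fin (n + 1) =>
        if i.val + 1 < n + 1 then cycVar n ((i.val + 2 : ℕ) + (j - 1)) -
          cycVar n ((i.val + 1 : ℕ) + (j - 1))
        else -cycVar n ((i.val + 1 : ℕ) + (j - 1))) := by
      ext1 i
      have hi := i.isLt
      have e1 : ((i.val + 2 : ℕ) : ZMod (n + 1)) + (j - 1) = (i.val + 1 : ℕ) + j := by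
        push_cast; ring
      have e2 : ((i.val + 1 : ℕ) : ZMod (n + 1)) + (j - 1) = (i.val : ℕ) + j := by
        push_cast; ring
      rw [AlgHom.comp_apply, diffSubst_X, aeval_X, map_sub, e1, e2,
        hψX, hψX, cycSubst_X, cycSubst_X, if_neg (show i.val ≠ n + 1 by omega)]
      split_ifs
      · omega
      · rw [zero_sub]
      · rfl
      · omega
    exact DFunLike.congr_fun this _
  have h6 : coords (preDiv u) (n + 1) =
      coords (rightPart 0 f) (n + 1) + coords (rightPart 1 g) (n + 1) := by
    change coords (rightPart 0 f + rightPart 1 g) (n + 1) = _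
    rw [map_add, Pi.add_apply]
  rw [h6, map_add, mul_add, ← h4, ← h5]
  linear_combination -h3 - h2

/-- As `u(a)` has no depth 0 part, `coords_der11` forces the depth 1 part of `u(b)` to vanish, and
with it the depth 0 part of its right part at `b`. -/
theorem coords_preDiv_zero {u : Der} (hu : u ∈ der11) {F : PolyMould} (hF : Represents F u)
    (hF0 : F 0 = 0) : coords (preDiv u) 0 = 0 := by
  have hP : coords (toAssoc (u genA)) 0 = 0 := by
    rw [← show polyOfMould F = toAssoc (u genA) from hF, coords_polyOfMould, hF0, map_zero]
  have h1 : coords (rightPart 0 (toAssoc (u genA))) 0 = 0 := by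
    have h := coords_zero_eq (toAssoc (u genA))
    rw [hP, constTerm_toAssoc, map_zero, zero_add] at h
    exact (mul_eq_zero.1 h.symm).resolve_left (X_ne_zero 0)
  have h2 : coords (toAssoc (u genB)) 1 = 0 := by
    have h := coords_der11 hu 0
    rw [hP, map_zero, sub_zero] at h
    exact (mul_eq_zero.1 h).resolve_left (X_sub_X_ne_zero (by omega))
  have h3 : coords (rightPart 1 (toAssoc (u genB))) 0 = 0 := by
    have h := congrArg (aeval fun i => if i = 1 then 0 else (X i : Coord))
      (coords_succ_eq (toAssoc (u genB)) 0)
    rw [zero_add, h2, map_zero, map_add, map_mul, aeval_X, if_pos rfl, zero_mul, zero_add] at h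
    rw [h]
    have := coords_hom_congr (rightPart 1 (toAssoc (u genB))) 0
      (φ := AlgHom.id ℚ _) (ψ := aeval fun i => if i = 1 then 0 else (X i : Coord))
      fun i hi => by rw [aeval_X, if_neg (by omega)]; rfl
    exact this
  change coords (rightPart 0 (toAssoc (u genA)) + rightPart 1 (toAssoc (u genB))) 0 = 0
  rw [map_add, Pi.add_apply, h1, h3, add_zero]

/-! ### Powers of the commutator -/

/-- The product of the cyclic differences `y_{z+1} - y_z`. -/
def cycDisc (n : ℕ) : Poly (n + 1) := ∏ z : ZMod (n + 1), (cycVar n (z + 1) - cycVar n z)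

theorem prod_range_zmod {M : Type*} [CommMonoid M] (n : ℕ) (g : ZMod (n + 1) → M)
    (j : ZMod (n + 1)) : ∏ i ∈ Finset.range (n + 1), g (i + j) = ∏ z, g z := by
  rw [← Equiv.prod_comp (Equiv.addRight j) g,
    ← Fin.prod_univ_eq_prod_range (fun i => g ((i : ZMod (n + 1)) + j))]
  change ∏ i : ZMod (n + 1), g ((i.val : ZMod (n + 1)) + j) = _
  simp only [ZMod.natCast_zmod_val]
  rfl

theorem sum_range_zmod {M : Type*} [AddCommMonoid M] (n : ℕ) (g : ZMod (n + 1) → M) :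
    ∑ i ∈ Finset.range (n + 1), g i = ∑ z, g z := by
  rw [← Fin.sum_univ_eq_sum_range (fun i => g (i : ZMod (n + 1)))]
  change ∑ i : ZMod (n + 1), g (i.val : ZMod (n + 1)) = _
  simp only [ZMod.natCast_zmod_val]

theorem toAssoc_c : toAssoc ⁅genA, genB⁆ = cElt 2 := by
  rw [toAssoc_lie, genA, genB, toAssoc_of, toAssoc_of, cElt_succ, zero_add, cElt_one]

theorem coords_c_pow (k : ℕ) : coords (toAssoc ⁅genA, genB⁆ ^ k) =
    Pi.single k (∏ i ∈ Finset.range k, (X i - X (i + 1))) := by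
  have h := coords_list_prod fun _ : Fin k => 1
  rw [List.ofFn_const, List.prod_replicate] at h
  rw [toAssoc_c, h, ← Fin.prod_univ_eq_prod_range]
  simp only [pow_one]

/-- The power `c^{n+1}` has the coordinate `∏ (x_i - x_{i+1})`. Each of the `n + 1` cyclic
substitutions turns it into the full product of cyclic differences with all `n + 1` signs reversed.
-/
theorem cycSum_c_pow (n k : ℕ) : cycSum n (toAssoc ⁅genA, genB⁆ ^ k) =
    if k = n + 1 then C ((-1) ^ (n + 1) * ((n + 1 : ℕ) : ℚ)) * cycDisc n else 0 := by
  rw [cycSum_apply, coords_c_pow]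
  split_ifs with h
  · subst h
    rw [Pi.single_eq_same]
    have key : ∀ j : ZMod (n + 1), cycSubst n j (∏ i ∈ Finset.range (n + 1), (X i - X (i + 1))) =
        (-1) ^ (n + 1) * cycDisc n := fun j => by
      rw [map_prod, cycDisc, ← prod_range_zmod n _ j]
      have h2 : ((-1) ^ (n + 1) : Poly (n + 1)) = ∏ i ∈ Finset.range (n + 1), (-1) := by
        rw [Finset.prod_const, Finset.card_range]
      rw [h2, ← Finset.prod_mul_distrib]
      refine Finset.prod_congr rfl fun i _ => ?_
      rw [map_sub, cycSubst_X, cycSubst_X, show ((i + 1 : ℕ) : ZMod (n + 1)) + j = i + j + 1 by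
        push_cast; ring]
      ring
    rw [Finset.sum_congr rfl fun j _ => key j, Finset.sum_const, Finset.card_univ, ZMod.card,
      nsmul_eq_mul, map_mul, map_pow, map_neg, map_one, map_natCast]
    ring
  · rw [Pi.single_eq_of_ne (Ne.symm h)]
    simp only [map_zero, Finset.sum_const_zero]

/-! ### Circ-constance -/

/-- The rotation of the variables. -/
def rotHom (n : ℕ) : Poly (n + 1) ≃ₐ[ℚ] Poly (n + 1) :=
  renameEquiv ℚ (finRotate (n + 1)).symm

theorem rotHom_cycVar (n : ℕ) (z : ZMod (n + 1)) : rotHom n (cycVar n z) = cycVar n (z + 1) := by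
  rw [rotHom, cycVar, renameEquiv_apply, rename_X, cycVar]
  congr 1
  rw [Equiv.symm_apply_eq, finRotate_apply]
  change -z = -(z + 1) + 1
  ring

theorem rotHom_iterate_cycVar (n k : ℕ) (z : ZMod (n + 1)) :
    (rotHom n)^[k] (cycVar n z) = cycVar n (z + k) := by
  induction k with
  | zero => simp
  | succ k ih =>
    rw [Function.iterate_succ_apply', ih, rotHom_cycVar]
    push_cast
    rw [add_assoc]

/-- The iterates of the rotation of the variables. -/
def rotIter (n k : ℕ) : Poly (n + 1) →ₐ[ℚ] Poly (n + 1) :=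
  aeval fun i => (rotHom n)^[k] (X i)

theorem rotIter_apply (n k : ℕ) (p : Poly (n + 1)) : rotIter n k p = (rotHom n)^[k] p := by
  induction k generalizing p with
  | zero =>
    change aeval X p = p
    exact aeval_X_left_apply p
  | succ k ih =>
    have : rotIter n (k + 1) = (rotHom n : Poly (n + 1) →ₐ[ℚ] Poly (n + 1)).comp (rotIter n k) := by
      ext1 i
      rw [rotIter, aeval_X, AlgHom.comp_apply, ih, Function.iterate_succ_apply']
      rfl
    rw [this, AlgHom.comp_apply, ih, Function.iterate_succ_apply']
    rfl

theorem circ_iterate_apply (A : RatMould) (n k : ℕ) {p q : Poly (n + 1)}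
    (h : A (n + 1) = algebraMap _ (RatFun (n + 1)) p / algebraMap _ _ q) :
    (circ^[k] A) (n + 1) =
      algebraMap _ (RatFun (n + 1)) (rotIter n k p) / algebraMap _ _ (rotIter n k q) := by
  simp only [rotIter_apply]
  induction k with
  | zero => exact h
  | succ k ih =>
    rw [Function.iterate_succ_apply']
    change ratSubst (renameEquiv ℚ (finRotate (n + 1)).symm) ((circ^[k] A) (n + 1)) = _
    rw [ih, map_div₀, ratSubst, IsFractionRing.ringEquivOfRingEquiv_algebraMap,
      IsFractionRing.ringEquivOfRingEquiv_algebraMap, Function.iterate_succ_apply',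
      Function.iterate_succ_apply']
    rfl

/-- The indices match because `-(k + 1) ≡ n - k` modulo `n + 1`. -/
theorem var_eq_cycVar (n k : ℕ) (hk : k ≤ n) : var (n + 1) (n - k) = cycVar n (k + 1 : ℕ) := by
  rw [var, dif_pos (by omega), cycVar]
  congr 1
  have h : -((k + 1 : ℕ) : ZMod (n + 1)) = (n - k : ℕ) := by
    rw [neg_eq_iff_add_eq_zero, ← Nat.cast_add, show k + 1 + (n - k) = n + 1 by omega,
      ZMod.natCast_self]
  rw [h]
  ext
  exact (ZMod.val_natCast_of_lt (show n - k < n + 1 by omega)).symm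

theorem cycVar_ne_zero (n : ℕ) (z : ZMod (n + 1)) : cycVar n z ≠ 0 := X_ne_zero _

theorem cycVar_sub_ne_zero {n : ℕ} {z w : ZMod (n + 1)} (h : z ≠ w) :
    cycVar n z - cycVar n w ≠ 0 :=
  X_sub_X_ne_zero fun h' => h (neg_injective (ofZMod_injective n h'))

theorem cycDisc_ne_zero {n : ℕ} (hn : n ≠ 0) : cycDisc n ≠ 0 :=
  have : Fact (1 < n + 1) := ⟨by omega⟩
  Finset.prod_ne_zero_iff.2 fun z _ => cycVar_sub_ne_zero fun h => one_ne_zero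
    (add_eq_left.1 h)

theorem swapHom_eq_aeval (n : ℕ) : swapHom (n + 1) = aeval fun i : Fin (n + 1) =>
    cycVar n (i.val + 1 : ℕ) - if i.val = 0 then 0 else cycVar n (i.val : ℕ) := by
  ext1 i
  have hi := i.isLt
  rw [swapHom, aeval_X, aeval_X, Nat.add_sub_cancel, var_eq_cycVar _ _ (by omega)]
  congr 1
  split_ifs with h
  · rw [var, dif_neg (by omega)]
  · rw [show n + 1 - i.val = n - (i.val - 1) by omega, var_eq_cycVar _ _ (by omega),
      show i.val - 1 + 1 = i.val by omega]

theorem rotIter_cycVar (n k : ℕ) (z : ZMod (n + 1)) :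
    rotIter n k (cycVar n z) = cycVar n (z + k) := by
  rw [rotIter_apply, rotHom_iterate_cycVar]

theorem rotIter_swapHom (n k : ℕ) (p : Poly (n + 1)) :
    rotIter n k (swapHom (n + 1) p) = cycValue n p k := by
  have : (rotIter n k).comp (swapHom (n + 1)) = aeval fun i : Fin (n + 1) =>
      cycVar n ((i.val + 1 : ℕ) + k) - if i.val = 0 then 0 else cycVar n ((i.val : ℕ) + k) := by
    ext1 i
    rw [AlgHom.comp_apply, swapHom_eq_aeval, aeval_X, aeval_X, map_sub, rotIter_cycVar]
    split_ifs
    · rw [map_zero]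
    · rw [rotIter_cycVar]
  exact DFunLike.congr_fun this p

theorem rotIter_cycDisc (n k : ℕ) : rotIter n k (cycDisc n) = cycDisc n := by
  rw [cycDisc, map_prod]
  simp only [map_sub, rotIter_cycVar, add_right_comm _ (1 : ZMod (n + 1)) (k : ZMod (n + 1))]
  exact Equiv.prod_comp (Equiv.addRight (k : ZMod (n + 1))) fun z => cycVar n (z + 1) - cycVar n z

/-- After the swap the variables are `y_1, y_2 - y_1, …, y_{n+1} - y_n`. Their sum telescopes to
`y_{n+1} = y_0`, and their product is `y_1` times all cyclic differences except `y_1 - y_0`. -/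
theorem swapHom_deltaFactor_mul (n : ℕ) :
    swapHom (n + 1) (deltaFactor (n + 1)) * (cycVar n 1 - cycVar n 0) =
      cycVar n 0 * cycVar n 1 * cycDisc n := by
  have hsum : ∀ m, ∑ i ∈ Finset.range (m + 1),
      (cycVar n (i + 1 : ℕ) - if i = 0 then 0 else cycVar n (i : ℕ)) = cycVar n (m + 1 : ℕ) := by
    intro m
    induction m with
    | zero => simp
    | succ m ih => rw [Finset.sum_range_succ, ih, if_neg (by omega)]; ring
  have hdisc : cycDisc n = ∏ i ∈ Finset.range (n + 1), (cycVar n (i + 1 : ℕ) - cycVar n (i : ℕ)) := by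
    rw [cycDisc, ← prod_range_zmod n _ 0]
    push_cast
    simp only [add_zero]
  rw [deltaFactor, map_mul, map_sum, map_prod, hdisc, swapHom_eq_aeval]
  simp only [aeval_X]
  rw [Fin.sum_univ_eq_sum_range
      fun i => cycVar n (i + 1 : ℕ) - if i = 0 then 0 else cycVar n (i : ℕ),
    Fin.prod_univ_eq_prod_range
      fun i => cycVar n (i + 1 : ℕ) - if i = 0 then 0 else cycVar n (i : ℕ), hsum,
    Finset.prod_range_succ', Finset.prod_range_succ']
  simp only [Nat.add_eq_zero_iff, one_ne_zero, and_false, if_false, if_true, sub_zero, zero_add,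
    Nat.cast_one, Nat.cast_zero, ZMod.natCast_self]
  ring

theorem rotIter_deltaFactor_mul (n k : ℕ) :
    rotIter n k (swapHom (n + 1) (deltaFactor (n + 1))) * (cycVar n (k + 1) - cycVar n k) =
      cycVar n k * cycVar n (k + 1) * cycDisc n := by
  have h := congrArg (rotIter n k) (swapHom_deltaFactor_mul n)
  simpa only [map_mul, map_sub, rotIter_cycVar, rotIter_cycDisc, zero_add, add_comm (1 : ZMod (n + 1))] using h

theorem circ_iterate_swap (F : PolyMould) (n k : ℕ) :
    (circ^[k] (swap (deltaInv (toRatMould F)))) (n + 1) =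
      algebraMap _ (RatFun (n + 1)) (cycValue n (F (n + 1)) k) /
        algebraMap _ _ (rotIter n k (swapHom (n + 1) (deltaFactor (n + 1)))) := by
  rw [← rotIter_swapHom]
  refine circ_iterate_apply _ n k ?_
  rw [swap, deltaInv, toRatMould, map_div₀, ratSubst,
    IsFractionRing.ringEquivOfRingEquiv_algebraMap, IsFractionRing.ringEquivOfRingEquiv_algebraMap]
  rfl

/-- Partial fractions: the quotient of `cycDisc` by the rotated `Δ`-factor is `(y_{k+1} - y_k) /
(y_k y_{k+1})`. -/
theorem circ_iterate_swap_mul (F : PolyMould) {n : ℕ} (hn : n ≠ 0) (k : ℕ) :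
    (circ^[k] (swap (deltaInv (toRatMould F)))) (n + 1) * algebraMap _ _ (cycDisc n) =
      algebraMap _ (RatFun (n + 1)) (cycValue n (F (n + 1)) k) / algebraMap _ _ (cycVar n k) -
      algebraMap _ (RatFun (n + 1)) (cycValue n (F (n + 1)) k) /
        algebraMap _ _ (cycVar n (k + 1)) := by
  have hι : ∀ p : Poly (n + 1), p ≠ 0 → algebraMap _ (RatFun (n + 1)) p ≠ 0 := fun p hp =>
    (map_ne_zero_iff _ (IsFractionRing.injective _ _)).2 hp
  have h := rotIter_deltaFactor_mul n k
  have hD : rotIter n k (swapHom (n + 1) (deltaFactor (n + 1))) ≠ 0 := fun h0 => by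
    rw [h0, zero_mul] at h
    exact mul_ne_zero (mul_ne_zero (cycVar_ne_zero _ _) (cycVar_ne_zero _ _)) (cycDisc_ne_zero hn)
      h.symm
  have h' := congrArg (algebraMap _ (RatFun (n + 1))) h
  simp only [map_mul, map_sub] at h'
  have h1 := hι _ hD
  have h2 := hι _ (cycVar_ne_zero n (k : ZMod (n + 1)))
  have h3 := hι _ (cycVar_ne_zero n ((k : ZMod (n + 1)) + 1))
  rw [circ_iterate_swap]
  field_simp
  linear_combination (-algebraMap _ (RatFun (n + 1)) (cycValue n (F (n + 1)) k)) * h'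

/-- Summation by parts collects the numerator `R_j - R_{j-1}` over `y_j`, which
`cycVar_mul_cycSubst_preDiv` identifies with a summand of the cyclic sum of the divergence. -/
theorem sum_circ_swap_mul {u : Der} (hu : u ∈ der11) {F : PolyMould} (hF : Represents F u) {n : ℕ}
    (hn : n ≠ 0) : (∑ k ∈ Finset.range (n + 1),
      (circ^[k] (swap (deltaInv (toRatMould F)))) (n + 1)) * algebraMap _ _ (cycDisc n) =
      algebraMap _ (RatFun (n + 1)) (cycSum n (preDiv u)) := by
  let R : ZMod (n + 1) → RatFun (n + 1) := fun j => algebraMap _ _ (cycValue n (F (n + 1)) j)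
  let y : ZMod (n + 1) → RatFun (n + 1) := fun j => algebraMap _ _ (cycVar n j)
  have hy : ∀ j, y j ≠ 0 := fun j =>
    (map_ne_zero_iff _ (IsFractionRing.injective _ _)).2 (cycVar_ne_zero _ _)
  rw [Finset.sum_mul, Finset.sum_congr rfl fun k _ => circ_iterate_swap_mul F hn k,
    Finset.sum_sub_distrib, sum_range_zmod n fun j => R j / y j,
    sum_range_zmod n fun j => R j / y (j + 1), cycSum_apply, map_sum,
    ← Equiv.sum_comp (Equiv.subRight 1) fun j => R j / y (j + 1), ← Finset.sum_sub_distrib]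
  refine Finset.sum_congr rfl fun j _ => ?_
  have h := congrArg (algebraMap _ (RatFun (n + 1))) (cycVar_mul_cycSubst_preDiv hu hF n j)
  rw [map_mul, map_sub] at h
  rw [Equiv.subRight_apply, sub_add_cancel, ← sub_div, div_eq_iff (hy j), mul_comm]
  exact h.symm

theorem sum_circ_swap_eq_iff {u : Der} (hu : u ∈ der11) {F : PolyMould} (hF : Represents F u)
    {n : ℕ} (hn : n ≠ 0) (p : Poly (n + 1)) : (∑ k ∈ Finset.range (n + 1),
      (circ^[k] (swap (deltaInv (toRatMould F)))) (n + 1)) = algebraMap _ _ p ↔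
      cycSum n (preDiv u) = p * cycDisc n := by
  have hι := IsFractionRing.injective (Poly (n + 1)) (RatFun (n + 1))
  rw [← hι.eq_iff, ← sum_circ_swap_mul hu hF hn, map_mul,
    mul_left_inj' ((map_ne_zero_iff _ hι).2 (cycDisc_ne_zero hn))]

/-- In depth 1 there is only one rotation, so `R_j - R_{j-1} = 0`. This is why circ-constance
imposes nothing there. -/
theorem cycSum_zero_preDiv {u : Der} (hu : u ∈ der11) {F : PolyMould} (hF : Represents F u) :
    cycSum 0 (preDiv u) = 0 := by
  rw [cycSum_apply]
  refine Finset.sum_eq_zero fun j _ => ?_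
  have h := cycVar_mul_cycSubst_preDiv hu hF 0 j
  rw [show j - 1 = j from @Subsingleton.elim _ (inferInstanceAs (Subsingleton (Fin 1))) _ _,
    sub_self] at h
  exact (mul_eq_zero.1 h).resolve_left (cycVar_ne_zero _ _)

theorem cycSum_preDiv_eq_zero {u : Der} (hu : u ∈ der11) {F : PolyMould} (hF : Represents F u)
    {n : ℕ} (h0 : F (n + 1) = 0) : cycSum n (preDiv u) = 0 := by
  rw [cycSum_apply]
  refine Finset.sum_eq_zero fun j _ => ?_
  have h := cycVar_mul_cycSubst_preDiv hu hF n j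
  rw [h0, cycValue, cycValue, evalDiff, evalDiff, map_zero, map_zero, sub_zero] at h
  exact (mul_eq_zero.1 h).resolve_left (cycVar_ne_zero _ _)

theorem isCircConstant_of_ellDiv {u : Der} (hu : u ∈ der11) {F : PolyMould} (hF : Represents F u)
    {K : ℚ} {k : ℕ} (h : ellDiv u = K • tr (toAssoc ⁅genA, genB⁆ ^ k)) :
    IsCircConstant (swap (deltaInv (toRatMould F))) := by
  intro r hr
  obtain ⟨n, rfl⟩ : ∃ n, r = n + 1 := ⟨r - 1, by omega⟩
  have h1 : tr (preDiv u - K • toAssoc ⁅genA, genB⁆ ^ k) = 0 := by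
    rw [map_sub, map_smul, ← ellDiv_eq, h, sub_self]
  have h2 := cycSum_eq_zero_of_tr h1 n
  rw [map_sub, map_smul, cycSum_c_pow, sub_eq_zero] at h2
  by_cases hk : k = n + 1
  -- The sign is that of the cyclic sum of `c^{n+1}` relative to `cycDisc`.
  · refine ⟨K * (-1) ^ (n + 1), (sum_circ_swap_eq_iff hu hF (by omega) _).2 ?_⟩
    rw [h2, if_pos hk, smul_eq_C_mul, ← mul_assoc, ← map_mul, mul_assoc K]
  · refine ⟨0, (sum_circ_swap_eq_iff hu hF (by omega) _).2 ?_⟩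
    rw [h2, if_neg hk, smul_zero, zero_mul, map_zero, zero_mul]

theorem ellDiv_eq_of_isCircConstant {u : Der} (hu : u ∈ der11) {F : PolyMould}
    (hF : Represents F u) (hF0 : F 0 = 0) (h : IsCircConstant (swap (deltaInv (toRatMould F)))) :
    ∃ (N : ℕ) (K : ℕ → ℚ), ellDiv u =
      ∑ k ∈ Finset.range N, K k • tr (toAssoc ⁅genA, genB⁆ ^ (k + 1)) := by
  -- The constant is chosen to be 0 wherever `F` vanishes, so that only finitely many powers of `c`
  -- occur.
  have h1 : ∀ n, ∃ K : ℚ, (F (n + 1) = 0 → K = 0) ∧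
      cycSum n (preDiv u) = K • cycSum n (toAssoc ⁅genA, genB⁆ ^ (n + 1)) := by
    intro n
    rcases eq_or_ne n 0 with rfl | hn
    · exact ⟨0, fun _ => rfl, by rw [cycSum_zero_preDiv hu hF, zero_smul]⟩
    by_cases h0 : F (n + 1) = 0
    · exact ⟨0, fun _ => rfl, by rw [cycSum_preDiv_eq_zero hu hF h0, zero_smul]⟩
    obtain ⟨K, hK⟩ := h (n + 1) (by omega)
    refine ⟨K * (-1) ^ (n + 1), fun h => absurd h h0, ?_⟩
    rw [(sum_circ_swap_eq_iff hu hF hn _).1 hK, cycSum_c_pow, if_pos rfl, smul_eq_C_mul,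
      ← mul_assoc, ← map_mul]
    congr 2
    have : ((-1 : ℚ) ^ (n + 1)) * (-1) ^ (n + 1) = 1 := by rw [← mul_pow]; simp
    linear_combination (-K * ((n + 1 : ℕ) : ℚ)) * this
  choose K hK0 hK using h1
  obtain ⟨N, hN⟩ : ∃ N, ∀ n, N ≤ n → F (n + 1) = 0 := by
    classical
    refine ⟨(DFinsupp.support F).sup id, fun n hn => ?_⟩
    by_contra hne
    have := Finset.le_sup (f := id) (DFinsupp.mem_support_iff.2 hne)
    simp only [id] at this
    omega
  refine ⟨N, K, ?_⟩
  rw [ellDiv_eq, ← sub_eq_zero]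
  simp only [← map_smul, ← map_sum]
  rw [← map_sub]
  refine tr_eq_zero_of_cycSum ?_ fun n => ?_
  · rw [map_sub, map_sum, Pi.sub_apply, coords_preDiv_zero hu hF hF0, Finset.sum_apply, zero_sub,
      neg_eq_zero]
    refine Finset.sum_eq_zero fun k _ => ?_
    rw [map_smul, Pi.smul_apply, coords_c_pow, Pi.single_eq_of_ne (by omega), smul_zero]
  · rw [map_sub, map_sum, sub_eq_zero, hK]
    by_cases hn : n < N
    · rw [Finset.sum_eq_single_of_mem n (Finset.mem_range.2 hn), map_smul]
      intro k _ hk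
      rw [map_smul, cycSum_c_pow, if_neg (by omega), smul_zero]
    · rw [hK0 n (hN n (by omega)), zero_smul, Finset.sum_eq_zero]
      intro k hk
      rw [Finset.mem_range] at hk
      rw [map_smul, cycSum_c_pow, if_neg (by omega), smul_zero]

/-! ### The weight decomposition -/

theorem rightPart_mem_assocWeight (x : Fin 2) {n : ℕ} {f : Assoc} (hf : f ∈ assocWeight (n + 1)) :
    rightPart x f ∈ assocWeight n := by
  induction hf using Submodule.span_induction with
  | mem f hf =>
    obtain ⟨w, hw, rfl⟩ := hf
    rcases freeMonoid_snoc_cases w with rfl | ⟨v, y, rfl⟩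
    · simp at hw
    · rw [rightPart_word_mul]
      split_ifs
      · refine word_mem_assocWeight ?_
        rw [FreeMonoid.length_mul, FreeMonoid.length_of] at hw
        omega
      · exact zero_mem _
  | zero => simp
  | add g g' _ _ h h' => rw [map_add]; exact add_mem h h'
  | smul t g _ h => rw [map_smul]; exact Submodule.smul_mem _ _ h

theorem preDiv_mem_assocWeight {u : Der} {n : ℕ} (hu : u ∈ derWeight (n + 1)) :
    preDiv u ∈ assocWeight n :=
  add_mem (rightPart_mem_assocWeight 0 (toAssoc_mem_assocWeight hu.2.1))
    (rightPart_mem_assocWeight 1 (toAssoc_mem_assocWeight hu.2.2))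

theorem c_pow_mem_assocWeight (k : ℕ) : toAssoc ⁅genA, genB⁆ ^ k ∈ assocWeight (2 * k) := by
  induction k with
  | zero => rw [pow_zero, ← word_one]; exact word_mem_assocWeight FreeMonoid.length_one
  | succ k ih =>
    rw [pow_succ]
    exact mul_mem_assocWeight ih
      (toAssoc_mem_assocWeight (Submodule.subset_span (.lie (.of 0) (.of 1))))

/-- The component of weight `n` of a linear combination of cyclic words. -/
def cycWeight (n : ℕ) : CycWords →ₗ[ℚ] CycWords :=
  Finsupp.linearCombination ℚ fun c => if c.length = n then Finsupp.single c 1 else 0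

theorem cycWeight_tr {m n : ℕ} {f : Assoc} (hf : f ∈ assocWeight m) :
    cycWeight n (tr f) = if m = n then tr f else 0 := by
  induction hf using Submodule.span_induction with
  | mem f hf =>
    obtain ⟨w, rfl, rfl⟩ := hf
    rw [tr_word, cycWeight, Finsupp.linearCombination_single, one_smul, Cycle.length_coe]
    rfl
  | zero => simp
  | add g g' _ _ h h' => rw [map_add, map_add, h, h']; split_ifs <;> simp
  | smul t g _ h => rw [map_smul, map_smul, h]; split_ifs <;> simp

/-- The derivations of weight `n`, as a subspace. -/
def derWeightSubmodule (n : ℕ) : Submodule ℚ Der where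
  carrier := derWeight n
  add_mem' hu hv := ⟨add_mem hu.1 hv.1, add_mem hu.2.1 hv.2.1, add_mem hu.2.2 hv.2.2⟩
  zero_mem' := ⟨zero_mem _, zero_mem _, zero_mem _⟩
  smul_mem' t _ hu := ⟨der11.smul_mem t hu.1, Submodule.smul_mem _ t hu.2.1,
    Submodule.smul_mem _ t hu.2.2⟩

theorem derGeThree_eq_iSup : derGeThree = ⨆ n, derWeightSubmodule (n + 3) := by
  refine le_antisymm (Submodule.span_le.2 ?_) (iSup_le fun n u hu =>
    Submodule.subset_span ⟨n + 3, by omega, hu⟩)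
  rintro u ⟨n, hn, hu⟩
  obtain ⟨m, rfl⟩ : ∃ m, n = m + 3 := ⟨n - 3, by omega⟩
  exact Submodule.mem_iSup_of_mem (p := fun n => derWeightSubmodule (n + 3)) m hu

/-- Compare weights: the component of `u` of weight `n + 3` has divergence of weight `n + 2`,
whereas `tr(c^{k+1})` has weight `2(k + 1)`. At most one power survives for each component, and none
if `n + 3` is even. -/
theorem mem_krv11_of_ellDiv {u : Der} (hu : u ∈ derGeThree) {N : ℕ} {K : ℕ → ℚ}
    (h : ellDiv u = ∑ k ∈ Finset.range N, K k • tr (toAssoc ⁅genA, genB⁆ ^ (k + 1))) :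
    u ∈ krv11 := by
  rw [derGeThree_eq_iSup] at hu
  obtain ⟨v, hv, rfl⟩ := (Submodule.mem_iSup_iff_exists_finsupp _ _).1 hu
  have hdiv : ∀ n, ellDiv (v n) = ∑ k ∈ Finset.range N,
      K k • if 2 * (k + 1) = n + 2 then tr (toAssoc ⁅genA, genB⁆ ^ (k + 1)) else 0 := by
    intro n
    have h1 := congrArg (cycWeight (n + 2)) h
    simp only [map_sum, map_smul, cycWeight_tr (c_pow_mem_assocWeight _)] at h1
    rw [← h1, Finsupp.sum, ellDiv_eq, ellDiv_eq, map_sum, map_sum, map_sum,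
      Finset.sum_congr rfl fun m _ => cycWeight_tr (preDiv_mem_assocWeight (n := m + 2) (hv m))]
    simp only [Nat.add_right_cancel_iff]
    rw [Finset.sum_ite_eq']
    split_ifs with hn
    · rfl
    · rw [Finsupp.notMem_support_iff.1 hn, map_zero, map_zero]
  refine Submodule.sum_mem _ fun n _ => Submodule.subset_span
    ⟨n + 3, by omega, hv n, fun hn => ?_, fun hn => ?_⟩
  · obtain ⟨m, hm⟩ := hn
    -- Here `n + 3 = 2m + 1`, so the required power is `c^m`, which has index `m - 1` because the
    -- sum runs over exponents `k + 1`.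
    refine ⟨if m - 1 < N then K (m - 1) else 0, ?_⟩
    rw [hdiv, show (n + 3 - 1) / 2 = m - 1 + 1 by omega]
    split_ifs with hN
    · rw [Finset.sum_eq_single_of_mem (m - 1) (Finset.mem_range.2 hN), if_pos (by omega)]
      intro k _ hk
      rw [if_neg (by omega), smul_zero]
    · rw [zero_smul]
      refine Finset.sum_eq_zero fun k hk => ?_
      rw [Finset.mem_range] at hk
      rw [if_neg (by omega), smul_zero]
  · obtain ⟨m, hm⟩ := hn
    rw [hdiv]
    refine Finset.sum_eq_zero fun k _ => ?_
    rw [if_neg (by omega), smul_zero]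

/-! ### The correspondence between moulds and derivations -/

theorem krv11_le_derGeThree : krv11 ≤ derGeThree :=
  Submodule.span_mono fun _ ⟨n, hn, hu, _⟩ => ⟨n, hn, hu⟩

theorem exists_mould_of_mem_krv11 {u : Der} (hu : u ∈ krv11) : ∃ F : krvEll, Represents F u := by
  induction hu using Submodule.span_induction with
  | mem u hu =>
    obtain ⟨K, k, hK⟩ := hu.choose_spec.2.2.exists_eq
    obtain ⟨h1, ⟨F, hF1, hF2, hF3⟩, -⟩ :=
      derGeThree_spec (krv11_le_derGeThree (Submodule.subset_span hu))
    exact ⟨⟨F, hF1, isPushInvariant_of_der11 h1 hF3, isCircConstant_of_ellDiv h1 hF3 hK, hF2⟩, hF3⟩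
  | zero => exact ⟨0, (map_zero polyOfMould).trans (map_zero toAssoc).symm⟩
  | add u v _ _ hu hv =>
    obtain ⟨F, hF⟩ := hu
    obtain ⟨G, hG⟩ := hv
    refine ⟨F + G, ?_⟩
    change polyOfMould (F + G) = toAssoc (u genA + v genA)
    rw [map_add, map_add, show polyOfMould F = _ from hF, show polyOfMould G = _ from hG]
  | smul t u _ hu =>
    obtain ⟨F, hF⟩ := hu
    refine ⟨t • F, ?_⟩
    change polyOfMould (t • (F : PolyMould)) = toAssoc (t • u genA)
    rw [map_smul, map_smul, show polyOfMould F = _ from hF]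

theorem exists_mem_krv11_of_mould (F : krvEll) : ∃ u ∈ krv11, Represents F u := by
  obtain ⟨F, h1, h2, h3, h4⟩ := F
  obtain ⟨u, hu, hF⟩ := exists_der_of_mould h1 h2 h4
  obtain ⟨N, K, hK⟩ := ellDiv_eq_of_isCircConstant (derGeThree_spec hu).1 hF h1.1 h3
  exact ⟨u, mem_krv11_of_ellDiv hu hK, hF⟩

/-- The derivation represented by a mould. -/
def derOfMould (F : krvEll) : Der := (exists_mem_krv11_of_mould F).choose

theorem derOfMould_mem (F : krvEll) : derOfMould F ∈ krv11 :=
  (exists_mem_krv11_of_mould F).choose_spec.1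

theorem represents_derOfMould (F : krvEll) : Represents F (derOfMould F) :=
  (exists_mem_krv11_of_mould F).choose_spec.2

theorem eq_derOfMould {F : krvEll} {u : Der} (hu : u ∈ derGeThree) (hF : Represents F u) :
    u = derOfMould F :=
  derGeThree_ext hu (krv11_le_derGeThree (derOfMould_mem F)) hF (represents_derOfMould F)

theorem represents_unique {F G : krvEll} {u : Der} (hF : Represents F u) (hG : Represents G u) :
    F = G :=
  Subtype.ext (polyOfMould_injective (hF.trans hG.symm))

/-- The linear isomorphism between moulds and derivations. -/
def mouldEquiv : krvEll ≃ₗ[ℚ] krvLieSubalgebra where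
  toFun F := ⟨derOfMould F, derOfMould_mem F⟩
  map_add' F G := Subtype.ext <| .symm <| eq_derOfMould
    (krv11_le_derGeThree (add_mem (derOfMould_mem F) (derOfMould_mem G))) <| by
      change polyOfMould (F + G) = toAssoc (derOfMould F genA + derOfMould G genA)
      rw [map_add, map_add, show polyOfMould F = _ from represents_derOfMould F,
        show polyOfMould G = _ from represents_derOfMould G]
  map_smul' t F := Subtype.ext <| .symm <| eq_derOfMould
    (krv11_le_derGeThree (Submodule.smul_mem _ t (derOfMould_mem F))) <| by
      change polyOfMould (t • (F : PolyMould)) = toAssoc (t • derOfMould F genA)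
      rw [map_smul, map_smul, show polyOfMould F = _ from represents_derOfMould F]
  invFun u := (exists_mould_of_mem_krv11 u.2).choose
  left_inv F := represents_unique (exists_mould_of_mem_krv11 (derOfMould_mem F)).choose_spec
    (represents_derOfMould F)
  right_inv u := Subtype.ext
    (eq_derOfMould (krv11_le_derGeThree u.2) (exists_mould_of_mem_krv11 u.2).choose_spec).symm

theorem represents_symm (u : krvLieSubalgebra) : Represents (mouldEquiv.symm u) u :=
  (exists_mould_of_mem_krv11 u.2).choose_spec

/-- The bracket of derivations, transported to moulds. -/
def mouldBracket : LieBracketOn krvEll where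
  br := LinearMap.mk₂ ℚ (fun F G => mouldEquiv.symm ⁅mouldEquiv F, mouldEquiv G⁆)
    (fun F F' G => by rw [map_add, add_lie, map_add])
    (fun t F G => by rw [map_smul, smul_lie, map_smul])
    (fun F G G' => by rw [map_add, lie_add, map_add])
    (fun t F G => by rw [map_smul, lie_smul, map_smul])
  br_self F := by rw [LinearMap.mk₂_apply, lie_self, map_zero]
  jacobi F G H := by
    simp only [LinearMap.mk₂_apply, LinearEquiv.apply_symm_apply]
    rw [← map_add, leibniz_lie]

end EllKV

end

/-! ### The main theorem -/

theorem mainTheorem1 :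
    ∃ (krvLie : LieSubalgebra ℚ Der) (β : LieBracketOn krvEll),
      krvLie.toSubmodule = krv11 ∧
      (∀ F : krvEll, ∃! u : Der, u ∈ derGeThree ∧ Represents F u) ∧
      (∀ (F G : krvEll) (u v : Der), u ∈ derGeThree → v ∈ derGeThree →
        Represents F u → Represents G v → Represents (β.br F G) ⁅u, v⁆) ∧
      letI := β.lieRing
      letI := β.lieAlgebra
      ∃! e : krvLie ≃ₗ⁅ℚ⁆ krvEll, ∀ u : krvLie, Represents (e u) u := by
  refine ⟨krvLieSubalgebra, mouldBracket, rfl, fun F => ?_, fun F G u v hu hv hF hG => ?_, ?_⟩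
  · exact ⟨derOfMould F, ⟨krv11_le_derGeThree (derOfMould_mem F), represents_derOfMould F⟩,
      fun u hu => eq_derOfMould hu.1 hu.2⟩
  · rw [eq_derOfMould hu hF, eq_derOfMould hv hG]
    exact represents_symm ⁅mouldEquiv F, mouldEquiv G⁆
  · let := mouldBracket.lieRing
    let := mouldBracket.lieAlgebra
    let e : krvLieSubalgebra ≃ₗ⁅ℚ⁆ krvEll :=
      { mouldEquiv.symm with
        map_lie' := fun {u v} => by
          change mouldEquiv.symm ⁅u, v⁆ =
            mouldEquiv.symm ⁅mouldEquiv (mouldEquiv.symm u), mouldEquiv (mouldEquiv.symm v)⁆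
          rw [LinearEquiv.apply_symm_apply, LinearEquiv.apply_symm_apply] }
    exact ⟨e, represents_symm, fun e' he' =>
      LieEquiv.ext fun u => represents_unique (he' u) (represents_symm u)⟩
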